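/- **Setting.** Let $\nu,d$ be nonnegative integers and let $X=\mathbf R^d/L$, where either $L=\{0\}$ (so $X=\mathbf R^d$) or $L$ is a lattice of full rank in $\mathbf R^d$ (so $X$ is a torus). On $X$ let $|q|$ be the norm in the Euclidean case and the distance from $q$ to the origin in the case of a torus. Let $\Omega=(X\times\mathbf R^d)^{\mathbf Z^\nu}$, with elements $(q_i,p_i)_{i\in\mathbf Z^\nu}$ and the product $\sigma$-algebra, and let $(\mathsf T_i^*\omega)_j=\omega_{j+i}$ (also for families of positions only). On $\mathbf Z^\nu$ let $|i|$ be the sup norm. A family of interactions is a function $W_\Delta:X^\Delta\to\mathbf R$ for every finite $\Delta\subset\mathbf Z^\nu$; $W_\Delta$ is also regarded as a function on $X^{\mathbf Z^\nu}$ and on $\Omega$. Let $\gamma(i,j)\in\{0,1,\dots,\infty\}$ be the graph distance on $\mathbf Z^\nu$ for which two distinct sites are adjacent if and only if both belong to some finite $\Delta$ with $W_\Delta\not\equiv0$. Assume: * (F) there is $D\in\mathbf N$ such that $\gamma(i,j)>1$ whenever $|i-j|>D$; * (R) every $W_\Delta$ is twice continuously differentiable; * (TI) $W_{\Delta+i}=W_\Delta\circ\mathsf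 T_i^*$ for all $i$ and all finite $\Delta$; * (P1) $W_{\{i\}}\ge0$ for all $i$; * (P2) there are constants $a,b$ such that, for all $i$ and $z\ge0$, the set $L_i(z)=\{x\in X: W_{\{i\}}(x)\le z\}$ is compact and $\operatorname{conv}(L_i(z))\subseteq L_i(az+b)$, where $\operatorname{conv}$ is the convex hull if $X=\mathbf R^d$, and $\operatorname{conv}(S)=X$ for every nonempty $S$ if $X$ is a torus; * (P3) there is a constant $C_0$ with $|q_i|\le C_0W_{\{i\}}(q_i)$ for all $i$ and all $q_i\in X$; * (D1)–(D3) there are constants $C_1,C_2,C_3$ such that, for all $i\in\mathbf Z^\nu$, all finite $\Lambda\subset\mathbf Z^\nu$ and all $\mathbf q\in X^{\mathbf Z^\nu}$, with $V_{i,\Lambda}(\mathbf q)=\sum_{j\in\Lambda,\ \gamma(i,j)\le1}W_{\{j\}}(q_j)$, $$\Big|\sum_{\{i\}\subsetneq\Delta\subseteq\Lambda}\partial_{q_i}W_\Delta(\mathbf q)\Big|^2\le C_1V_{i,\Lambda}(\mathbf q),\qquad \Big|\sum_{\{i\}\subsetneq\Delta\subseteq\Lambda}W_\Delta(\mathbf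 q)\Big|\le C_2V_{i,\Lambda}(\mathbf q),$$ $$\Big\|\sum_{\{i\}\subseteq\Delta\subseteq\Lambda}\partial_{q_j}\partial_{q_i}W_\Delta(\mathbf q)\Big\|\le C_3V_{i,\Lambda}(\mathbf q)\quad\text{for all }j\in\Lambda .$$ Put $$E_i^{\rm n.i.}=\tfrac12|p_i|^2+W_{\{i\}},\qquad E_i=\tfrac12|p_i|^2+\sum_{\Delta\ni i}\frac{1}{\#\Delta}W_\Delta .$$ For $r>0$ let $\mathfrak B_r$ be the set of all $\omega\in\Omega$ for which there is $C>0$ with $|E_i^{\rm n.i.}(\omega)|\le C(1+|i|)^r$ for all $i$, and let $\Omega_2=\bigcup_{0<r<2}\mathfrak B_r$. Let $\mathcal I_2$ be the set of probability measures $\mu$ on $\Omega$ that are invariant under all $\mathsf T_i^*$, $i\in\mathbf Z^\nu$, and satisfy $\int|E_0^{\rm n.i.}|^\zeta\,d\mu<\infty$ for some $\zeta>\max\{1,\nu/2\}$. **Proposition (conservation of energy under time evolution).** For every $\omega\in\Omega_2$ the equations of motion $$\dot q_i=p_i,\qquad \dot p_i=-\sum_{\Delta}\partial_{q_i}W_\Delta(\mathbf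 q)\qquad(i\in\mathbf Z^\nu)$$ have exactly one solution on $\mathbf R$ that equals $\omega$ at time $0$ and remains in $\mathfrak B_r$ for some $r\in(0,2)$. Let $\tau_t(\omega)$ be the value of this solution at time $t$, and let $\tau_t(\omega)=\omega$ for $\omega\notin\Omega_2$. If $\mu\in\mathcal I_2$, then $E_0$ and $E_0\circ\tau_t$ are $\mu$-integrable and $$\int E_0\,d\mu=\int E_0\circ\tau_t\,d\mu\qquad\text{for all }t\in\mathbf R .$$ -/

import Mathlib

open MeasureTheory

namespace AnharmonicCrystal

/-- The lattice `ℤ^ν`; its norm `‖i‖` is the sup norm. -/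
abbrev Site (ν : ℕ) := Fin ν → ℤ

/-- The space of momenta of one particle, which is also the tangent space of the one-particle
configuration space. -/
abbrev Mom (d : ℕ) := EuclideanSpace ℝ (Fin d)

/-- The one-particle configuration space `ℝ^d / L`. It is used for `L = 0` (Euclidean space) and for
`L` a lattice of full rank (torus). Its norm is the quotient norm: `|q|` in the Euclidean case, the
distance to the origin in the case of a torus. -/
abbrev Pos {d : ℕ} (L : AddSubgroup (Mom d)) := Mom d ⧸ L

/-- `ℝ^d / L` is a Euclidean space or a torus. -/
def IsEuclideanOrTorus {d : ℕ} (L : AddSubgroup (Mom d)) : Prop :=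
  L = ⊥ ∨ (DiscreteTopology L ∧ Submodule.span ℝ (L : Set (Mom d)) = ⊤)

/-- The state space `Ω`: an element assigns to each site a point `(q, p)` of the (trivial) cotangent
bundle `T^*(ℝ^d / L) = (ℝ^d / L) × ℝ^d`. It carries the product `σ`-algebra. -/
abbrev Phase (ν : ℕ) {d : ℕ} (L : AddSubgroup (Mom d)) := Site ν → Pos L × Mom d

/-- A family of interactions: a function of the positions `(q_j)_{j ∈ Δ}` for each finite `Δ`. -/
abbrev Interaction (ν : ℕ) {d : ℕ} (L : AddSubgroup (Mom d)) :=
  (Δ : Finset (Site ν)) → ({j // j ∈ Δ} → Pos L) → ℝ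

section

variable {ν d : ℕ} {L : AddSubgroup (Mom d)}

/-- The positions of a point of the state space. -/
def positions (ω : Phase ν L) : Site ν → Pos L := fun j => (ω j).1

/-- `W_Δ` seen as a function of all positions. -/
def Interaction.ext (W : Interaction ν L) (Δ : Finset (Site ν)) (q : Site ν → Pos L) : ℝ :=
  W Δ (fun j => q j)

/-- The partial gradient `∂_{q_i} f`. -/
noncomputable def pgrad (i : Site ν) (f : (Site ν → Pos L) → ℝ) (q : Site ν → Pos L) : Mom d :=
  gradient (fun v : Mom d => f (Function.update q i (q i + (v : Pos L)))) 0

/-- The mixed second derivative `∂_{q_j} ∂_{q_i} f`, as an endomorphism of `ℝ^d`. -/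
noncomputable def phess (j i : Site ν) (f : (Site ν → Pos L) → ℝ) (q : Site ν → Pos L) :
    Mom d →L[ℝ] Mom d :=
  fderiv ℝ (fun v : Mom d => pgrad i f (Function.update q j (q j + (v : Pos L)))) 0

/-- Two different sites are adjacent if they belong to a common `Δ` with `W_Δ` not identically
zero. -/
def Interaction.graph (W : Interaction ν L) : SimpleGraph (Site ν) where
  Adj i j := i ≠ j ∧ ∃ Δ : Finset (Site ν), i ∈ Δ ∧ j ∈ Δ ∧ W Δ ≠ 0
  symm := ⟨fun _ _ h => ⟨h.1.symm, h.2.imp fun _ hΔ => ⟨hΔ.2.1, hΔ.1, hΔ.2.2⟩⟩⟩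
  loopless := ⟨fun _ h => h.1 rfl⟩

/-- The interaction distance `γ(i, j)`. -/
noncomputable def Interaction.dist (W : Interaction ν L) (i j : Site ν) : ℕ∞ := W.graph.edist i j

/-- The translate `Δ + i`. -/
def translate (i : Site ν) (Δ : Finset (Site ν)) : Finset (Site ν) :=
  Δ.map (addRightEmbedding i)

/-- The map `T^*_i` on the state space. -/
def shift (i : Site ν) (ω : Phase ν L) : Phase ν L := fun j => ω (j + i)

/-- (F) finite range. -/
def FiniteRange (W : Interaction ν L) : Prop :=
  ∃ D : ℕ, ∀ i j : Site ν, (D : ℝ) < ‖i - j‖ → 1 < W.dist i j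

/-- (R) every `W_Δ` is of class `C²`; on `(ℝ^d / L)^Δ` this means that the lift to `(ℝ^d)^Δ` is. -/
def Regular (W : Interaction ν L) : Prop :=
  ∀ Δ : Finset (Site ν), ContDiff ℝ 2 (fun x : {j // j ∈ Δ} → Mom d => W Δ (fun j => (x j : Pos L)))

/-- (TI) translation invariance: `W_{Δ + i}(q) = W_Δ((q_{j + i})_j)`. -/
def TranslationInvariant (W : Interaction ν L) : Prop :=
  ∀ (i : Site ν) (Δ : Finset (Site ν)) (q : Site ν → Pos L),
    W.ext (translate i Δ) q = W.ext Δ (fun j => q (j + i))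

/-- The on-site potential `W_{{i}}` as a function of `q_i`. -/
def Interaction.onSite (W : Interaction ν L) (i : Site ν) (x : Pos L) : ℝ := W {i} (fun _ => x)

/-- (P1) nonnegative on-site potentials. -/
def OnSiteNonneg (W : Interaction ν L) : Prop := ∀ i x, 0 ≤ W.onSite i x

/-- The sublevel set `{x | W_{{i}}(x) ≤ z}`. -/
def sublevel (W : Interaction ν L) (i : Site ν) (z : ℝ) : Set (Pos L) := {x | W.onSite i x ≤ z}

/-- The convex hull in `ℝ^d / L`: the image of the convex hull of the preimage in `ℝ^d`. For `L = 0`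
this is the usual convex hull; if `L` spans `ℝ^d`, the convex hull of a nonempty set is the whole
torus. -/
def conv (S : Set (Pos L)) : Set (Pos L) :=
  (fun v : Mom d => (v : Pos L)) '' convexHull ℝ ((fun v : Mom d => (v : Pos L)) ⁻¹' S)

/-- (P2) compact sublevel sets with controlled convex hulls. -/
def PinningConv (W : Interaction ν L) : Prop :=
  ∃ a b : ℝ, ∀ i, ∀ z : ℝ, 0 ≤ z →
    IsCompact (sublevel W i z) ∧ conv (sublevel W i z) ⊆ sublevel W i (a * z + b)

/-- (P3) the on-site potentials dominate `|q_i|`. -/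
def PinningGrowth (W : Interaction ν L) : Prop :=
  ∃ C₀ : ℝ, ∀ i (x : Pos L), ‖x‖ ≤ C₀ * W.onSite i x

open scoped Classical in
/-- The sum of the on-site potentials over the sites of `Λ` at interaction distance at most one
from `i`. -/
noncomputable def nearbyPinning (W : Interaction ν L) (i : Site ν) (Λ : Finset (Site ν))
    (q : Site ν → Pos L) : ℝ :=
  ∑ j ∈ Λ with W.dist i j ≤ 1, W.onSite j (q j)

open scoped Classical in
/-- (D1) the interaction forces are dominated by the on-site potentials. -/
def ForceDominated (W : Interaction ν L) : Prop :=
  ∃ C₁ : ℝ, ∀ (i : Site ν) (Λ : Finset (Site ν)) (q : Site ν → Pos L),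
    ‖∑ Δ ∈ Λ.powerset with {i} ⊂ Δ, pgrad i (W.ext Δ) q‖ ^ 2 ≤ C₁ * nearbyPinning W i Λ q

open scoped Classical in
/-- (D2) the interaction energies are dominated by the on-site potentials. -/
def EnergyDominated (W : Interaction ν L) : Prop :=
  ∃ C₂ : ℝ, ∀ (i : Site ν) (Λ : Finset (Site ν)) (q : Site ν → Pos L),
    |∑ Δ ∈ Λ.powerset with {i} ⊂ Δ, W.ext Δ q| ≤ C₂ * nearbyPinning W i Λ q

open scoped Classical in
/-- (D3) the second derivatives are dominated by the on-site potentials. -/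
def HessianDominated (W : Interaction ν L) : Prop :=
  ∃ C₃ : ℝ, ∀ (i : Site ν) (Λ : Finset (Site ν)) (q : Site ν → Pos L), ∀ j ∈ Λ,
    ‖∑ Δ ∈ Λ.powerset with {i} ⊆ Δ, phess j i (W.ext Δ) q‖ ≤ C₃ * nearbyPinning W i Λ q

/-- The noninteracting local energy `E_i^{n.i.}`. -/
noncomputable def energyNI (W : Interaction ν L) (i : Site ν) (ω : Phase ν L) : ℝ :=
  1 / 2 * ‖(ω i).2‖ ^ 2 + W.onSite i (ω i).1

/-- The local energy `E_i`. The sum has finitely many nonzero terms if the interactions have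
finite range. -/
noncomputable def energy (W : Interaction ν L) (i : Site ν) (ω : Phase ν L) : ℝ :=
  1 / 2 * ‖(ω i).2‖ ^ 2 +
    ∑ᶠ (Δ : Finset (Site ν)) (_ : i ∈ Δ), 1 / (Δ.card : ℝ) * W.ext Δ (positions ω)

/-- The set `𝔅_{r,C}`. -/
def growthSetWith (W : Interaction ν L) (r C : ℝ) : Set (Phase ν L) :=
  {ω | ∀ i, |energyNI W i ω| ≤ C * (1 + ‖i‖) ^ r}

/-- The set `𝔅_r`. -/
def growthSet (W : Interaction ν L) (r : ℝ) : Set (Phase ν L) :=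
  {ω | ∃ C : ℝ, 0 < C ∧ ω ∈ growthSetWith W r C}

/-- The set `Ω_2`. -/
def Omega2 (W : Interaction ν L) : Set (Phase ν L) :=
  {ω | ∃ r : ℝ, 0 < r ∧ r < 2 ∧ ω ∈ growthSet W r}

/-- The equations of motion on `ℝ`. The velocity of a curve in `ℝ^d / L` is the derivative of a
lift of that curve to `ℝ^d`. The sum of forces has finitely many nonzero terms if the interactions
have finite range. -/
def SolvesMotion (W : Interaction ν L) (y : ℝ → Phase ν L) : Prop :=
  ∀ i : Site ν,
    (∃ Q : ℝ → Mom d, (∀ t, (Q t : Pos L) = (y t i).1) ∧ ∀ t, HasDerivAt Q (y t i).2 t) ∧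
    ∀ t, HasDerivAt (fun s => (y s i).2)
      (-∑ᶠ Δ : Finset (Site ν), pgrad i (W.ext Δ) (positions (y t))) t

/-- The solutions of the equations of motion that remain in `𝔅_r` for some `r ∈ (0, 2)`. -/
def IsTrajectory (W : Interaction ν L) (y : ℝ → Phase ν L) : Prop :=
  SolvesMotion W y ∧ ∃ r : ℝ, 0 < r ∧ r < 2 ∧ ∀ t, y t ∈ growthSet W r

open scoped Classical in
/-- The time evolution `τ_t`: it follows the trajectory through the given point, and it is the
identity outside `Ω_2`, where there is no trajectory. -/
noncomputable def flow (W : Interaction ν L) (t : ℝ) (ω : Phase ν L) : Phase ν L :=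
  if h : ∃ y : ℝ → Phase ν L, IsTrajectory W y ∧ y 0 = ω then h.choose t else ω

/-- The moment `𝔐_ζ(μ)` of the noninteracting local energy. -/
noncomputable def moment (W : Interaction ν L) (ζ : ℝ) (μ : Measure (Phase ν L)) : ENNReal :=
  ∫⁻ ω, ENNReal.ofReal (|energyNI W 0 ω| ^ ζ) ∂μ

/-- The set `𝓘_2` of translation-invariant probability measures with a finite moment of an order
`ζ > max {1, ν / 2}`. -/
structure MemI2 (W : Interaction ν L) (μ : Measure (Phase ν L)) : Prop where
  prob : IsProbabilityMeasure μ
  invariant : ∀ i : Site ν, μ.map (shift i) = μ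
  finite_moment : ∃ ζ : ℝ, max 1 ((ν : ℝ) / 2) < ζ ∧ moment W ζ μ < ⊤

end

end AnharmonicCrystal

/-! Along a trajectory `E_0` changes at the rate `flux`: the sum over the clusters `Δ ∋ 0` of the
average over `k ∈ Δ` of `⟨∂_k W_Δ, p_k⟩`, minus `⟨∂_0 W_Δ, p_0⟩`. Under a shift-invariant law the
term of `k` in `Δ` has the same mean as the term of `0` in `Δ - k`, so the mean flux vanishes by
mass transport (`sum_clusters_average`). The measure need not be invariant in time: the flow
commutes with shifts (`flow_shift`), so the law at time `t` is still shift invariant, and `∫ E_0 ∘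
τ_t` has derivative zero at every `t`.

Differentiating under the integral needs a majorant. In the derivative of the noninteracting energy
`e_i` the on-site force cancels, and (D1) leaves `|e_i'| ≤ K ∑ e_j` with `j` near `i`. Iteration
bounds `e_i(t)` by the exponential series of the neighborhood sum, applied to the initial energies
(`le_tsum_iterate_nsum`). By stationarity each neighborhood sum multiplies the mean by one fixed
number, so this series is integrable (`exists_integrable_bound`).

For the dynamics, (P2) and (D3) make the forces Lipschitz with constants of order `(1 + |i|)^r`. The
equation is of second order, so `k` iterations produce about `k` such factors, of size `(k!)^r` up
to exponentials, against `T^(2k) / (2k)!`; this tends to zero because `r < 2` (`comparison`). Both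
uniqueness and the convergence of finite-box approximations follow. Uniqueness also needs energy
bounds uniform in time, which Baire category extracts from membership in `𝔅_r` at each single time
(`locally_bounded_of_pointwise_bounded`). The finite systems are slowed down at high energy, so that
they have global flows; the energy bounds do not notice the slowdown. Finally, a moment of order `ζ
> ν / 2` puts almost every point into `Ω_2` (`ae_mem_Omega2`). -/

namespace AnharmonicCrystal

open scoped InnerProductSpace Nat NNReal

/-! ### Derivatives of the interactions, computed on lifts to `ℝ^d` -/

section Calculus

variable {ν d : ℕ} {L : AddSubgroup (Mom d)} {W : Interaction ν L}

/-- The projection of a configuration of lifts to a configuration of positions. -/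
def proj (L : AddSubgroup (Mom d)) (q : Site ν → Mom d) : Site ν → Pos L := fun j => (q j : Pos L)

/-- The lift of `W_Δ` to `(ℝ^d)^Δ`. -/
def Interaction.lift (W : Interaction ν L) (Δ : Finset (Site ν)) (x : {j // j ∈ Δ} → Mom d) : ℝ :=
  W Δ (fun j => (x j : Pos L))

/-- The partial gradient of the lift of `W_Δ`. -/
noncomputable def Interaction.liftGrad (W : Interaction ν L) (Δ : Finset (Site ν))
    (i : {j // j ∈ Δ}) (x : {j // j ∈ Δ} → Mom d) : Mom d :=
  (InnerProductSpace.toDual ℝ (Mom d)).symm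
    ((fderiv ℝ (W.lift Δ) x).comp (ContinuousLinearMap.single ℝ (fun _ : {j // j ∈ Δ} => Mom d) i))

theorem Interaction.ext_proj (W : Interaction ν L) (Δ : Finset (Site ν)) (q : Site ν → Mom d) :
    W.ext Δ (proj L q) = W.lift Δ (fun j => q j) := rfl

theorem update_proj (q : Site ν → Mom d) (i : Site ν) (v : Mom d) :
    Function.update (proj L q) i (proj L q i + (v : Pos L)) =
      proj L (Function.update q i (q i + v)) := by
  funext j
  by_cases h : j = i
  · subst h; simp [proj]
  · simp [proj, h]

theorem restrict_update_of_mem {Δ : Finset (Site ν)} {i : Site ν} (hi : i ∈ Δ)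
    (q : Site ν → Mom d) (v : Mom d) :
    (fun j : {j // j ∈ Δ} => Function.update q i (q i + v) j) =
      (fun j : {j // j ∈ Δ} => q j) +
        ContinuousLinearMap.single ℝ (fun _ : {j // j ∈ Δ} => Mom d) ⟨i, hi⟩ v := by
  funext j
  by_cases h : j = ⟨i, hi⟩
  · subst h; simp
  · have h' : (j : Site ν) ≠ i := fun e => h (Subtype.ext e)
    simp [h, h']

theorem ext_update_of_notMem {Δ : Finset (Site ν)} {i : Site ν} (hi : i ∉ Δ)
    (q : Site ν → Pos L) (x : Pos L) : W.ext Δ (Function.update q i x) = W.ext Δ q := by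
  unfold Interaction.ext
  congr 1
  funext j
  have : (j : Site ν) ≠ i := fun e => hi (e ▸ j.2)
  simp [this]

theorem pgrad_of_notMem {Δ : Finset (Site ν)} {i : Site ν} (hi : i ∉ Δ) (q : Site ν → Pos L) :
    pgrad i (W.ext Δ) q = 0 := by
  unfold pgrad
  simp only [ext_update_of_notMem hi]
  exact gradient_fun_const _ _

theorem pgrad_congr {Δ : Finset (Site ν)} {i : Site ν} {q q' : Site ν → Pos L}
    (h : ∀ j ∈ Δ, q j = q' j) : pgrad i (W.ext Δ) q = pgrad i (W.ext Δ) q' := by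
  by_cases hi : i ∈ Δ
  · unfold pgrad
    congr 1
    funext v
    unfold Interaction.ext
    congr 1
    funext j
    by_cases hj : (j : Site ν) = i
    · subst hj; simp [h _ hi]
    · simp [hj, h _ j.2]
  · rw [pgrad_of_notMem hi, pgrad_of_notMem hi]

theorem phess_of_notMem_left {Δ : Finset (Site ν)} {i j : Site ν} (hj : j ∉ Δ)
    (q : Site ν → Pos L) : phess j i (W.ext Δ) q = 0 := by
  unfold phess
  have : (fun v : Mom d => pgrad i (W.ext Δ) (Function.update q j (q j + (v : Pos L)))) =
      fun _ => pgrad i (W.ext Δ) q := by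
    funext v
    apply pgrad_congr
    intro k hk
    have : k ≠ j := fun e => hj (e ▸ hk)
    simp [this]
  rw [this]
  simp

theorem pgrad_zero (i : Site ν) (q : Site ν → Pos L) {Δ : Finset (Site ν)} (h : W Δ = 0) :
    pgrad i (W.ext Δ) q = 0 := by
  have : W.ext Δ = fun _ => 0 := by funext q; simp [Interaction.ext, h]
  unfold pgrad
  simp only [this]
  exact gradient_fun_const _ _

theorem lift_contDiff (hR : Regular W) (Δ : Finset (Site ν)) : ContDiff ℝ 2 (W.lift Δ) := hR Δ

theorem liftGrad_contDiff (hR : Regular W) (Δ : Finset (Site ν)) (i : {j // j ∈ Δ}) :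
    ContDiff ℝ 1 (W.liftGrad Δ i) := by
  have h1 : ContDiff ℝ 1 (fderiv ℝ (W.lift Δ)) :=
    (lift_contDiff hR Δ).fderiv_right (by norm_num [one_add_one_eq_two])
  exact (InnerProductSpace.toDual ℝ (Mom d)).symm.toContinuousLinearEquiv.contDiff.comp
    (h1.clm_comp contDiff_const)

theorem pgrad_of_mem (hR : Regular W) {Δ : Finset (Site ν)} {i : Site ν} (hi : i ∈ Δ)
    (q : Site ν → Mom d) :
    pgrad i (W.ext Δ) (proj L q) = W.liftGrad Δ ⟨i, hi⟩ (fun j => q j) := by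
  unfold pgrad Interaction.liftGrad gradient
  congr 1
  simp only [update_proj, W.ext_proj, restrict_update_of_mem hi]
  have h := ((lift_contDiff hR Δ).differentiable (by norm_num)
    ((fun j : {j // j ∈ Δ} => q j))).hasFDerivAt
  have h2 : HasFDerivAt (fun v : Mom d => (fun j : {j // j ∈ Δ} => q j) +
      ContinuousLinearMap.single ℝ (fun _ : {j // j ∈ Δ} => Mom d) ⟨i, hi⟩ v)
      (ContinuousLinearMap.single ℝ (fun _ : {j // j ∈ Δ} => Mom d) ⟨i, hi⟩) 0 :=
    (ContinuousLinearMap.hasFDerivAt _).const_add _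
  have h3 := HasFDerivAt.comp (0 : Mom d) (by simpa using h) h2
  exact h3.fderiv

theorem phess_of_mem (hR : Regular W) {Δ : Finset (Site ν)} {i j : Site ν} (hi : i ∈ Δ)
    (hj : j ∈ Δ) (q : Site ν → Mom d) :
    phess j i (W.ext Δ) (proj L q) = (fderiv ℝ (W.liftGrad Δ ⟨i, hi⟩) (fun j => q j)).comp
      (ContinuousLinearMap.single ℝ (fun _ : {j // j ∈ Δ} => Mom d) ⟨j, hj⟩) := by
  unfold phess
  simp only [update_proj, pgrad_of_mem hR hi, restrict_update_of_mem hj]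
  have h := ((liftGrad_contDiff hR Δ ⟨i, hi⟩).differentiable (by norm_num)
    ((fun j : {j // j ∈ Δ} => q j))).hasFDerivAt
  have h2 : HasFDerivAt (fun v : Mom d => (fun j : {j // j ∈ Δ} => q j) +
      ContinuousLinearMap.single ℝ (fun _ : {j // j ∈ Δ} => Mom d) ⟨j, hj⟩ v)
      (ContinuousLinearMap.single ℝ (fun _ : {j // j ∈ Δ} => Mom d) ⟨j, hj⟩) 0 :=
    (ContinuousLinearMap.hasFDerivAt _).const_add _
  have h3 := HasFDerivAt.comp (0 : Mom d) (by simpa using h) h2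
  exact h3.fderiv

theorem clm_apply_eq_sum_single {ι E F : Type*} [Fintype ι] [DecidableEq ι]
    [NormedAddCommGroup E] [NormedSpace ℝ E] [NormedAddCommGroup F] [NormedSpace ℝ F]
    (A : (ι → E) →L[ℝ] F) (u : ι → E) :
    A u = ∑ k, A (ContinuousLinearMap.single ℝ (fun _ : ι => E) k (u k)) := by
  rw [← map_sum]
  congr 1
  funext k
  simp [Finset.sum_apply, Pi.single_apply]

/-- Chain rule on the finite-dimensional lift; only the coordinates in `Δ` have to be
differentiable, so nothing is asked of the infinite configuration. -/
theorem hasDerivAt_ext (hR : Regular W) (Δ : Finset (Site ν)) {Q : ℝ → Site ν → Mom d}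
    {Q' : Site ν → Mom d} {t : ℝ} (hQ : ∀ k ∈ Δ, HasDerivAt (fun s => Q s k) (Q' k) t) :
    HasDerivAt (fun s => W.ext Δ (proj L (Q s)))
      (∑ k ∈ Δ, ⟪pgrad k (W.ext Δ) (proj L (Q t)), Q' k⟫_ℝ) t := by
  have h := ((lift_contDiff hR Δ).differentiable (by norm_num)
    ((fun j : {j // j ∈ Δ} => Q t j))).hasFDerivAt
  have h1 : HasDerivAt (fun s => fun j : {j // j ∈ Δ} => Q s j) (fun j : {j // j ∈ Δ} => Q' j) t :=
    hasDerivAt_pi.2 fun j => hQ j j.2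
  have h2 := h.comp_hasDerivAt t h1
  rw [clm_apply_eq_sum_single] at h2
  rw [← Finset.sum_attach]
  refine h2.congr_deriv ?_
  rw [Finset.univ_eq_attach]
  refine Finset.sum_congr rfl fun k _ => ?_
  rw [pgrad_of_mem hR k.2]
  simp [Interaction.liftGrad, InnerProductSpace.toDual_symm_apply]

theorem hasDerivAt_pgrad (hR : Regular W) (Δ : Finset (Site ν)) (i : Site ν)
    {Q : ℝ → Site ν → Mom d} {Q' : Site ν → Mom d} {t : ℝ}
    (hQ : ∀ k ∈ Δ, HasDerivAt (fun s => Q s k) (Q' k) t) :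
    HasDerivAt (fun s => pgrad i (W.ext Δ) (proj L (Q s)))
      (∑ k ∈ Δ, phess k i (W.ext Δ) (proj L (Q t)) (Q' k)) t := by
  by_cases hi : i ∈ Δ
  · have h := ((liftGrad_contDiff hR Δ ⟨i, hi⟩).differentiable (by norm_num)
      ((fun j : {j // j ∈ Δ} => Q t j))).hasFDerivAt
    have h1 : HasDerivAt (fun s => fun j : {j // j ∈ Δ} => Q s j)
        (fun j : {j // j ∈ Δ} => Q' j) t := hasDerivAt_pi.2 fun j => hQ j j.2
    have h2 := h.comp_hasDerivAt t h1
    rw [clm_apply_eq_sum_single] at h2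
    rw [← Finset.sum_attach]
    simp only [pgrad_of_mem hR hi]
    refine h2.congr_deriv ?_
    rw [Finset.univ_eq_attach]
    refine Finset.sum_congr rfl fun k _ => ?_
    rw [phess_of_mem hR hi k.2]
    rfl
  · have h0 : ∀ q : Site ν → Pos L, pgrad i (W.ext Δ) q = 0 := pgrad_of_notMem hi
    have h1 : ∀ k q, phess k i (W.ext Δ) q = 0 := by
      intro k q
      unfold phess
      simp [h0]
    simp only [h0, h1]
    simpa using hasDerivAt_const t (0 : Mom d)

theorem contDiff_ext (hR : Regular W) (Δ : Finset (Site ν)) {E : Type*} [NormedAddCommGroup E]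
    [NormedSpace ℝ E] {q : E → Site ν → Mom d} (hq : ∀ j, ContDiff ℝ 2 (fun x => q x j)) :
    ContDiff ℝ 2 (fun x => W.ext Δ (proj L (q x))) :=
  (lift_contDiff hR Δ).comp (contDiff_pi.2 fun j : {j // j ∈ Δ} => hq j)

theorem contDiff_pgrad (hR : Regular W) (Δ : Finset (Site ν)) (i : Site ν) {E : Type*}
    [NormedAddCommGroup E] [NormedSpace ℝ E] {q : E → Site ν → Mom d}
    (hq : ∀ j, ContDiff ℝ 1 (fun x => q x j)) :
    ContDiff ℝ 1 (fun x => pgrad i (W.ext Δ) (proj L (q x))) := by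
  by_cases hi : i ∈ Δ
  · simp only [pgrad_of_mem hR hi]
    exact (liftGrad_contDiff hR Δ ⟨i, hi⟩).comp (contDiff_pi.2 fun j : {j // j ∈ Δ} => hq j)
  · simp only [pgrad_of_notMem hi]
    exact contDiff_const

theorem continuous_ext (hR : Regular W) (Δ : Finset (Site ν)) :
    Continuous (fun q : Site ν → Mom d => W.ext Δ (proj L q)) :=
  (lift_contDiff hR Δ).continuous.comp
    (continuous_pi fun j : {j // j ∈ Δ} => continuous_apply (j : Site ν))

theorem continuous_pgrad (hR : Regular W) (Δ : Finset (Site ν)) (i : Site ν) :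
    Continuous (fun q : Site ν → Mom d => pgrad i (W.ext Δ) (proj L q)) := by
  by_cases hi : i ∈ Δ
  · simp only [pgrad_of_mem hR hi]
    exact (liftGrad_contDiff hR Δ ⟨i, hi⟩).continuous.comp
      (continuous_pi fun j : {j // j ∈ Δ} => continuous_apply (j : Site ν))
  · simp only [pgrad_of_notMem hi]
    exact continuous_const

end Calculus

/-! ### Differential inequalities for infinite families, and a Baire argument -/

section RealAnalysis

open Set Filter Topology

theorem norm_le_of_norm_deriv_le {E : Type*} [NormedAddCommGroup E] [NormedSpace ℝ E]
    {f f' : ℝ → E} {B B' : ℝ → ℝ} {T : ℝ}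
    (hf : ∀ t ∈ Icc 0 T, HasDerivAt f (f' t) t) (h0 : ‖f 0‖ ≤ B 0)
    (hB : ∀ t, HasDerivAt B (B' t) t) (hb : ∀ t ∈ Icc 0 T, ‖f' t‖ ≤ B' t) :
    ∀ t ∈ Icc 0 T, ‖f t‖ ≤ B t := fun _ ht =>
  image_norm_le_of_norm_deriv_right_le_deriv_boundary
    (fun s hs => (hf s hs).continuousAt.continuousWithinAt)
    (fun s hs => (hf s ⟨hs.1, hs.2.le⟩).hasDerivWithinAt) h0 hB
    (fun s hs => hb s ⟨hs.1, hs.2.le⟩) ht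

/-- Negative times reduce to positive ones by reversing time. -/
theorem norm_le_of_norm_deriv_le_abs {E : Type*} [NormedAddCommGroup E] [NormedSpace ℝ E]
    {f f' : ℝ → E} {B B' : ℝ → ℝ} {T : ℝ}
    (hf : ∀ t, |t| ≤ T → HasDerivAt f (f' t) t) (h0 : ‖f 0‖ ≤ B 0)
    (hB : ∀ t, HasDerivAt B (B' t) t) (hb : ∀ t, |t| ≤ T → ‖f' t‖ ≤ B' |t|) :
    ∀ t, |t| ≤ T → ‖f t‖ ≤ B |t| := by
  intro t ht
  rcases le_total 0 t with h | h
  · rw [abs_of_nonneg h]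
    refine norm_le_of_norm_deriv_le (T := T) (fun s hs => hf s ?_) h0 hB (fun s hs => ?_) t
      ⟨h, by rwa [abs_of_nonneg h] at ht⟩
    · rw [abs_of_nonneg hs.1]; exact hs.2
    · have := hb s (by rw [abs_of_nonneg hs.1]; exact hs.2)
      rwa [abs_of_nonneg hs.1] at this
  · rw [abs_of_nonpos h]
    have hd : ∀ s ∈ Icc 0 T, HasDerivAt (fun u => f (-u)) (-f' (-s)) s := by
      intro s hs
      have h1 := hf (-s) (by rw [abs_neg, abs_of_nonneg hs.1]; exact hs.2)
      have := h1.scomp s (hasDerivAt_neg s)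
      simpa [Function.comp_def] using this
    have := norm_le_of_norm_deriv_le (T := T) (B := B) hd (by simpa using h0) hB (fun s hs => ?_)
      (-t) ⟨by linarith, by rwa [abs_of_nonpos h] at ht⟩
    · simpa using this
    · have := hb (-s) (by rw [abs_neg, abs_of_nonneg hs.1]; exact hs.2)
      rw [abs_neg, abs_of_nonneg hs.1] at this
      simpa using this

/-- The terms of the exponential series reproduce themselves under integration, which drives every
iteration below. -/
theorem hasDerivAt_pow_div_factorial (K : ℝ) (k : ℕ) (x : ℝ) :
    HasDerivAt (fun x => (K * x) ^ (k + 1) / (k + 1)!) (K * ((K * x) ^ k / k !)) x := by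
  have h : HasDerivAt (fun x : ℝ => K * x) K x := by simpa using (hasDerivAt_id x).const_mul K
  have h1 := (h.pow (k + 1)).div_const ((k + 1)! : ℝ)
  refine h1.congr_deriv ?_
  rw [Nat.factorial_succ]
  push_cast
  have : (k ! : ℝ) ≠ 0 := by positivity
  field_simp

/-- Summation over neighborhoods. -/
def nsum {ι : Type*} (N : ι → Finset ι) (f : ι → ℝ) (i : ι) : ℝ := ∑ j ∈ N i, f j

theorem nsum_mono {ι : Type*} {N : ι → Finset ι} {f g : ι → ℝ} (h : ∀ i, f i ≤ g i) (i : ι) :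
    nsum N f i ≤ nsum N g i := Finset.sum_le_sum fun j _ => h j

theorem iterate_nsum_nonneg {ι : Type*} {N : ι → Finset ι} {f : ι → ℝ} (h : ∀ i, 0 ≤ f i) (k : ℕ) :
    ∀ i, 0 ≤ (nsum N)^[k] f i := by
  induction k with
  | zero => exact h
  | succ k ih =>
    intro i
    rw [Function.iterate_succ_apply']
    exact Finset.sum_nonneg fun j _ => ih j

/-- A weight that the neighborhood sum enlarges by at most a factor `c` dominates all iterates, at
the price of one factor `c` per step. -/
theorem iterate_nsum_le {ι : Type*} {N : ι → Finset ι} {f w : ι → ℝ} {C c : ℝ} (hc : 0 ≤ c)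
    (hC : 0 ≤ C) (h : ∀ i, f i ≤ C * w i) (hw : ∀ i, nsum N w i ≤ c * w i) (k : ℕ) :
    ∀ i, (nsum N)^[k] f i ≤ C * (c ^ k * w i) := by
  induction k with
  | zero => intro i; simpa using h i
  | succ k ih =>
    intro i
    rw [Function.iterate_succ_apply']
    calc nsum N ((nsum N)^[k] f) i ≤ nsum N (fun i => C * (c ^ k * w i)) i := nsum_mono ih i
      _ = C * (c ^ k * nsum N w i) := by simp only [nsum, Finset.mul_sum]
      _ ≤ C * (c ^ k * (c * w i)) := by gcongr; exact hw i
      _ = C * (c ^ (k + 1) * w i) := by ring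

/-- The finite iteration of the differential inequality `|e_i'| ≤ K ∑_{j ∈ N i} e_j`. -/
theorem le_sum_iterate_nsum_add {ι : Type*} {N : ι → Finset ι} {e e' : ι → ℝ → ℝ} {K M T : ℝ}
    {w : ι → ℝ} (hK : 0 ≤ K)
    (he : ∀ i, ∀ t ∈ Icc 0 T, HasDerivAt (e i) (e' i t) t)
    (hb : ∀ i, ∀ t ∈ Icc 0 T, |e' i t| ≤ K * ∑ j ∈ N i, e j t)
    (h0 : ∀ i, 0 ≤ e i 0)
    (hM : ∀ i, ∀ t ∈ Icc 0 T, e i t ≤ M * w i) (n : ℕ) :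
    ∀ i, ∀ t ∈ Icc 0 T, e i t ≤ ∑ k ∈ Finset.range n, (K * t) ^ k / k ! *
      (nsum N)^[k] (fun i => e i 0) i + (K * t) ^ n / n ! * (nsum N)^[n] (fun i => M * w i) i := by
  induction n with
  | zero => intro i t ht; simpa using hM i t ht
  | succ n ih =>
    intro i t ht
    let a : ℕ → ℝ := fun k => (nsum N)^[k] (fun i => e i 0) i
    let b : ℝ := (nsum N)^[n + 1] (fun i => M * w i) i
    -- An antiderivative of `K` times the neighborhood sum of the bound of order `n`; its value at
    -- time zero is `a 0 = e i 0`.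
    have hB : ∀ x : ℝ, HasDerivAt (fun x => (∑ k ∈ Finset.range n, (K * x) ^ (k + 1) / (k + 1)! *
        a (k + 1) + a 0) + (K * x) ^ (n + 1) / (n + 1)! * b)
        ((∑ k ∈ Finset.range n, K * ((K * x) ^ k / k !) * a (k + 1)) + K * ((K * x) ^ n / n !) * b)
        x := by
      intro x
      refine HasDerivAt.add (HasDerivAt.add_const _ (HasDerivAt.fun_sum fun k _ => ?_)) ?_
      · exact (hasDerivAt_pow_div_factorial K k x).mul_const _
      · exact (hasDerivAt_pow_div_factorial K n x).mul_const _
    have := norm_le_of_norm_deriv_le (he i) (B := _) ?_ hB ?_ t ht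
    · refine (le_abs_self _).trans (this.trans (le_of_eq ?_))
      rw [Finset.sum_range_succ']
      simp [a, b]
    · simp [a, abs_of_nonneg (h0 i)]
    · intro s hs
      refine (hb i s hs).trans ?_
      have : ∑ j ∈ N i, e j s ≤ ∑ j ∈ N i, (∑ k ∈ Finset.range n, (K * s) ^ k / k ! *
          (nsum N)^[k] (fun i => e i 0) j + (K * s) ^ n / n ! *
          (nsum N)^[n] (fun i => M * w i) j) := Finset.sum_le_sum fun j _ => ih j s hs
      refine (mul_le_mul_of_nonneg_left this hK).trans (le_of_eq ?_)
      rw [Finset.sum_add_distrib, Finset.sum_comm, mul_add, Finset.mul_sum]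
      congr 1
      · refine Finset.sum_congr rfl fun k _ => ?_
        simp only [a, Function.iterate_succ_apply', nsum, Finset.mul_sum]
        exact Finset.sum_congr rfl fun j _ => by ring
      · simp only [b, Function.iterate_succ_apply', nsum, Finset.mul_sum]
        exact Finset.sum_congr rfl fun j _ => by ring

theorem summable_iterate_nsum {ι : Type*} {N : ι → Finset ι} {f w : ι → ℝ} {C c x : ℝ}
    (hf : ∀ i, 0 ≤ f i) (hc : 0 ≤ c) (hC : 0 ≤ C) (hx : 0 ≤ x) (h : ∀ i, f i ≤ C * w i)
    (hw : ∀ i, nsum N w i ≤ c * w i) (i : ι) :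
    Summable (fun k : ℕ => x ^ k / k ! * (nsum N)^[k] f i) := by
  refine Summable.of_nonneg_of_le (fun k => ?_) (fun k => ?_)
    ((Real.summable_pow_div_factorial (x * c)).mul_right (C * w i))
  · exact mul_nonneg (by positivity) (iterate_nsum_nonneg hf k i)
  · calc x ^ k / k ! * (nsum N)^[k] f i ≤ x ^ k / k ! * (C * (c ^ k * w i)) := by
          gcongr; exact iterate_nsum_le hc hC h hw k i
      _ = _ := by rw [mul_pow]; ring

/-- The bound on the propagation of `e` by the exponential series of the neighborhood sum. -/
theorem le_tsum_iterate_nsum {ι : Type*} {N : ι → Finset ι} {e e' : ι → ℝ → ℝ} {K M T c : ℝ}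
    {w : ι → ℝ} (hK : 0 ≤ K) (hc : 0 ≤ c) (hM0 : 0 ≤ M) (hT : 0 ≤ T)
    (hw : ∀ i, nsum N w i ≤ c * w i) (he : ∀ i, ∀ t ∈ Icc 0 T, HasDerivAt (e i) (e' i t) t)
    (hb : ∀ i, ∀ t ∈ Icc 0 T, |e' i t| ≤ K * ∑ j ∈ N i, e j t)
    (h0 : ∀ i, 0 ≤ e i 0)
    (hM : ∀ i, ∀ t ∈ Icc 0 T, e i t ≤ M * w i) (i : ι) :
    e i T ≤ ∑' k : ℕ, (K * T) ^ k / k ! * (nsum N)^[k] (fun i => e i 0) i := by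
  have hs := summable_iterate_nsum (N := N) (x := K * T) h0 hc hM0 (by positivity)
    (fun i => hM i 0 ⟨le_rfl, hT⟩) hw i
  have h1 := hs.hasSum.tendsto_sum_nat
  -- The remainder is the general term of a convergent series, so the a priori bound `M` disappears
  -- in the limit.
  have h2 : Tendsto (fun n : ℕ => (K * T) ^ n / n ! * (nsum N)^[n] (fun i => M * w i) i) atTop
      (𝓝 0) := by
    have hwi : ∀ i, 0 ≤ M * w i := fun i => (h0 i).trans (hM i 0 ⟨le_rfl, hT⟩)
    exact (summable_iterate_nsum (N := N) (x := K * T) hwi hc hM0 (by positivity)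
      (fun i => le_rfl) hw i).tendsto_atTop_zero
  have h3 := h1.add h2
  rw [add_zero] at h3
  exact ge_of_tendsto' h3 fun n =>
    le_sum_iterate_nsum_add hK he hb h0 hM n i T ⟨hT, le_rfl⟩

/-- The a priori constant `M` only has to exist: the conclusion depends on the initial constant `C`
alone. This is what allows bounds to be propagated from one time to another. -/
theorem le_exp_of_deriv_le_nsum {ι : Type*} {N : ι → Finset ι} {e e' : ι → ℝ → ℝ} {K M T c C : ℝ}
    {w : ι → ℝ} (hK : 0 ≤ K) (hc : 0 ≤ c) (hM0 : 0 ≤ M) (hC0 : 0 ≤ C) (hT : 0 ≤ T)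
    (hw : ∀ i, nsum N w i ≤ c * w i) (he : ∀ i, ∀ t ∈ Icc 0 T, HasDerivAt (e i) (e' i t) t)
    (hb : ∀ i, ∀ t ∈ Icc 0 T, |e' i t| ≤ K * ∑ j ∈ N i, e j t)
    (h0 : ∀ i, 0 ≤ e i 0)
    (hM : ∀ i, ∀ t ∈ Icc 0 T, e i t ≤ M * w i) (hC : ∀ i, e i 0 ≤ C * w i) (i : ι) :
    e i T ≤ C * Real.exp (K * c * T) * w i := by
  refine (le_tsum_iterate_nsum hK hc hM0 hT hw he hb h0 hM i).trans ?_
  have h1 : HasSum (fun k : ℕ => (K * T) ^ k / k ! * (C * (c ^ k * w i)))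
      (C * Real.exp (K * c * T) * w i) := by
    have h := (NormedSpace.expSeries_div_hasSum_exp (𝔸 := ℝ) (K * c * T)).mul_left (C * w i)
    rw [← Real.exp_eq_exp_ℝ] at h
    have h2 : (fun k : ℕ => (K * T) ^ k / k ! * (C * (c ^ k * w i))) =
        fun k : ℕ => C * w i * ((K * c * T) ^ k / k !) := by
      funext k; rw [mul_pow, mul_pow, mul_pow]; ring
    rw [h2, show C * Real.exp (K * c * T) * w i = C * w i * Real.exp (K * c * T) by ring]
    exact h
  rw [← h1.tsum_eq]
  refine (summable_iterate_nsum h0 hc hC0 (by positivity) hC hw i).tsum_le_tsum (fun k => ?_)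
    h1.summable
  gcongr
  exact iterate_nsum_le hc hC0 hC hw k i

/-- A family of continuous functions which is bounded at each time, and whose bounds propagate
along intervals on which it is bounded, is bounded on a neighborhood of a time `t₀` from the left
or right, as soon as its bounds at the exceptional times near `t₀` are uniform. -/
theorem bounded_right_of_bounded_exceptional {ι : Type*} {e : ι → ℝ → ℝ} {w : ι → ℝ} {κ : ℝ}
    (hκ : 0 ≤ κ) (hw : ∀ i, 0 ≤ w i) {G : Set ℝ} (hG : IsOpen G)
    (hloc : ∀ t ∈ G, ∃ n : ℕ, ∀ᶠ s in 𝓝 t, ∀ i, e i s ≤ n * w i)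
    (hpt : ∀ t, ∃ C : ℝ, 0 ≤ C ∧ ∀ i, e i t ≤ C * w i)
    (hprop : ∀ s t, (∃ M : ℝ, 0 ≤ M ∧ ∀ u ∈ uIcc s t, ∀ i, e i u ≤ M * w i) → ∀ C : ℝ, 0 ≤ C →
      (∀ i, e i s ≤ C * w i) → ∀ i, e i t ≤ C * Real.exp (κ * |t - s|) * w i)
    {t₀ t C : ℝ} (hC : 0 ≤ C) (ht : t₀ ≤ t) (ht₀ : t₀ ∉ G)
    (hex : ∀ s ∈ Icc t₀ t, s ∉ G → ∀ i, e i s ≤ C * w i) :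
    ∀ i, e i t ≤ C * Real.exp (κ * (t - t₀)) * w i := by
  have hcomp : IsCompact (Icc t₀ t ∩ Gᶜ) := isCompact_Icc.inter_right hG.isClosed_compl
  -- The last exceptional time `s` before `t`. All times in `(s, t]` are good, but their local
  -- bounds could degenerate towards `s`.
  obtain ⟨s, ⟨hs, hsG⟩, hmax⟩ := hcomp.exists_isGreatest ⟨t₀, ⟨le_rfl, ht⟩, ht₀⟩
  obtain ⟨Ct, hCt, hCt'⟩ := hpt t
  have hbd : ∀ u ∈ uIcc s t, ∀ i,
      e i u ≤ max C (Ct * Real.exp (κ * (t - s))) * w i := by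
    intro u hu i
    rw [uIcc_of_le hs.2] at hu
    rcases hu.1.eq_or_lt with rfl | hlt
    · exact (hex _ hs hsG i).trans (mul_le_mul_of_nonneg_right (le_max_left _ _) (hw i))
    have hsub : uIcc t u ⊆ G := by
      intro v hv
      rw [uIcc_of_ge hu.2] at hv
      by_contra hvG
      exact absurd (hmax ⟨⟨hs.1.trans (hu.1.trans hv.1), hv.2⟩, hvG⟩) (by linarith [hv.1])
    have hM : ∃ M : ℝ, 0 ≤ M ∧ ∀ v ∈ uIcc t u, ∀ i, e i v ≤ M * w i := by
      choose! n hn using hloc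
      have hcov := isCompact_uIcc.elim_nhds_subcover
        (fun v => {x | ∀ i, e i x ≤ n v * w i}) (fun v (hv : v ∈ uIcc t u) => hn v (hsub hv))
      obtain ⟨F, -, hF⟩ := hcov
      refine ⟨∑ v ∈ F, (n v : ℝ), by positivity, fun v hv i => ?_⟩
      obtain ⟨x, hx, hvx⟩ := mem_iUnion₂.1 (hF hv)
      refine (hvx i).trans (mul_le_mul_of_nonneg_right ?_ (hw i))
      exact Finset.single_le_sum (f := fun v => (n v : ℝ)) (fun _ _ => by positivity) hx
    -- Propagation backwards from `t` bounds time `u` by a constant that does not depend on `u`. So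
    -- all of `[s, t]` is bounded, and propagation forwards from `s` then gives the sharp constant.
    refine (hprop t u hM Ct hCt hCt' i).trans (mul_le_mul_of_nonneg_right ?_ (hw i))
    refine le_trans ?_ (le_max_right _ _)
    gcongr
    rw [abs_sub_comm, abs_of_nonneg (by linarith [hu.2])]
    linarith
  have := hprop s t ⟨_, le_max_of_le_left hC, hbd⟩ C hC (hex s hs hsG)
  intro i
  refine (this i).trans (mul_le_mul_of_nonneg_right ?_ (hw i))
  gcongr
  rw [abs_of_nonneg (by linarith [hs.2])]
  linarith [hs.1]

/-- A family of continuous functions which is bounded at each time, and whose bounds propagate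
along intervals on which it is bounded, is locally uniformly bounded. -/
theorem locally_bounded_of_pointwise_bounded {ι : Type*} {e : ι → ℝ → ℝ} {w : ι → ℝ} {κ : ℝ}
    (hκ : 0 ≤ κ) (hw : ∀ i, 0 ≤ w i) (hcont : ∀ i, Continuous (e i))
    (hpt : ∀ t, ∃ C : ℝ, 0 ≤ C ∧ ∀ i, e i t ≤ C * w i)
    (hprop : ∀ s t, (∃ M : ℝ, 0 ≤ M ∧ ∀ u ∈ uIcc s t, ∀ i, e i u ≤ M * w i) → ∀ C : ℝ, 0 ≤ C →
      (∀ i, e i s ≤ C * w i) → ∀ i, e i t ≤ C * Real.exp (κ * |t - s|) * w i) (t : ℝ) :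
    ∃ n : ℕ, ∀ᶠ s in 𝓝 t, ∀ i, e i s ≤ n * w i := by
  let G : Set ℝ := {t | ∃ n : ℕ, ∀ᶠ s in 𝓝 t, ∀ i, e i s ≤ n * w i}
  have hG : IsOpen G := by
    rw [isOpen_iff_mem_nhds]
    rintro t ⟨n, hn⟩
    filter_upwards [hn.eventually_nhds] with s hs using ⟨n, hs⟩
  by_contra hcon
  have htG : t ∉ G := hcon
  let B : ℕ → Set (Gᶜ : Set ℝ) := fun n => {s | ∀ i, e i s ≤ n * w i}
  have hBc : ∀ n, IsClosed (B n) := by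
    intro n
    simp only [B, ofPred_forall]
    exact isClosed_iInter fun i =>
      isClosed_le ((hcont i).comp continuous_subtype_val) continuous_const
  have hBU : ⋃ n, B n = univ := by
    refine eq_univ_of_forall fun s => ?_
    obtain ⟨C, hC, hC'⟩ := hpt s
    obtain ⟨n, hn⟩ := exists_nat_ge C
    exact mem_iUnion.2 ⟨n, fun i => (hC' i).trans (mul_le_mul_of_nonneg_right hn (hw i))⟩
  have : Nonempty (Gᶜ : Set ℝ) := ⟨⟨t, htG⟩⟩
  have : CompleteSpace (Gᶜ : Set ℝ) := hG.isClosed_compl.completeSpace_coe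
  -- Baire on the closed set of bad times: near some bad time `t₀` a single constant `n` serves all
  -- bad times. Propagation through the gaps then bounds every time near `t₀`, so `t₀` is not bad.
  obtain ⟨n, ⟨t₀, ht₀G⟩, ht₀⟩ := nonempty_interior_of_iUnion_of_closed hBc hBU
  rw [mem_interior_iff_mem_nhds, nhds_subtype, mem_comap] at ht₀
  obtain ⟨U, hU, hUB⟩ := ht₀
  obtain ⟨ε, hε, hεU⟩ := Metric.mem_nhds_iff.1 hU
  have hex : ∀ s, |s - t₀| < ε → s ∉ G → ∀ i, e i s ≤ n * w i := by
    intro s hs hsG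
    exact hUB (show (⟨s, hsG⟩ : (Gᶜ : Set ℝ)) ∈ _ from hεU (by simpa [Real.dist_eq] using hs))
  obtain ⟨m, hm⟩ := exists_nat_ge (n * Real.exp (κ * ε))
  refine ht₀G ⟨m, ?_⟩
  filter_upwards [Metric.ball_mem_nhds t₀ hε] with s hs i
  rw [Metric.mem_ball, Real.dist_eq] at hs
  suffices h : e i s ≤ n * Real.exp (κ * |s - t₀|) * w i by
    refine h.trans (mul_le_mul_of_nonneg_right (le_trans ?_ hm) (hw i))
    gcongr
  rcases le_total t₀ s with h | h
  · rw [abs_of_nonneg (by linarith)] at hs ⊢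
    refine bounded_right_of_bounded_exceptional hκ hw hG (fun t ht => ht) hpt hprop
      (Nat.cast_nonneg n) h ht₀G (fun u hu => hex u ?_) i
    rw [abs_of_nonneg (by linarith [hu.1])]
    linarith [hu.2]
  · rw [abs_of_nonpos (by linarith)] at hs ⊢
    -- To the left of `t₀` the same estimate is applied with time reversed.
    have := bounded_right_of_bounded_exceptional (e := fun i t => e i (-t)) (t₀ := -t₀) (t := -s)
      (C := n) hκ hw (G := -G) hG.neg
      (fun t ht => ?_) (fun t => hpt (-t)) (fun s t hM C hC h0 i => ?_)
      (Nat.cast_nonneg n) (by linarith) (by simpa using ht₀G) (fun u hu huG => hex (-u) ?_ huG) i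
    · rw [neg_neg] at this
      convert this using 4
      ring
    · obtain ⟨n, hn⟩ := ht
      exact ⟨n, continuous_neg.continuousAt.eventually hn⟩
    · have := hprop (-s) (-t) ?_ C hC h0 i
      · rw [show |t - s| = |(-t) - (-s)| by rw [abs_sub_comm]; congr 1; ring]
        exact this
      · obtain ⟨M, hM0, hM⟩ := hM
        refine ⟨M, hM0, fun u hu i => ?_⟩
        have := hM (-u) ?_ i
        · simpa using this
        · rw [mem_uIcc] at hu ⊢
          rcases hu with hu | hu
          · right; constructor <;> linarith [hu.1, hu.2]
          · left; constructor <;> linarith [hu.1, hu.2]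
    · rw [abs_of_nonpos (by linarith [hu.1])]
      linarith [hu.2]

end RealAnalysis

/-! ### Uniform constants, neighborhoods and weights -/

section Constants

variable {ν d : ℕ} {L : AddSubgroup (Mom d)} {W : Interaction ν L}

/-- The sites at distance at most `D` from `i`. -/
noncomputable def nbhd {ν : ℕ} (D : ℕ) (i : Site ν) : Finset (Site ν) :=
  Finset.Icc (i - fun _ => (D : ℤ)) (i + fun _ => (D : ℤ))

theorem mem_nbhd {D : ℕ} {i j : Site ν} : j ∈ nbhd D i ↔ ‖i - j‖ ≤ D := by
  rw [nbhd, Finset.mem_Icc, pi_norm_le_iff_of_nonneg (Nat.cast_nonneg D), Pi.le_def, Pi.le_def,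
    ← forall_and]
  refine forall_congr' fun k => ?_
  rw [Int.norm_eq_abs]
  simp only [Pi.sub_apply, Pi.add_apply]
  have : |((i k - j k : ℤ) : ℝ)| ≤ D ↔ |i k - j k| ≤ (D : ℤ) := by
    rw [← Int.cast_abs]; exact_mod_cast Iff.rfl
  rw [this, abs_le]
  constructor <;> rintro ⟨h1, h2⟩ <;> constructor <;> omega

theorem self_mem_nbhd (D : ℕ) (i : Site ν) : i ∈ nbhd D i := by
  rw [mem_nbhd]; simp

theorem norm_le_of_mem_nbhd {D : ℕ} {i j : Site ν} (h : j ∈ nbhd D i) : ‖j‖ ≤ ‖i‖ + D := by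
  have h1 := mem_nbhd.1 h
  have h2 := norm_sub_norm_le j i
  rw [norm_sub_rev] at h2
  linarith

theorem mem_translate {i j : Site ν} {Δ : Finset (Site ν)} :
    j ∈ translate i Δ ↔ j - i ∈ Δ := by
  simp only [translate, Finset.mem_map, addRightEmbedding_apply]
  constructor
  · rintro ⟨a, ha, rfl⟩; simpa using ha
  · intro h; exact ⟨j - i, h, by simp⟩

theorem translate_nbhd (D : ℕ) (i j : Site ν) : translate i (nbhd D j) = nbhd D (j + i) := by
  ext k
  rw [mem_translate, mem_nbhd, mem_nbhd]
  congr! 2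
  abel

theorem card_nbhd (D : ℕ) (i : Site ν) : (nbhd D i).card = (nbhd D (0 : Site ν)).card := by
  conv_lhs => rw [← zero_add i, ← translate_nbhd, translate, Finset.card_map]

/-- The weight `(1 + |i|)^r`. -/
noncomputable def weight (r : ℝ) (i : Site ν) : ℝ := (1 + ‖i‖) ^ r

theorem weight_pos (r : ℝ) (i : Site ν) : 0 < weight r i :=
  Real.rpow_pos_of_pos (by positivity) _

theorem one_le_weight {r : ℝ} (hr : 0 ≤ r) (i : Site ν) : 1 ≤ weight r i :=
  Real.one_le_rpow (by linarith [norm_nonneg i]) hr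

theorem weight_mono {r s : ℝ} (h : r ≤ s) (i : Site ν) : weight r i ≤ weight s i :=
  Real.rpow_le_rpow_of_exponent_le (by linarith [norm_nonneg i]) h

theorem weight_le_of_mem_nbhd {r : ℝ} (hr : 0 ≤ r) {D : ℕ} {i j : Site ν} (h : j ∈ nbhd D i) :
    weight r j ≤ (1 + D : ℝ) ^ r * weight r i := by
  rw [weight, weight, ← Real.mul_rpow (by positivity) (by positivity)]
  refine Real.rpow_le_rpow (by positivity) ?_ hr
  have := norm_le_of_mem_nbhd h
  nlinarith [norm_nonneg i, (Nat.cast_nonneg D : (0 : ℝ) ≤ D), mul_nonneg (norm_nonneg i)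
    (Nat.cast_nonneg D : (0 : ℝ) ≤ D)]

/-- Over a neighborhood the polynomial weight changes by at most the factor `(1 + D)^r`; this
provides the hypothesis on `w` in the propagation estimates. -/
theorem nsum_weight_le {r : ℝ} (hr : 0 ≤ r) (D : ℕ) (i : Site ν) :
    nsum (nbhd D) (weight r) i ≤ ((nbhd D (0 : Site ν)).card * (1 + D : ℝ) ^ r) * weight r i := by
  rw [nsum]
  refine (Finset.sum_le_card_nsmul _ _ _ fun j hj => weight_le_of_mem_nbhd hr hj).trans ?_
  rw [card_nbhd, nsmul_eq_mul, mul_assoc]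

/-- The sum of the on-site potentials over the sites near `i`. -/
noncomputable def pinning (W : Interaction ν L) (D : ℕ) (i : Site ν) (q : Site ν → Pos L) : ℝ :=
  ∑ j ∈ nbhd D i, W.onSite j (q j)

open scoped Classical in
/-- The consequences of the assumptions on the interactions with uniform constants. -/
structure Controlled (W : Interaction ν L) (D : ℕ) (A : ℝ) : Prop where
  regular : Regular W
  inv : TranslationInvariant W
  nonneg : OnSiteNonneg W
  one_le : 1 ≤ A
  subset_nbhd : ∀ Δ : Finset (Site ν), W Δ ≠ 0 → ∀ i ∈ Δ, Δ ⊆ nbhd D i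
  conv_subset : ∀ i, ∀ z : ℝ, 0 ≤ z → conv (sublevel W i z) ⊆ sublevel W i (A * (z + 1))
  growth : ∀ i (x : Pos L), ‖x‖ ≤ A * W.onSite i x
  inter_le : ∀ i q, ‖∑ Δ ∈ (nbhd D i).powerset with {i} ⊂ Δ, pgrad i (W.ext Δ) q‖ ^ 2 ≤
    A * pinning W D i q
  hess_le : ∀ i q, ∀ j ∈ nbhd D i, ‖∑ Δ ∈ (nbhd D i).powerset with {i} ⊆ Δ,
    phess j i (W.ext Δ) q‖ ≤ A * pinning W D i q
  ext_le : ∀ (Δ : Finset (Site ν)) (i : Site ν) q, {i} ⊂ Δ → |W.ext Δ q| ≤ A * pinning W D i q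
  pgrad_le : ∀ (Δ : Finset (Site ν)) (i : Site ν) q, {i} ⊂ Δ →
    ‖pgrad i (W.ext Δ) q‖ ^ 2 ≤ A * pinning W D i q

/-- Inclusion-exclusion, one site at a time: the sets containing `T` and `t` are those containing
`T`, minus those which also avoid `t`. Each site doubles the bound. -/
theorem norm_sum_superset_le {ι E : Type*} [DecidableEq ι] [SeminormedAddCommGroup E]
    {f : Finset ι → E} {M : Finset ι} {b : ℝ} (h : ∀ Λ ⊆ M, ‖∑ Δ ∈ Λ.powerset, f Δ‖ ≤ b)
    (T : Finset ι) : ∀ Λ ⊆ M, ‖∑ Δ ∈ Λ.powerset with T ⊆ Δ, f Δ‖ ≤ 2 ^ T.card * b := by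
  induction T using Finset.induction_on with
  | empty => intro Λ hΛ; simpa using h Λ hΛ
  | insert t T ht ih =>
    intro Λ hΛ
    have h1 : ∑ Δ ∈ Λ.powerset with insert t T ⊆ Δ, f Δ =
        ∑ Δ ∈ Λ.powerset with T ⊆ Δ, f Δ - ∑ Δ ∈ (Λ.erase t).powerset with T ⊆ Δ, f Δ := by
      rw [eq_sub_iff_add_eq, ← Finset.sum_union]
      · refine Finset.sum_congr ?_ fun _ _ => rfl
        ext Δ
        simp only [Finset.mem_union, Finset.mem_filter, Finset.mem_powerset, Finset.insert_subset_iff,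
          Finset.subset_erase]
        tauto
      · rw [Finset.disjoint_left]
        intro Δ h1 h2
        simp only [Finset.mem_filter, Finset.mem_powerset, Finset.insert_subset_iff,
          Finset.subset_erase] at h1 h2
        tauto
    rw [h1, Finset.card_insert_of_notMem ht, pow_succ]
    refine (norm_sub_le _ _).trans ?_
    have := ih Λ hΛ
    have := ih (Λ.erase t) ((Finset.erase_subset _ _).trans hΛ)
    linarith

/-- (D1) and (D2) bound only sums over all `Δ ⊆ Λ`, but for every `Λ`. This recovers a bound for
each single interaction, which is needed because the local energy and its flux weight the
interactions by `1 / #Δ`. -/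
theorem norm_le_of_norm_sum_powerset_le {ι E : Type*} [DecidableEq ι] [SeminormedAddCommGroup E]
    {f : Finset ι → E} {M : Finset ι} {b : ℝ} (h : ∀ Λ ⊆ M, ‖∑ Δ ∈ Λ.powerset, f Δ‖ ≤ b) :
    ‖f M‖ ≤ 2 ^ M.card * b := by
  have := norm_sum_superset_le h M M subset_rfl
  have h1 : M.powerset.filter (fun Δ => M ⊆ Δ) = {M} := by
    ext Δ
    simp only [Finset.mem_filter, Finset.mem_powerset, Finset.mem_singleton]
    exact ⟨fun h => h.1.antisymm h.2, fun h => by simp [h]⟩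
  rwa [h1, Finset.sum_singleton] at this

theorem nearbyPinning_le {D : ℕ} (hP1 : OnSiteNonneg W)
    (hF : ∀ i j : Site ν, (D : ℝ) < ‖i - j‖ → 1 < W.dist i j) (i : Site ν)
    (Λ : Finset (Site ν)) (q : Site ν → Pos L) : nearbyPinning W i Λ q ≤ pinning W D i q := by
  refine Finset.sum_le_sum_of_subset_of_nonneg ?_ fun j _ _ => hP1 j _
  intro j hj
  rw [mem_nbhd]
  by_contra h
  exact absurd (Finset.mem_filter.1 hj).2 (not_le.2 (hF i j (not_le.1 h)))

theorem nearbyPinning_nonneg (hP1 : OnSiteNonneg W) (i : Site ν)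
    (Λ : Finset (Site ν)) (q : Site ν → Pos L) : 0 ≤ nearbyPinning W i Λ q :=
  Finset.sum_nonneg fun j _ => hP1 j _

theorem exists_controlled (hF : FiniteRange W) (hR : Regular W) (hTI : TranslationInvariant W)
    (hP1 : OnSiteNonneg W) (hP2 : PinningConv W) (hP3 : PinningGrowth W)
    (hD1 : ForceDominated W) (hD2 : EnergyDominated W) (hD3 : HessianDominated W) :
    ∃ (D : ℕ) (A : ℝ), Controlled W D A := by
  classical
  obtain ⟨D, hD⟩ := hF
  obtain ⟨a, b, hab⟩ := hP2
  obtain ⟨C₀, hC₀⟩ := hP3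
  obtain ⟨C₁, hC₁⟩ := hD1
  obtain ⟨C₂, hC₂⟩ := hD2
  obtain ⟨C₃, hC₃⟩ := hD3
  set m := (nbhd D (0 : Site ν)).card
  have hpin : ∀ i q, 0 ≤ pinning W D i q := fun i q => Finset.sum_nonneg fun j _ => hP1 j _
  have hrange : ∀ Δ : Finset (Site ν), W Δ ≠ 0 → ∀ i ∈ Δ, Δ ⊆ nbhd D i := by
    intro Δ hΔ i hi j hj
    rw [mem_nbhd]
    by_contra h
    have h1 := hD i j (not_le.1 h)
    have hne : i ≠ j := by
      rintro rfl
      apply h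
      simp
    have hadj : W.graph.Adj i j := ⟨hne, Δ, hi, hj, hΔ⟩
    have : W.dist i j = 1 := SimpleGraph.edist_eq_one_iff_adj.2 hadj
    rw [this] at h1
    exact lt_irrefl _ h1
  have hcard : ∀ Δ : Finset (Site ν), W Δ ≠ 0 → ∀ i ∈ Δ, Δ.card ≤ m := fun Δ hΔ i hi => by
    have := Finset.card_le_card (hrange Δ hΔ i hi)
    rwa [card_nbhd] at this
  have hbd : ∀ C i Λ q, C * nearbyPinning W i Λ q ≤ |C| * pinning W D i q := by
    intro C i Λ q
    exact mul_le_mul (le_abs_self C) (nearbyPinning_le hP1 hD i Λ q) (nearbyPinning_nonneg hP1 _ _ _)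
      (abs_nonneg C)
  let s : ℝ := 1 + |a| + |b| + |C₀| + |C₁| + |C₂| + |C₃|
  -- An interacting set has at most `m` sites, so inclusion-exclusion costs `2 ^ m`; the square is
  -- due to the squared norm in (D1).
  let A : ℝ := (2 ^ m) ^ 2 * s
  have h2m : (1 : ℝ) ≤ 2 ^ m := one_le_pow₀ (by norm_num)
  have h2m' : (2 : ℝ) ^ m ≤ (2 ^ m) ^ 2 := by nlinarith
  have hs : 1 ≤ s := by
    simp only [s]
    linarith [abs_nonneg a, abs_nonneg b, abs_nonneg C₀, abs_nonneg C₁, abs_nonneg C₂,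
      abs_nonneg C₃]
  have hsA : s ≤ A := le_mul_of_one_le_left (by linarith) (by linarith)
  have ha : |a| ≤ s := by
    simp only [s]
    linarith [abs_nonneg a, abs_nonneg b, abs_nonneg C₀, abs_nonneg C₁, abs_nonneg C₂,
      abs_nonneg C₃]
  have hb : |b| ≤ s := by
    simp only [s]
    linarith [abs_nonneg a, abs_nonneg b, abs_nonneg C₀, abs_nonneg C₁, abs_nonneg C₂,
      abs_nonneg C₃]
  have h0 : |C₀| ≤ s := by
    simp only [s]
    linarith [abs_nonneg a, abs_nonneg b, abs_nonneg C₀, abs_nonneg C₁, abs_nonneg C₂,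
      abs_nonneg C₃]
  have h1 : |C₁| ≤ s := by
    simp only [s]
    linarith [abs_nonneg a, abs_nonneg b, abs_nonneg C₀, abs_nonneg C₁, abs_nonneg C₂,
      abs_nonneg C₃]
  have h2 : |C₂| ≤ s := by
    simp only [s]
    linarith [abs_nonneg a, abs_nonneg b, abs_nonneg C₀, abs_nonneg C₁, abs_nonneg C₂,
      abs_nonneg C₃]
  have h3 : |C₃| ≤ s := by
    simp only [s]
    linarith [abs_nonneg a, abs_nonneg b, abs_nonneg C₀, abs_nonneg C₁, abs_nonneg C₂,
      abs_nonneg C₃]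
  refine ⟨D, A, hR, hTI, hP1, hs.trans hsA, hrange, ?_, ?_, ?_, ?_, ?_, ?_⟩
  · intro i z hz x hx
    have := (hab i z hz).2 hx
    refine le_trans (show W.onSite i x ≤ a * z + b from this) ?_
    have e1 : a * z ≤ A * z := mul_le_mul_of_nonneg_right ((le_abs_self a).trans (ha.trans hsA)) hz
    have e2 : b ≤ A := (le_abs_self b).trans (hb.trans hsA)
    linarith
  · intro i x
    refine (hC₀ i x).trans (mul_le_mul_of_nonneg_right ?_ (hP1 i x))
    exact (le_abs_self _).trans (h0.trans hsA)
  · intro i q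
    refine le_trans ?_ (((hC₁ i (nbhd D i) q).trans (hbd _ _ _ _)).trans
      (mul_le_mul_of_nonneg_right (h1.trans hsA) (hpin _ _)))
    exact le_of_eq (by congr!)
  · intro i q j hj
    refine le_trans ?_ (((hC₃ i (nbhd D i) q j hj).trans (hbd _ _ _ _)).trans
      (mul_le_mul_of_nonneg_right (h3.trans hsA) (hpin _ _)))
    exact le_of_eq (by congr!)
  · intro Δ i q hi
    by_cases hW : W Δ = 0
    · simp only [Interaction.ext, hW, Pi.zero_apply, abs_zero]
      exact mul_nonneg (by linarith) (hpin _ _)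
    have hmem : i ∈ Δ := hi.1 (Finset.mem_singleton_self i)
    -- Extending the terms by zero turns the sums over `{i} ⊂ Δ ⊆ Λ` of (D2) into sums over full
    -- power sets.
    have key := norm_le_of_norm_sum_powerset_le
      (f := fun Δ => if {i} ⊂ Δ then W.ext Δ q else 0) (M := Δ) (b := |C₂| * pinning W D i q) ?_
    · rw [if_pos hi, Real.norm_eq_abs] at key
      refine key.trans ?_
      rw [← mul_assoc]
      refine mul_le_mul_of_nonneg_right ?_ (hpin _ _)
      refine mul_le_mul ?_ h2 (abs_nonneg _) (by positivity)
      exact (pow_le_pow_right₀ (by norm_num) (hcard Δ hW i hmem)).trans h2m'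
    · intro Λ _
      rw [← Finset.sum_filter]
      refine le_trans ?_ ((hC₂ i Λ q).trans (hbd _ _ _ _))
      exact le_of_eq (by rw [Real.norm_eq_abs])
  · intro Δ i q hi
    by_cases hW : W Δ = 0
    · simp only [pgrad_zero i q hW, norm_zero]
      rw [zero_pow two_ne_zero]
      exact mul_nonneg (by linarith) (hpin _ _)
    have hmem : i ∈ Δ := hi.1 (Finset.mem_singleton_self i)
    have key := norm_le_of_norm_sum_powerset_le
      (f := fun Δ => if {i} ⊂ Δ then pgrad i (W.ext Δ) q else 0) (M := Δ)
      (b := Real.sqrt (|C₁| * pinning W D i q)) ?_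
    · rw [if_pos hi] at key
      have hnn : 0 ≤ |C₁| * pinning W D i q := mul_nonneg (abs_nonneg _) (hpin _ _)
      calc ‖pgrad i (W.ext Δ) q‖ ^ 2 ≤ (2 ^ Δ.card * Real.sqrt (|C₁| * pinning W D i q)) ^ 2 := by
            gcongr
        _ = (2 ^ Δ.card) ^ 2 * (|C₁| * pinning W D i q) := by
            rw [mul_pow, Real.sq_sqrt hnn]
        _ ≤ (2 ^ m) ^ 2 * (s * pinning W D i q) := by
            have := hpin i q
            gcongr
            · norm_num
            · exact hcard Δ hW i hmem
        _ = A * pinning W D i q := by simp only [A]; ring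
    · intro Λ _
      rw [← Finset.sum_filter]
      refine Real.le_sqrt_of_sq_le ?_
      refine le_trans ?_ ((hC₁ i Λ q).trans (hbd _ _ _ _))
      exact le_of_eq (by congr!)

/-- The total force on the particle at `i`. -/
noncomputable def force (W : Interaction ν L) (i : Site ν) (q : Site ν → Pos L) : Mom d :=
  -∑ᶠ Δ : Finset (Site ν), pgrad i (W.ext Δ) q

open scoped Classical in
theorem Controlled.force_eq {D : ℕ} {A : ℝ} (h : Controlled W D A) (i : Site ν)
    (q : Site ν → Pos L) : force W i q =
      -∑ Δ ∈ (nbhd D i).powerset with {i} ⊆ Δ, pgrad i (W.ext Δ) q := by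
  rw [force, finsum_eq_sum_of_support_subset]
  intro Δ hΔ
  rw [Function.mem_support] at hΔ
  have h1 : i ∈ Δ := by
    by_contra hi
    exact hΔ (pgrad_of_notMem hi q)
  have h2 : W Δ ≠ 0 := fun h0 => hΔ (pgrad_zero i q h0)
  simp only [Finset.coe_filter, Finset.mem_powerset, Finset.singleton_subset_iff]
  exact ⟨h.subset_nbhd Δ h2 i h1, h1⟩

open scoped Classical in
-- Splits off the on-site force, which cancels in the balance of the noninteracting energy.
theorem Controlled.force_eq_add {D : ℕ} {A : ℝ} (h : Controlled W D A) (i : Site ν)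
    (q : Site ν → Pos L) : force W i q = -(pgrad i (W.ext {i}) q +
      ∑ Δ ∈ (nbhd D i).powerset with {i} ⊂ Δ, pgrad i (W.ext Δ) q) := by
  rw [h.force_eq]
  congr 1
  have : (nbhd D i).powerset.filter (fun Δ => {i} ⊆ Δ) =
      insert {i} ((nbhd D i).powerset.filter (fun Δ => {i} ⊂ Δ)) := by
    ext Δ
    simp only [Finset.mem_filter, Finset.mem_powerset, Finset.mem_insert]
    constructor
    · rintro ⟨h1, h2⟩
      rcases h2.eq_or_ssubset with h3 | h3
      · exact Or.inl h3.symm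
      · exact Or.inr ⟨h1, h3⟩
    · rintro (rfl | ⟨h1, h2⟩)
      · exact ⟨by simpa using self_mem_nbhd D i, subset_rfl⟩
      · exact ⟨h1, h2.1⟩
  rw [this, Finset.sum_insert]
  simp

theorem Controlled.force_congr {D : ℕ} {A : ℝ} (h : Controlled W D A) {i : Site ν}
    {q q' : Site ν → Pos L} (hq : ∀ j ∈ nbhd D i, q j = q' j) : force W i q = force W i q' := by
  rw [h.force_eq, h.force_eq]
  congr 1
  refine Finset.sum_congr rfl fun Δ hΔ => pgrad_congr fun j hj => hq j ?_
  exact Finset.mem_powerset.1 (Finset.mem_filter.1 hΔ).1 hj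

theorem onSite_eq_ext (W : Interaction ν L) (i : Site ν) (q : Site ν → Pos L) :
    W.onSite i (q i) = W.ext {i} q := by
  unfold Interaction.onSite Interaction.ext
  congr 1
  funext j
  rw [Finset.mem_singleton.1 j.2]

theorem onSite_add (hTI : TranslationInvariant W) (i : Site ν) :
    W.onSite i = W.onSite 0 := by
  funext x
  have h := hTI i {0} (fun _ => x)
  have h2 : translate i {0} = {i} := by simp [translate]
  rw [h2] at h
  have h3 := onSite_eq_ext W i (fun _ => x)
  have h4 := onSite_eq_ext W 0 (fun _ => x)
  rw [h3, h4, h]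

end Constants

/-! ### Energy propagation and Lipschitz bounds for the forces -/

section Motion

open Set Filter Topology

theorem exists_segment_parametrization (s t : ℝ) : ∃ σ : ℝ, |σ| = 1 ∧ s + σ * |t - s| = t ∧
    ∀ u ∈ Icc 0 |t - s|, s + σ * u ∈ uIcc s t := by
  rcases le_total s t with h | h
  · refine ⟨1, by simp, by rw [abs_of_nonneg (by linarith)]; ring, fun u hu => ?_⟩
    rw [abs_of_nonneg (by linarith)] at hu
    rw [uIcc_of_le h]
    constructor <;> linarith [hu.1, hu.2]
  · refine ⟨-1, by simp, by rw [abs_of_nonpos (by linarith)]; ring, fun u hu => ?_⟩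
    rw [abs_of_nonpos (by linarith)] at hu
    rw [uIcc_of_ge h]
    constructor <;> linarith [hu.1, hu.2]

/-- The two-sided form of `le_tsum_iterate_nsum` and `le_exp_of_deriv_le_nsum`. -/
theorem propagation_on_segment {ι : Type*} {N : ι → Finset ι} {e e' : ι → ℝ → ℝ} {K M c s t : ℝ}
    {w : ι → ℝ} (hK : 0 ≤ K) (hc : 0 ≤ c) (hM0 : 0 ≤ M)
    (hw : ∀ i, nsum N w i ≤ c * w i) (he : ∀ i, ∀ u ∈ uIcc s t, HasDerivAt (e i) (e' i u) u)
    (hb : ∀ i, ∀ u ∈ uIcc s t, |e' i u| ≤ K * ∑ j ∈ N i, e j u)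
    (h0 : ∀ i u, 0 ≤ e i u)
    (hM : ∀ i, ∀ u ∈ uIcc s t, e i u ≤ M * w i) :
    (∀ i, e i t ≤ ∑' k : ℕ, (K * |t - s|) ^ k / k ! * (nsum N)^[k] (fun i => e i s) i) ∧
    ∀ C : ℝ, 0 ≤ C → (∀ i, e i s ≤ C * w i) → ∀ i, e i t ≤ C * Real.exp (K * c * |t - s|) * w i := by
  obtain ⟨σ, hσ, hσt, hσu⟩ := exists_segment_parametrization s t
  have hd : ∀ i, ∀ u ∈ Icc 0 |t - s|,
      HasDerivAt (fun u => e i (s + σ * u)) (e' i (s + σ * u) * σ) u := by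
    intro i u hu
    have h1 : HasDerivAt (fun u : ℝ => s + σ * u) σ u := by
      simpa using ((hasDerivAt_id u).const_mul σ).const_add s
    exact (he i _ (hσu u hu)).comp u h1
  have hb' : ∀ i, ∀ u ∈ Icc 0 |t - s|, |e' i (s + σ * u) * σ| ≤
      K * ∑ j ∈ N i, e j (s + σ * u) := by
    intro i u hu
    rw [abs_mul, hσ, mul_one]
    exact hb i _ (hσu u hu)
  constructor
  · intro i
    have := le_tsum_iterate_nsum hK hc hM0 (abs_nonneg (t - s)) hw hd hb' (fun i => h0 i _)
      (fun i u hu => hM i _ (hσu u hu)) i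
    rw [hσt] at this
    simpa using this
  · intro C hC0 hC i
    have := le_exp_of_deriv_le_nsum hK hc hM0 hC0 (abs_nonneg (t - s)) hw hd hb' (fun i => h0 i _)
      (fun i u hu => hM i _ (hσu u hu)) (by simpa using hC) i
    rwa [hσt] at this

variable {ν d : ℕ} {L : AddSubgroup (Mom d)} {W : Interaction ν L}

/-- The point of the state space with given lifts of positions and momenta. -/
def phase (L : AddSubgroup (Mom d)) (q p : Site ν → Mom d) : Phase ν L :=
  fun j => ((q j : Pos L), p j)

/-- The lifts `Q`, `P` solve the equations of motion on `[-T, T]`, up to time-dependent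
slowdown factors `θ_i ∈ [0, 1]` at each site. -/
structure IsMotion (W : Interaction ν L) (θ : Site ν → ℝ → ℝ) (T : ℝ) (Q P : ℝ → Site ν → Mom d) :
    Prop where
  nonneg : ∀ i t, 0 ≤ θ i t
  le_one : ∀ i t, θ i t ≤ 1
  pos : ∀ i t, |t| ≤ T → HasDerivAt (fun s => Q s i) (θ i t • P t i) t
  mom : ∀ i t, |t| ≤ T → HasDerivAt (fun s => P s i) (θ i t • force W i (proj L (Q t))) t

theorem energyNI_nonneg (hP1 : OnSiteNonneg W) (i : Site ν) (ω : Phase ν L) :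
    0 ≤ energyNI W i ω := by
  unfold energyNI
  have := hP1 i (ω i).1
  positivity

theorem onSite_le_energyNI (i : Site ν) (ω : Phase ν L) : W.onSite i (ω i).1 ≤ energyNI W i ω := by
  unfold energyNI
  have : 0 ≤ ‖(ω i).2‖ ^ 2 := by positivity
  linarith

theorem sq_norm_le_energyNI (hP1 : OnSiteNonneg W) (i : Site ν) (ω : Phase ν L) :
    ‖(ω i).2‖ ^ 2 ≤ 2 * energyNI W i ω := by
  unfold energyNI
  have := hP1 i (ω i).1
  linarith

theorem pinning_le_sum_energyNI (D : ℕ) (i : Site ν) (ω : Phase ν L) :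
    pinning W D i (positions ω) ≤ ∑ j ∈ nbhd D i, energyNI W j ω :=
  Finset.sum_le_sum fun j _ => onSite_le_energyNI j ω

theorem energyNI_le_sum (hP1 : OnSiteNonneg W) (D : ℕ) (i : Site ν) (ω : Phase ν L) :
    energyNI W i ω ≤ ∑ j ∈ nbhd D i, energyNI W j ω :=
  Finset.single_le_sum (f := fun j => energyNI W j ω) (fun j _ => energyNI_nonneg hP1 j ω)
    (self_mem_nbhd D i)

/-- Since `2 |F| |p| ≤ |F|² + |p|²`, and both squares are at most linear in the nearby energies, so
is the power. The square in (D1) has exactly this purpose. -/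
theorem Controlled.abs_inner_le {D : ℕ} {A : ℝ} (h : Controlled W D A) (i : Site ν)
    (ω : Phase ν L) {F : Mom d} (hF : ‖F‖ ^ 2 ≤ A * pinning W D i (positions ω)) :
    |⟪F, (ω i).2⟫_ℝ| ≤ (1 + A) * ∑ j ∈ nbhd D i, energyNI W j ω := by
  refine (abs_real_inner_le_norm _ _).trans ?_
  have h1 := sq_norm_le_energyNI h.nonneg i ω
  have h2 := energyNI_le_sum h.nonneg D i ω
  have h3 := mul_le_mul_of_nonneg_left (pinning_le_sum_energyNI (W := W) D i ω)
    (zero_le_one.trans h.one_le)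
  have h4 : 0 ≤ A * ∑ j ∈ nbhd D i, energyNI W j ω := (sq_nonneg _).trans (hF.trans h3)
  nlinarith [sq_nonneg (‖F‖ - ‖(ω i).2‖)]

open scoped Classical in
-- The work of the on-site force cancels against the change of the on-site potential. The slowdown
-- `c` multiplies velocity and force alike, so it does not disturb the cancellation and comes out as
-- a factor.
theorem Controlled.hasDerivAt_energyNI {D : ℕ} {A : ℝ} (h : Controlled W D A)
    {Q P : ℝ → Site ν → Mom d} {i : Site ν} {t c : ℝ}
    (hQ : HasDerivAt (fun s => Q s i) (c • P t i) t)
    (hP : HasDerivAt (fun s => P s i) (c • force W i (proj L (Q t))) t) :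
    HasDerivAt (fun s => energyNI W i (phase L (Q s) (P s)))
      (-c * ⟪∑ Δ ∈ (nbhd D i).powerset with {i} ⊂ Δ, pgrad i (W.ext Δ) (proj L (Q t)), P t i⟫_ℝ)
      t := by
  have h1 := (hP.norm_sq).const_mul (1 / 2 : ℝ)
  have h2 := hasDerivAt_ext h.regular {i} (Q := Q) (Q' := fun _ => c • P t i) (t := t)
    (by intro k hk; rw [Finset.mem_singleton.1 hk]; exact hQ)
  have h3 := h1.add h2
  have h4 : (fun s => energyNI W i (phase L (Q s) (P s))) =
      fun s => 1 / 2 * ‖P s i‖ ^ 2 + W.ext {i} (proj L (Q s)) := by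
    funext s
    rw [← onSite_eq_ext]
    rfl
  rw [h4]
  refine h3.congr_deriv ?_
  rw [h.force_eq_add, Finset.sum_singleton]
  simp only [inner_smul_right, inner_neg_right, inner_add_right, smul_neg, smul_add,
    real_inner_comm (P t i)]
  ring

theorem Controlled.exists_hasDerivAt_energyNI {D : ℕ} {A : ℝ} (h : Controlled W D A)
    {θ : Site ν → ℝ → ℝ} {T : ℝ} {Q P : ℝ → Site ν → Mom d} (hm : IsMotion W θ T Q P) :
    ∃ e' : Site ν → ℝ → ℝ, ∀ i t, |t| ≤ T →
      HasDerivAt (fun s => energyNI W i (phase L (Q s) (P s))) (e' i t) t ∧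
      |e' i t| ≤ (1 + A) * ∑ j ∈ nbhd D i, energyNI W j (phase L (Q t) (P t)) := by
  classical
  refine ⟨_, fun i t ht => ⟨h.hasDerivAt_energyNI (hm.pos i t ht) (hm.mom i t ht), ?_⟩⟩
  rw [abs_mul, abs_neg, abs_of_nonneg (hm.nonneg i t)]
  refine (mul_le_of_le_one_left (abs_nonneg _) (hm.le_one i t)).trans ?_
  refine h.abs_inner_le i (phase L (Q t) (P t)) ?_
  refine le_trans (le_of_eq ?_) (h.inter_le i (proj L (Q t)))
  congr!

/-- The exponential growth rate of the energies of motions in `𝔅_r`. -/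
noncomputable def growthRate (ν D : ℕ) (A r : ℝ) : ℝ :=
  (1 + A) * ((nbhd D (0 : Site ν)).card * (1 + D : ℝ) ^ r)

theorem Controlled.growthRate_nonneg {D : ℕ} {A : ℝ} (h : Controlled W D A) (r : ℝ) :
    0 ≤ growthRate ν D A r := by
  have := h.one_le
  unfold growthRate
  positivity

/-- The bounds depend neither on the slowdown factors nor on `M`, so they hold uniformly for the
finite approximations as well as for trajectories. -/
theorem Controlled.energyNI_propagation {D : ℕ} {A : ℝ} (h : Controlled W D A)
    {θ : Site ν → ℝ → ℝ} {T : ℝ} {Q P : ℝ → Site ν → Mom d} (hm : IsMotion W θ T Q P)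
    {r M s t : ℝ} (hr : 0 ≤ r) (hM : 0 ≤ M) (hT : ∀ u ∈ uIcc s t, |u| ≤ T)
    (hb : ∀ i, ∀ u ∈ uIcc s t, energyNI W i (phase L (Q u) (P u)) ≤ M * weight r i) :
    (∀ i, energyNI W i (phase L (Q t) (P t)) ≤ ∑' k : ℕ, ((1 + A) * |t - s|) ^ k / k ! *
      (nsum (nbhd D))^[k] (fun i => energyNI W i (phase L (Q s) (P s))) i) ∧
    ∀ C : ℝ, 0 ≤ C → (∀ i, energyNI W i (phase L (Q s) (P s)) ≤ C * weight r i) →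
      ∀ i, energyNI W i (phase L (Q t) (P t)) ≤
        C * Real.exp (growthRate ν D A r * |t - s|) * weight r i := by
  obtain ⟨e', he'⟩ := h.exists_hasDerivAt_energyNI hm
  exact propagation_on_segment (e := fun i u => energyNI W i (phase L (Q u) (P u)))
    (by linarith [h.one_le]) (by positivity) hM (nsum_weight_le hr D)
    (fun i u hu => (he' i u (hT u hu)).1) (fun i u hu => (he' i u (hT u hu)).2)
    (fun i u => energyNI_nonneg h.nonneg i _) hb

/-- Mean value inequality along the segment between the lifts. The segment may leave the sublevel
sets that contain its endpoints, but by (P2) it stays in the sublevel sets at height `A (z + 1)`,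
where (D3) bounds the derivative of the force. -/
theorem Controlled.norm_force_sub_le {D : ℕ} {A : ℝ} (h : Controlled W D A) (i : Site ν)
    {q q' : Site ν → Mom d} {z : Site ν → ℝ} (hz : ∀ j, 0 ≤ z j)
    (hq : ∀ j ∈ nbhd D i, W.onSite j (q j : Pos L) ≤ z j)
    (hq' : ∀ j ∈ nbhd D i, W.onSite j (q' j : Pos L) ≤ z j) :
    ‖force W i (proj L q) - force W i (proj L q')‖ ≤
      (A * ∑ j ∈ nbhd D i, A * (z j + 1)) * ∑ j ∈ nbhd D i, ‖q j - q' j‖ := by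
  classical
  let γ : ℝ → Site ν → Mom d := fun s j => q' j + s • (q j - q' j)
  have hγ : ∀ s, ∀ j, HasDerivAt (fun s => γ s j) (q j - q' j) s := by
    intro s j
    have := ((hasDerivAt_id s).smul_const (q j - q' j)).const_add (q' j)
    rwa [one_smul] at this
  have hd : ∀ s, HasDerivAt (fun s => force W i (proj L (γ s)))
      (-∑ j ∈ nbhd D i, (∑ Δ ∈ (nbhd D i).powerset with {i} ⊆ Δ,
        phess j i (W.ext Δ) (proj L (γ s))) (q j - q' j)) s := by
    intro s
    simp only [h.force_eq]
    have h1 : HasDerivAt (fun s => ∑ Δ ∈ (nbhd D i).powerset with {i} ⊆ Δ,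
        pgrad i (W.ext Δ) (proj L (γ s))) (∑ Δ ∈ (nbhd D i).powerset with {i} ⊆ Δ,
        ∑ j ∈ Δ, phess j i (W.ext Δ) (proj L (γ s)) (q j - q' j)) s :=
      HasDerivAt.fun_sum fun Δ _ => hasDerivAt_pgrad h.regular Δ i fun k _ => hγ s k
    refine (h1.neg).congr_deriv ?_
    congr 1
    have h2 : ∀ Δ ∈ (nbhd D i).powerset.filter (fun Δ => {i} ⊆ Δ),
        ∑ j ∈ Δ, phess j i (W.ext Δ) (proj L (γ s)) (q j - q' j) =
        ∑ j ∈ nbhd D i, phess j i (W.ext Δ) (proj L (γ s)) (q j - q' j) := by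
      intro Δ hΔ
      refine Finset.sum_subset (Finset.mem_powerset.1 (Finset.mem_filter.1 hΔ).1) fun j _ hj => ?_
      rw [phess_of_notMem_left hj]
      rfl
    rw [Finset.sum_congr rfl h2, Finset.sum_comm]
    refine Finset.sum_congr rfl fun j _ => ?_
    rw [sum_apply]
  have hγ1 : γ 1 = q := by funext j; simp [γ]
  have hγ0 : γ 0 = q' := by funext j; simp [γ]
  have hseg : ∀ s ∈ Icc (0 : ℝ) 1, ∀ j ∈ nbhd D i, W.onSite j (γ s j : Pos L) ≤ A * (z j + 1) := by
    intro s hs j hj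
    refine h.conv_subset j (z j) (hz j) ⟨γ s j, ?_, rfl⟩
    have hc := convex_convexHull ℝ ((fun v : Mom d => (v : Pos L)) ⁻¹' sublevel W j (z j))
    have hx := subset_convexHull ℝ ((fun v : Mom d => (v : Pos L)) ⁻¹' sublevel W j (z j))
      (show q j ∈ _ from hq j hj)
    have hy := subset_convexHull ℝ ((fun v : Mom d => (v : Pos L)) ⁻¹' sublevel W j (z j))
      (show q' j ∈ _ from hq' j hj)
    exact hc.add_smul_sub_mem hy hx hs
  have hA : 0 ≤ A := zero_le_one.trans h.one_le
  have := norm_image_sub_le_of_norm_deriv_le_segment_01'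
    (f := fun s => force W i (proj L (γ s)))
    (C := (A * ∑ j ∈ nbhd D i, A * (z j + 1)) * ∑ j ∈ nbhd D i, ‖q j - q' j‖)
    (fun s _ => (hd s).hasDerivWithinAt) (fun s hs => ?_)
  · simpa only [hγ1, hγ0] using this
  · rw [norm_neg, Finset.mul_sum]
    refine norm_sum_le_of_le _ fun j hj => ?_
    refine (ContinuousLinearMap.le_opNorm _ _).trans ?_
    refine mul_le_mul_of_nonneg_right ?_ (norm_nonneg _)
    refine le_trans ?_ ((h.hess_le i (proj L (γ s)) j hj).trans (mul_le_mul_of_nonneg_left ?_ hA))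
    · exact le_of_eq (by congr!)
    · exact Finset.sum_le_sum fun k hk => hseg s (Ico_subset_Icc_self hs) k hk

end Motion

/-! ### Comparison of two motions with equal initial values -/

section Comparison

open Set Filter Topology

/-- The coefficients of the iterated comparison estimate. -/
noncomputable def comparisonCoeff (c r : ℝ) (D : ℕ) : ℕ → ℕ → ℝ
  | 0, m => (1 + m : ℝ) ^ r
  | k + 1, m => c * (1 + m : ℝ) ^ r * comparisonCoeff c r D k (m + D)

/-- The coefficient is a product of weights at the radii `m, m + D, …, m + k D`. The definition
splits off the innermost one; splitting off the outermost keeps `m` fixed, as the ratio test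
requires. -/
theorem comparisonCoeff_succ (c r : ℝ) (D k m : ℕ) : comparisonCoeff c r D (k + 1) m =
    c * (1 + (m + (k + 1) * D : ℕ) : ℝ) ^ r * comparisonCoeff c r D k m := by
  induction k generalizing m with
  | zero => simp [comparisonCoeff]; ring
  | succ k ih =>
    rw [comparisonCoeff, ih, comparisonCoeff.eq_2 c r D m,
      show m + D + (k + 1) * D = m + (k + 1 + 1) * D by ring]
    ring

theorem comparisonCoeff_nonneg {c : ℝ} (hc : 0 ≤ c) (r : ℝ) (D k m : ℕ) :
    0 ≤ comparisonCoeff c r D k m := by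
  induction k generalizing m with
  | zero => unfold comparisonCoeff; positivity
  | succ k ih => unfold comparisonCoeff; have := ih (m + D); positivity

/-- Ratio test, and the place where `r < 2` is decisive: a new weight contributes a factor of order
`k ^ r`, the factorial one of order `k ^ 2` in the denominator. -/
theorem tendsto_comparisonCoeff {c r : ℝ} (hc : 0 ≤ c) (hr : 0 ≤ r) (hr2 : r < 2) (D m : ℕ)
    (T : ℝ) :
    Tendsto (fun k : ℕ => comparisonCoeff c r D k m * (T ^ (2 * k) / (2 * k)!)) atTop (𝓝 0) := by
  refine Summable.tendsto_atTop_zero ?_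
  refine summable_of_ratio_norm_eventually_le (r := 1 / 2) (by norm_num) ?_
  have hlim : Tendsto (fun k : ℕ => ((k + 1 : ℕ) : ℝ) ^ (2 - r)) atTop atTop :=
    (tendsto_rpow_atTop (by linarith)).comp
      (tendsto_natCast_atTop_atTop.comp (tendsto_add_atTop_nat 1))
  filter_upwards [hlim.eventually_ge_atTop (2 * (c * (1 + m + D : ℝ) ^ r * T ^ 2))] with k hk
  have h0 := comparisonCoeff_nonneg hc r D k m
  have hT : T ^ (2 * (k + 1)) = T ^ 2 * T ^ (2 * k) := by ring
  have hTk : 0 ≤ T ^ (2 * k) := by rw [pow_mul]; positivity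
  have hfac : ((2 * (k + 1))! : ℝ) = (2 * k + 2) * (2 * k + 1) * (2 * k)! := by
    rw [show 2 * (k + 1) = 2 * k + 1 + 1 by ring, Nat.factorial_succ, Nat.factorial_succ]
    push_cast; ring
  -- From `1 + m + (k + 1) D ≤ (1 + m + D) (k + 1)`, which isolates the growth in `k`.
  have hw : (1 + (m + (k + 1) * D : ℕ) : ℝ) ^ r ≤ (1 + m + D : ℝ) ^ r * ((k + 1 : ℕ) : ℝ) ^ r := by
    rw [← Real.mul_rpow (by positivity) (by positivity)]
    refine Real.rpow_le_rpow (by positivity) ?_ hr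
    push_cast
    nlinarith [(Nat.cast_nonneg k : (0 : ℝ) ≤ k), (Nat.cast_nonneg m : (0 : ℝ) ≤ m),
      mul_nonneg (Nat.cast_nonneg k : (0 : ℝ) ≤ k) (Nat.cast_nonneg m : (0 : ℝ) ≤ m)]
  have hk1 : ((k + 1 : ℕ) : ℝ) ^ r * ((k + 1 : ℕ) : ℝ) ^ (2 - r) = (k + 1 : ℝ) ^ 2 := by
    rw [← Real.rpow_add (by positivity)]
    push_cast
    rw [show r + (2 - r) = (2 : ℕ) by norm_num, Real.rpow_natCast]
  have key : c * (1 + (m + (k + 1) * D : ℕ) : ℝ) ^ r * T ^ 2 ≤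
      1 / 2 * ((2 * k + 2) * (2 * k + 1)) := by
    have hpos : 0 ≤ ((k + 1 : ℕ) : ℝ) ^ r := by positivity
    calc c * (1 + (m + (k + 1) * D : ℕ) : ℝ) ^ r * T ^ 2
        ≤ c * ((1 + m + D : ℝ) ^ r * ((k + 1 : ℕ) : ℝ) ^ r) * T ^ 2 := by gcongr
      _ = 1 / 2 * (((k + 1 : ℕ) : ℝ) ^ r * (2 * (c * (1 + m + D : ℝ) ^ r * T ^ 2))) := by ring
      _ ≤ 1 / 2 * (((k + 1 : ℕ) : ℝ) ^ r * ((k + 1 : ℕ) : ℝ) ^ (2 - r)) := by gcongr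
      _ = 1 / 2 * (k + 1 : ℝ) ^ 2 := by rw [hk1]
      _ ≤ _ := by nlinarith [(Nat.cast_nonneg k : (0 : ℝ) ≤ k)]
  rw [comparisonCoeff_succ, hfac, hT, Real.norm_eq_abs, Real.norm_eq_abs,
    abs_of_nonneg (by positivity), abs_of_nonneg (by positivity)]
  have e : c * (1 + (m + (k + 1) * D : ℕ) : ℝ) ^ r * comparisonCoeff c r D k m *
      (T ^ 2 * T ^ (2 * k) / ((2 * k + 2) * (2 * k + 1) * (2 * k)!)) =
      (c * (1 + (m + (k + 1) * D : ℕ) : ℝ) ^ r * T ^ 2) / ((2 * k + 2) * (2 * k + 1)) *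
      (comparisonCoeff c r D k m * (T ^ (2 * k) / (2 * k)!)) := by
    field_simp
  rw [e]
  refine mul_le_mul_of_nonneg_right ?_ (by positivity)
  rw [div_le_iff₀ (by positivity)]
  exact key

variable {ν d : ℕ} {L : AddSubgroup (Mom d)} {W : Interaction ν L}

theorem weight_le_of_norm_le {r : ℝ} (hr : 0 ≤ r) {i : Site ν} {m : ℕ} (h : ‖i‖ ≤ m) :
    weight r i ≤ (1 + m : ℝ) ^ r :=
  Real.rpow_le_rpow (by positivity) (by linarith) hr

/-- The Lipschitz constant of the forces on configurations with energies at most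
`M (1 + |i|)^r`, relative to `(1 + |i|)^r`. -/
noncomputable def forceConst (ν D : ℕ) (A r M : ℝ) : ℝ :=
  A * (A * (M + 1) * ((nbhd D (0 : Site ν)).card * (1 + D : ℝ) ^ r))

theorem Controlled.norm_force_sub_le_weight {D : ℕ} {A : ℝ} (h : Controlled W D A) {r M : ℝ}
    (hr : 0 ≤ r) (hM : 0 ≤ M) (i : Site ν) {q q' : Site ν → Mom d}
    (hq : ∀ j, W.onSite j (q j : Pos L) ≤ M * weight r j)
    (hq' : ∀ j, W.onSite j (q' j : Pos L) ≤ M * weight r j) :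
    ‖force W i (proj L q) - force W i (proj L q')‖ ≤
      forceConst ν D A r M * weight r i * ∑ j ∈ nbhd D i, ‖q j - q' j‖ := by
  have hA : 0 ≤ A := zero_le_one.trans h.one_le
  refine (h.norm_force_sub_le i (z := fun j => M * weight r j)
    (fun j => mul_nonneg hM (weight_pos r j).le) (fun j _ => hq j) (fun j _ => hq' j)).trans ?_
  refine mul_le_mul_of_nonneg_right ?_ (Finset.sum_nonneg fun j _ => norm_nonneg _)
  rw [forceConst, mul_assoc A]
  refine mul_le_mul_of_nonneg_left ?_ hA
  calc ∑ j ∈ nbhd D i, A * (M * weight r j + 1)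
      ≤ ∑ j ∈ nbhd D i, A * (M + 1) * weight r j := by
        refine Finset.sum_le_sum fun j _ => ?_
        have := one_le_weight hr j
        rw [mul_assoc]
        refine mul_le_mul_of_nonneg_left ?_ hA
        linarith
    _ = A * (M + 1) * nsum (nbhd D) (weight r) i := by rw [nsum, Finset.mul_sum]
    _ ≤ A * (M + 1) * (((nbhd D (0 : Site ν)).card * (1 + D : ℝ) ^ r) * weight r i) := by
        gcongr
        exact nsum_weight_le hr D i
    _ = _ := by ring

theorem forceConst_nonneg {D : ℕ} {A r M : ℝ} (hA : 0 ≤ A) (hM : 0 ≤ M) :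
    0 ≤ forceConst ν D A r M := by
  unfold forceConst; positivity

/-- Two motions with the same initial values which are not slowed down at the sites of norm at
most `n`. -/
structure Comparable (W : Interaction ν L) (n : ℕ) (r M T : ℝ)
    (Q P Q' P' : ℝ → Site ν → Mom d) : Prop where
  pos : ∀ i : Site ν, ‖i‖ ≤ n → ∀ t, |t| ≤ T → HasDerivAt (fun s => Q s i) (P t i) t
  mom : ∀ i : Site ν, ‖i‖ ≤ n → ∀ t, |t| ≤ T →
    HasDerivAt (fun s => P s i) (force W i (proj L (Q t))) t
  pos' : ∀ i : Site ν, ‖i‖ ≤ n → ∀ t, |t| ≤ T → HasDerivAt (fun s => Q' s i) (P' t i) t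
  mom' : ∀ i : Site ν, ‖i‖ ≤ n → ∀ t, |t| ≤ T →
    HasDerivAt (fun s => P' s i) (force W i (proj L (Q' t))) t
  pos_init : Q 0 = Q' 0
  mom_init : P 0 = P' 0
  bound : ∀ i t, |t| ≤ T → energyNI W i (phase L (Q t) (P t)) ≤ M * weight r i
  bound' : ∀ i t, |t| ≤ T → energyNI W i (phase L (Q' t) (P' t)) ≤ M * weight r i

/-- The crude bound `2 |p| ≤ 1 + |p|²` suffices, since momenta enter only the starting point of the
iteration. -/
theorem Controlled.norm_mom_le {D : ℕ} {A : ℝ} (h : Controlled W D A) {r M : ℝ} (hr : 0 ≤ r)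
    {q p : Site ν → Mom d} {i : Site ν}
    (hb : energyNI W i (phase L q p) ≤ M * weight r i) : ‖p i‖ ≤ (1 + M) * weight r i := by
  have h1 := sq_norm_le_energyNI h.nonneg i (phase L q p)
  have h3 : (phase L q p i).2 = p i := rfl
  rw [h3] at h1
  have h2 := one_le_weight hr i
  nlinarith [sq_nonneg (‖p i‖ - 1)]

theorem Controlled.force_sub_le_of_comparable {D : ℕ} {A : ℝ} (h : Controlled W D A) {r M T : ℝ}
    (hr : 0 ≤ r) (hM : 0 ≤ M) {n : ℕ} {Q P Q' P' : ℝ → Site ν → Mom d}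
    (hc : Comparable W n r M T Q P Q' P') {m : ℕ} {i : Site ν} (hi : ‖i‖ ≤ m) {t δ : ℝ}
    (ht : |t| ≤ T) (hδ : ∀ j : Site ν, ‖j‖ ≤ (m + D : ℕ) → ‖Q t j - Q' t j‖ ≤ δ) :
    ‖force W i (proj L (Q t)) - force W i (proj L (Q' t))‖ ≤
      forceConst ν D A r M * (nbhd D (0 : Site ν)).card * (1 + m : ℝ) ^ r * δ := by
  have hA : 0 ≤ A := zero_le_one.trans h.one_le
  have hf := forceConst_nonneg (ν := ν) (D := D) (r := r) hA hM
  have h1 := h.norm_force_sub_le_weight hr hM i (q := Q t) (q' := Q' t)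
    (fun j => (onSite_le_energyNI j (phase L (Q t) (P t))).trans (hc.bound j t ht))
    (fun j => (onSite_le_energyNI j (phase L (Q' t) (P' t))).trans (hc.bound' j t ht))
  have h2 : ∑ j ∈ nbhd D i, ‖Q t j - Q' t j‖ ≤ (nbhd D (0 : Site ν)).card * δ := by
    rw [← card_nbhd D i, ← nsmul_eq_mul]
    refine Finset.sum_le_card_nsmul _ _ _ fun j hj => hδ j ?_
    push_cast
    linarith [norm_le_of_mem_nbhd hj]
  have h3 := weight_le_of_norm_le hr hi
  have h4 := (weight_pos r i).le
  have h5 : (0 : ℝ) ≤ ∑ j ∈ nbhd D i, ‖Q t j - Q' t j‖ := Finset.sum_nonneg fun j _ => norm_nonneg _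
  calc _ ≤ _ := h1
    _ ≤ forceConst ν D A r M * (1 + m : ℝ) ^ r * ((nbhd D (0 : Site ν)).card * δ) := by gcongr
    _ = _ := by ring

/-- Forces within radius `m` see positions within radius `m + D`. Each round costs one weight and a
widening by `D`, and gains two orders in `|t|^(2k) / (2k)!`, because force differences are
integrated twice. The condition `m + k D ≤ n` keeps all sites involved among those that are not
slowed down. -/
theorem Controlled.pos_sub_le_comparisonCoeff {D : ℕ} {A : ℝ} (h : Controlled W D A) {r M T : ℝ}
    (hr : 0 ≤ r) (hM : 0 ≤ M) {n : ℕ} {Q P Q' P' : ℝ → Site ν → Mom d}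
    (hc : Comparable W n r M T Q P Q' P') (k : ℕ) :
    ∀ m : ℕ, m + k * D ≤ n → ∀ i : Site ν, ‖i‖ ≤ m → ∀ t, |t| ≤ T →
    ‖Q t i - Q' t i‖ ≤ 2 * (1 + M) * T *
      comparisonCoeff (forceConst ν D A r M * (nbhd D (0 : Site ν)).card) r D k m *
      (|t| ^ (2 * k) / (2 * k)!) := by
  have hd : ∀ i : Site ν, ‖i‖ ≤ n → ∀ t, |t| ≤ T →
      HasDerivAt (fun s => Q s i - Q' s i) (P t i - P' t i) t :=
    fun i hi t ht => (hc.pos i hi t ht).sub (hc.pos' i hi t ht)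
  have hd' : ∀ i : Site ν, ‖i‖ ≤ n → ∀ t, |t| ≤ T → HasDerivAt (fun s => P s i - P' s i)
      (force W i (proj L (Q t)) - force W i (proj L (Q' t))) t :=
    fun i hi t ht => (hc.mom i hi t ht).sub (hc.mom' i hi t ht)
  set c := forceConst ν D A r M * (nbhd D (0 : Site ν)).card with hcdef
  have hc0 : 0 ≤ c := by
    have := forceConst_nonneg (ν := ν) (D := D) (r := r) (zero_le_one.trans h.one_le) hM
    positivity
  induction k with
  | zero =>
    intro m hm i hi t ht
    have hin : ‖i‖ ≤ n := hi.trans (by exact_mod_cast (by omega : m ≤ n))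
    have hB : ∀ t : ℝ, HasDerivAt (fun t : ℝ => 2 * (1 + M) * (1 + m : ℝ) ^ r * t)
        (2 * (1 + M) * (1 + m : ℝ) ^ r) t := fun t => by
      simpa using (hasDerivAt_id t).const_mul (2 * (1 + M) * (1 + m : ℝ) ^ r)
    have := norm_le_of_norm_deriv_le_abs (hd i hin) (B := fun t => _ * t)
      (B' := fun _ => 2 * (1 + M) * (1 + m : ℝ) ^ r)
      (by simp [hc.pos_init]) hB (fun s hs => ?_) t ht
    · refine this.trans ?_
      simp only [comparisonCoeff, mul_zero, pow_zero, Nat.factorial_zero, Nat.cast_one, div_one,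
        mul_one]
      calc 2 * (1 + M) * (1 + m : ℝ) ^ r * |t| ≤ 2 * (1 + M) * (1 + m : ℝ) ^ r * T := by gcongr
        _ = _ := by ring
    · refine (norm_sub_le _ _).trans ?_
      have h1 := h.norm_mom_le hr (hc.bound i s hs)
      have h2 := h.norm_mom_le hr (hc.bound' i s hs)
      have h3 := mul_le_mul_of_nonneg_left (weight_le_of_norm_le hr hi) (by linarith : 0 ≤ 1 + M)
      linarith
  | succ k ih =>
    intro m hm i hi t ht
    have hin : ‖i‖ ≤ n := by
      have : m ≤ n := by omega
      exact hi.trans (by exact_mod_cast this)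
    let b := 2 * (1 + M) * T * comparisonCoeff c r D (k + 1) m
    have hp : ∀ t, |t| ≤ T → ‖P t i - P' t i‖ ≤ b * ((1 * |t|) ^ (2 * k + 1) / (2 * k + 1)!) := by
      refine norm_le_of_norm_deriv_le_abs
        (B := fun x : ℝ => b * ((1 * x) ^ (2 * k + 1) / (2 * k + 1)!))
        (B' := fun x : ℝ => b * (1 * ((1 * x) ^ (2 * k) / (2 * k)!)))
        (hd' i hin) (by simp [hc.mom_init])
        (fun t => (hasDerivAt_pow_div_factorial 1 (2 * k) t).const_mul b) (fun s hs => ?_)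
      have h1 := h.force_sub_le_of_comparable hr hM hc hi hs
        (fun j hj => ih (m + D) (by linarith) j hj s hs)
      refine h1.trans (le_of_eq ?_)
      rw [← hcdef]
      simp only [b, comparisonCoeff, one_mul]
      ring
    have hq := norm_le_of_norm_deriv_le_abs
      (B := fun x : ℝ => b * ((1 * x) ^ (2 * k + 1 + 1) / (2 * k + 1 + 1)!))
      (B' := fun x : ℝ => b * (1 * ((1 * x) ^ (2 * k + 1) / (2 * k + 1)!)))
      (hd i hin) (by simp [hc.pos_init])
      (fun t => (hasDerivAt_pow_div_factorial 1 (2 * k + 1) t).const_mul b)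
      (fun s hs => by rw [one_mul]; exact hp s hs) t ht
    rw [one_mul] at hq
    exact hq

/-- Motions with the same initial values are uniformly close at the sites of norm at most `m` as
long as they are not slowed down in a large region. -/
theorem Controlled.comparison {D : ℕ} {A : ℝ} (h : Controlled W D A) {r M T : ℝ}
    (hr : 0 ≤ r) (hr2 : r < 2) (hM : 0 ≤ M) (hT : 0 ≤ T) (m : ℕ) {ε : ℝ} (hε : 0 < ε) :
    ∃ n : ℕ, ∀ Q P Q' P' : ℝ → Site ν → Mom d, Comparable W n r M T Q P Q' P' →
      ∀ i : Site ν, ‖i‖ ≤ m → ∀ t, |t| ≤ T → ‖Q t i - Q' t i‖ ≤ ε ∧ ‖P t i - P' t i‖ ≤ ε ∧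
        ‖force W i (proj L (Q t)) - force W i (proj L (Q' t))‖ ≤ ε := by
  set c := forceConst ν D A r M * (nbhd D (0 : Site ν)).card with hcdef
  have hc0 : 0 ≤ c := by
    have := forceConst_nonneg (ν := ν) (D := D) (r := r) (zero_le_one.trans h.one_le) hM
    positivity
  -- A position error `δ` at radius `m + D` causes a force error `c (1 + m)^r δ` at radius `m` and a
  -- momentum error at most `T` times that; all three are then at most `ε`.
  let δ : ℝ := ε / (1 + c * (1 + m : ℝ) ^ r * (1 + T))
  have hden : 1 ≤ 1 + c * (1 + m : ℝ) ^ r * (1 + T) := by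
    have : 0 ≤ c * (1 + m : ℝ) ^ r * (1 + T) := by positivity
    linarith
  have hδ : 0 < δ := div_pos hε (by linarith)
  have hδε : δ ≤ ε := div_le_self hε.le hden
  have hδ2 : c * (1 + m : ℝ) ^ r * δ * (1 + T) ≤ ε := by
    have : δ * (1 + c * (1 + m : ℝ) ^ r * (1 + T)) = ε := div_mul_cancel₀ _ (by linarith)
    nlinarith
  have hδ3 : c * (1 + m : ℝ) ^ r * δ ≤ ε := by
    have : 0 ≤ c * (1 + m : ℝ) ^ r * δ * T := by positivity
    linarith
  have hδ4 : c * (1 + m : ℝ) ^ r * δ * T ≤ ε := by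
    have : 0 ≤ c * (1 + m : ℝ) ^ r * δ := by positivity
    linarith
  have hlim := (tendsto_comparisonCoeff hc0 hr hr2 D (m + D) T).const_mul (2 * (1 + M) * T)
  rw [mul_zero] at hlim
  obtain ⟨k, hk⟩ := (hlim.eventually (gt_mem_nhds hδ)).exists
  -- One `D` to pass from positions to forces, and `k` more for the iteration.
  refine ⟨m + D + k * D, fun Q P Q' P' hc => ?_⟩
  have hQ : ∀ j : Site ν, ‖j‖ ≤ (m + D : ℕ) → ∀ t, |t| ≤ T → ‖Q t j - Q' t j‖ ≤ δ := by
    intro j hj t ht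
    refine (h.pos_sub_le_comparisonCoeff hr hM hc k (m + D) le_rfl j hj t ht).trans
      (le_trans ?_ hk.le)
    rw [← hcdef, mul_assoc _ (comparisonCoeff c r D k (m + D))]
    have := comparisonCoeff_nonneg hc0 r D k (m + D)
    gcongr
  intro i hi t ht
  have hF : ∀ t, |t| ≤ T → ‖force W i (proj L (Q t)) - force W i (proj L (Q' t))‖ ≤
      c * (1 + m : ℝ) ^ r * δ := fun t ht =>
    h.force_sub_le_of_comparable hr hM hc hi ht fun j hj => hQ j hj t ht
  have hin : ‖i‖ ≤ (m + D + k * D : ℕ) := by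
    push_cast
    have : (0 : ℝ) ≤ D + k * D := by positivity
    linarith
  refine ⟨(hQ i (hi.trans (by push_cast; linarith [(Nat.cast_nonneg D : (0 : ℝ) ≤ D)])) t
    ht).trans hδε, ?_, (hF t ht).trans hδ3⟩
  have := norm_le_of_norm_deriv_le_abs (f := fun s => P s i - P' s i)
    (B := fun x : ℝ => c * (1 + m : ℝ) ^ r * δ * x) (B' := fun _ => c * (1 + m : ℝ) ^ r * δ)
    (fun s hs => (hc.mom i hin s hs).sub (hc.mom' i hin s hs)) (by simp [hc.mom_init])
    (fun x => by simpa using (hasDerivAt_id x).const_mul (c * (1 + m : ℝ) ^ r * δ)) hF t ht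
  refine this.trans (le_trans ?_ hδ4)
  gcongr

end Comparison

/-! ### Uniqueness of trajectories -/

section Uniqueness

open Set Filter Topology

variable {ν d : ℕ} {L : AddSubgroup (Mom d)} {W : Interaction ν L}

theorem exists_phase_eq (ω : Phase ν L) : ∃ q p : Site ν → Mom d, phase L q p = ω := by
  choose q hq using fun i => QuotientAddGroup.mk_surjective (ω i).1
  exact ⟨q, fun i => (ω i).2, funext fun i => Prod.ext (hq i) rfl⟩

/-- The given lifts may start at any representatives. Translating each by the constant `q i - Q i
0`, which is zero in the quotient, makes them start at `q`, so that lifts of two solutions can be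
compared. -/
theorem SolvesMotion.exists_lift {y : ℝ → Phase ν L} (hy : SolvesMotion W y)
    {q p : Site ν → Mom d} (h0 : y 0 = phase L q p) :
    ∃ Q P : ℝ → Site ν → Mom d, (∀ t, y t = phase L (Q t) (P t)) ∧ Q 0 = q ∧ P 0 = p ∧
      (∀ i t, HasDerivAt (fun s => Q s i) (P t i) t) ∧
      ∀ i t, HasDerivAt (fun s => P s i) (force W i (proj L (Q t))) t := by
  choose Q hQ hQ' using fun i => (hy i).1
  have hyi : ∀ i, y 0 i = ((q i : Pos L), p i) := fun i => congrFun h0 i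
  have h1 : ∀ t, y t = phase L (fun i => Q i t + (q i - Q i 0)) (fun i => (y t i).2) := by
    intro t
    funext i
    refine Prod.ext ?_ rfl
    have h2 : (Q i 0 : Pos L) = (q i : Pos L) := by rw [hQ i 0, hyi]
    simp only [phase]
    rw [QuotientAddGroup.mk_add, QuotientAddGroup.mk_sub, h2, sub_self, add_zero, hQ i t]
  refine ⟨fun t i => Q i t + (q i - Q i 0), fun t i => (y t i).2, h1, ?_, ?_, ?_, ?_⟩
  · funext i; simp
  · exact funext fun i => congrArg Prod.snd (hyi i)
  · intro i t
    exact (hQ' i t).add_const _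
  · intro i t
    have h2 := (hy i).2 t
    have h3 : positions (y t) = proj L (fun i => Q i t + (q i - Q i 0)) := by
      funext j
      have := congrFun (h1 t) j
      exact congrArg Prod.fst this
    rw [h3] at h2
    exact h2

theorem isMotion_of_hasDerivAt {Q P : ℝ → Site ν → Mom d}
    (hQ : ∀ i t, HasDerivAt (fun s => Q s i) (P t i) t)
    (hP : ∀ i t, HasDerivAt (fun s => P s i) (force W i (proj L (Q t))) t) (T : ℝ) :
    IsMotion W (fun _ _ => 1) T Q P :=
  ⟨fun _ _ => zero_le_one, fun _ _ => le_rfl, fun i t _ => by simpa using hQ i t,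
    fun i t _ => by simpa using hP i t⟩

theorem solvesMotion_of_hasDerivAt {Q P : ℝ → Site ν → Mom d}
    (hQ : ∀ i t, HasDerivAt (fun s => Q s i) (P t i) t)
    (hP : ∀ i t, HasDerivAt (fun s => P s i) (force W i (proj L (Q t))) t) :
    SolvesMotion W (fun t => phase L (Q t) (P t)) :=
  fun i => ⟨⟨fun t => Q t i, fun _ => rfl, hQ i⟩, hP i⟩

theorem mem_growthSet_iff (hP1 : OnSiteNonneg W) {r : ℝ} {ω : Phase ν L} :
    ω ∈ growthSet W r ↔ ∃ C : ℝ, 0 < C ∧ ∀ i, energyNI W i ω ≤ C * weight r i := by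
  refine exists_congr fun C => and_congr_right fun _ => forall_congr' fun i => ?_
  rw [abs_of_nonneg (energyNI_nonneg hP1 i ω)]
  rfl

theorem growthSet_mono (hP1 : OnSiteNonneg W) {r s : ℝ} (h : r ≤ s) :
    growthSet W r ⊆ growthSet W s := by
  intro ω hω
  rw [mem_growthSet_iff hP1] at hω ⊢
  obtain ⟨C, hC, hb⟩ := hω
  exact ⟨C, hC, fun i => (hb i).trans (mul_le_mul_of_nonneg_left (weight_mono h i) hC.le)⟩

/-- A trajectory is bounded in `𝔅_r` uniformly on compact time intervals. -/
theorem Controlled.exists_bound_of_trajectory {D : ℕ} {A : ℝ} (h : Controlled W D A)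
    {Q P : ℝ → Site ν → Mom d} (hQ : ∀ i t, HasDerivAt (fun s => Q s i) (P t i) t)
    (hP : ∀ i t, HasDerivAt (fun s => P s i) (force W i (proj L (Q t))) t) {r : ℝ} (hr : 0 ≤ r)
    (hg : ∀ t, phase L (Q t) (P t) ∈ growthSet W r) (T : ℝ) :
    ∃ M : ℝ, 0 ≤ M ∧ ∀ i t, |t| ≤ T → energyNI W i (phase L (Q t) (P t)) ≤ M * weight r i := by
  obtain ⟨e', he'⟩ : ∃ e' : Site ν → ℝ → ℝ, ∀ i t,
      HasDerivAt (fun s => energyNI W i (phase L (Q s) (P s))) (e' i t) t := by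
    classical
    exact ⟨_, fun i t => h.hasDerivAt_energyNI (c := 1) (by simpa using hQ i t)
      (by simpa using hP i t)⟩
  -- Staying in `𝔅_r` gives a constant at each time, with no uniformity in time; the Baire argument
  -- supplies it.
  have key := locally_bounded_of_pointwise_bounded
    (e := fun i t => energyNI W i (phase L (Q t) (P t))) (w := weight r)
    (h.growthRate_nonneg r) (fun i => (weight_pos r i).le)
    (fun i => continuous_iff_continuousAt.2 fun t => (he' i t).continuousAt)
    (fun t => by
      obtain ⟨C, hC, hb⟩ := (mem_growthSet_iff h.nonneg).1 (hg t)
      exact ⟨C, hC.le, hb⟩)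
    (fun s t hM C hC hb => by
      obtain ⟨M, hM0, hM⟩ := hM
      refine (h.energyNI_propagation (isMotion_of_hasDerivAt hQ hP (max |s| |t|)) hr hM0
        (fun u hu => ?_) (fun i u hu => hM u hu i)).2 C hC hb
      rcases mem_uIcc.1 hu with hu | hu
      · exact abs_le_max_abs_abs hu.1 hu.2
      · rw [max_comm]; exact abs_le_max_abs_abs hu.1 hu.2)
  choose n hn using key
  obtain ⟨F, -, hF⟩ := (isCompact_Icc (a := -T) (b := T)).elim_nhds_subcover
    (fun v => {x | ∀ i, energyNI W i (phase L (Q x) (P x)) ≤ n v * weight r i})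
    (fun v _ => hn v)
  refine ⟨∑ v ∈ F, (n v : ℝ), by positivity, fun i t ht => ?_⟩
  obtain ⟨x, hx, htx⟩ := mem_iUnion₂.1 (hF (abs_le.1 ht))
  refine (htx i).trans (mul_le_mul_of_nonneg_right ?_ (weight_pos r i).le)
  exact Finset.single_le_sum (f := fun v => (n v : ℝ)) (fun _ _ => by positivity) hx

/-- Neither trajectory is slowed down anywhere, so `comparison` applies with every `n` and every
`ε`. The two exponents may differ; their maximum is still below `2`. -/
theorem Controlled.trajectory_unique {D : ℕ} {A : ℝ} (h : Controlled W D A)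
    {y y' : ℝ → Phase ν L} (hy : IsTrajectory W y) (hy' : IsTrajectory W y') (h0 : y 0 = y' 0) :
    y = y' := by
  obtain ⟨hs, r, hr, hr2, hg⟩ := hy
  obtain ⟨hs', r', hr', hr2', hg'⟩ := hy'
  obtain ⟨q, p, hqp⟩ := exists_phase_eq (y 0)
  obtain ⟨Q, P, hyQ, hQ0, hP0, hQ, hP⟩ := hs.exists_lift hqp.symm
  obtain ⟨Q', P', hyQ', hQ0', hP0', hQ', hP'⟩ := hs'.exists_lift (h0 ▸ hqp.symm)
  have hmax : 0 ≤ max r r' := hr.le.trans (le_max_left _ _)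
  have hgm : ∀ t, phase L (Q t) (P t) ∈ growthSet W (max r r') := fun t =>
    hyQ t ▸ growthSet_mono h.nonneg (le_max_left _ _) (hg t)
  have hgm' : ∀ t, phase L (Q' t) (P' t) ∈ growthSet W (max r r') := fun t =>
    hyQ' t ▸ growthSet_mono h.nonneg (le_max_right _ _) (hg' t)
  have hall : ∀ t i, Q t i = Q' t i ∧ P t i = P' t i := by
    intro t i
    obtain ⟨M, hM, hb⟩ := h.exists_bound_of_trajectory hQ hP hmax hgm |t|
    obtain ⟨M', hM', hb'⟩ := h.exists_bound_of_trajectory hQ' hP' hmax hgm' |t|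
    obtain ⟨m, hm⟩ := exists_nat_ge ‖i‖
    have hle : ∀ ε > 0, ‖Q t i - Q' t i‖ ≤ ε ∧ ‖P t i - P' t i‖ ≤ ε := by
      intro ε hε
      obtain ⟨n, hn⟩ := h.comparison (r := max r r') (M := max M M') hmax (max_lt hr2 hr2')
        (hM.trans (le_max_left _ _)) (abs_nonneg t) m hε
      have := hn Q P Q' P' ⟨fun i _ t _ => hQ i t, fun i _ t _ => hP i t, fun i _ t _ => hQ' i t,
        fun i _ t _ => hP' i t, by rw [hQ0, hQ0'], by rw [hP0, hP0'],
        fun i t ht => (hb i t ht).trans (mul_le_mul_of_nonneg_right (le_max_left _ _)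
          (weight_pos _ i).le),
        fun i t ht => (hb' i t ht).trans (mul_le_mul_of_nonneg_right (le_max_right _ _)
          (weight_pos _ i).le)⟩ i hm t le_rfl
      exact ⟨this.1, this.2.1⟩
    constructor
    · refine sub_eq_zero.1 (norm_le_zero_iff.1 (le_of_forall_pos_le_add fun ε hε => ?_))
      rw [zero_add]; exact (hle ε hε).1
    · refine sub_eq_zero.1 (norm_le_zero_iff.1 (le_of_forall_pos_le_add fun ε hε => ?_))
      rw [zero_add]; exact (hle ε hε).2
  funext t
  rw [hyQ, hyQ', show Q t = Q' t from funext fun i => (hall t i).1,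
    show P t = P' t from funext fun i => (hall t i).2]

end Uniqueness

/-! ### Flows of bounded Lipschitz vector fields -/

section GlobalFlow

open Set Filter Topology

variable {E : Type*} [NormedAddCommGroup E] [NormedSpace ℝ E]

/-- Wherever the field does not vanish locally, a period moves the point into the compact set `S`,
so the maxima over `S` of the field and of its derivative are global bounds. -/
theorem exists_lipschitz_bounded_of_periodic {F : E → E} (hF : ContDiff ℝ 1 F) {S : Set E}
    (hS : IsCompact S)
    (hper : ∀ x, F =ᶠ[𝓝 x] (fun _ => 0) ∨ ∃ v, x + v ∈ S ∧ ∀ z, F (z + v) = F z) :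
    ∃ K : ℝ≥0, LipschitzWith K F ∧ ∀ x, ‖F x‖ ≤ K := by
  obtain ⟨K₁, hK₁⟩ := hS.exists_bound_of_continuousOn hF.continuous.continuousOn
  obtain ⟨K₂, hK₂⟩ := hS.exists_bound_of_continuousOn
    (hF.continuous_fderiv one_ne_zero).continuousOn
  let K : ℝ≥0 := ⟨max 0 (max K₁ K₂), le_max_left _ _⟩
  refine ⟨K, lipschitzWith_of_nnnorm_fderiv_le (hF.differentiable one_ne_zero) fun x => ?_,
    fun x => ?_⟩
  · rw [← NNReal.coe_le_coe, coe_nnnorm]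
    rcases hper x with h0 | ⟨v, hv, hFv⟩
    · rw [h0.fderiv_eq]
      simp
    · have h1 : fderiv ℝ F x = fderiv ℝ F (x + v) := by
        rw [← fderiv_comp_add_right]
        congr 1
        exact (funext hFv).symm
      rw [h1]
      exact (hK₂ _ hv).trans ((le_max_right _ _).trans (le_max_right _ _))
  · rcases hper x with h0 | ⟨v, hv, hFv⟩
    · rw [h0.eq_of_nhds]
      simp
    · rw [← hFv]
      exact (hK₁ _ hv).trans ((le_max_left _ _).trans (le_max_right _ _))

theorem dist_le_of_trajectories_forward {F : E → E} {K : ℝ≥0} (hF : LipschitzWith K F)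
    {f g : ℝ → E} {T : ℝ} (hf : ∀ t ∈ Icc 0 T, HasDerivAt f (F (f t)) t)
    (hg : ∀ t ∈ Icc 0 T, HasDerivAt g (F (g t)) t) (hT : 0 ≤ T) :
    dist (f T) (g T) ≤ dist (f 0) (g 0) * Real.exp (K * T) := by
  have := dist_le_of_trajectories_ODE (v := fun _ => F) (K := K) (fun _ => hF)
    (fun t ht => (hf t ht).continuousAt.continuousWithinAt)
    (fun t ht => (hf t (Ico_subset_Icc_self ht)).hasDerivWithinAt)
    (fun t ht => (hg t ht).continuousAt.continuousWithinAt)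
    (fun t ht => (hg t (Ico_subset_Icc_self ht)).hasDerivWithinAt) le_rfl T ⟨hT, le_rfl⟩
  simpa using this

theorem dist_le_of_trajectories {F : E → E} {K : ℝ≥0} (hF : LipschitzWith K F)
    {f g : ℝ → E} {T : ℝ} (hf : ∀ t, |t| ≤ T → HasDerivAt f (F (f t)) t)
    (hg : ∀ t, |t| ≤ T → HasDerivAt g (F (g t)) t) {t : ℝ} (ht : |t| ≤ T) :
    dist (f t) (g t) ≤ dist (f 0) (g 0) * Real.exp (K * |t|) := by
  rcases le_total 0 t with h | h
  · rw [abs_of_nonneg h] at ht ⊢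
    have hs : ∀ s ∈ Icc 0 t, |s| ≤ T := fun s hs => by
      rw [abs_of_nonneg hs.1]; exact hs.2.trans ht
    exact dist_le_of_trajectories_forward hF (fun s hs' => hf s (hs s hs'))
      (fun s hs' => hg s (hs s hs')) h
  · rw [abs_of_nonpos h] at ht ⊢
    have hs : ∀ s ∈ Icc 0 (-t), |-s| ≤ T := fun s hs => by
      rw [abs_neg, abs_of_nonneg hs.1]; exact hs.2.trans ht
    have hrev : ∀ f : ℝ → E, (∀ t, |t| ≤ T → HasDerivAt f (F (f t)) t) →
        ∀ s ∈ Icc 0 (-t), HasDerivAt (fun u => f (-u)) (-F (f (-s))) s := by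
      intro f hf s hs'
      have := (hf (-s) (hs s hs')).scomp s (hasDerivAt_neg s)
      simpa [Function.comp_def] using this
    have := dist_le_of_trajectories_forward (F := fun x => -F x) hF.neg (hrev f hf) (hrev g hg)
      (by linarith)
    simpa using this

theorem exists_flow_of_lipschitz_bounded [CompleteSpace E] {F : E → E} {K : ℝ≥0}
    (hF : LipschitzWith K F) (hK : ∀ x, ‖F x‖ ≤ K) {T : ℝ} (hT : 0 ≤ T) :
    ∃ Φ : E → ℝ → E, (∀ x, Φ x 0 = x ∧ ∀ t, |t| ≤ T → HasDerivAt (Φ x) (F (Φ x t)) t) ∧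
      ∀ t, |t| ≤ T → Continuous fun x => Φ x t := by
  have hex : ∀ x : E, ∃ α : ℝ → E, α 0 = x ∧ ∀ t, |t| ≤ T → HasDerivAt α (F (α t)) t := by
    intro x
    have h0 : (0 : ℝ) ∈ Icc (-(T + 1)) (T + 1) := ⟨by linarith, by linarith⟩
    -- The field is bounded by `K` everywhere, so a solution cannot leave the ball of radius `K (T +
    -- 1)` within time `T + 1`, and one application covers the whole interval. The extra unit of
    -- time makes the derivatives at `±T` two-sided.
    have hpl : IsPicardLindelof (fun _ => F) (⟨0, h0⟩ : Icc (-(T + 1)) (T + 1)) x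
        (K * ⟨T + 1, by linarith⟩) 0 K K := by
      refine ⟨fun t _ => hF.lipschitzOnWith, fun x _ => continuousOn_const, fun t _ x _ => hK x, ?_⟩
      simp only [sub_zero, zero_sub, neg_neg, max_self, NNReal.coe_zero]
      exact (NNReal.coe_mul K ⟨T + 1, by linarith⟩).ge
    obtain ⟨α, h1, h2⟩ := hpl.exists_eq_forall_mem_Icc_hasDerivWithinAt₀
    refine ⟨α, h1, fun t ht => (h2 t ?_).hasDerivAt (Icc_mem_nhds ?_ ?_)⟩
    · constructor <;> linarith [(abs_le.1 ht).1, (abs_le.1 ht).2]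
    · linarith [(abs_le.1 ht).1]
    · linarith [(abs_le.1 ht).2]
  choose Φ hΦ hΦ' using hex
  refine ⟨Φ, fun x => ⟨hΦ x, hΦ' x⟩, fun t ht => ?_⟩
  have : LipschitzWith ⟨Real.exp (K * |t|), (Real.exp_pos _).le⟩ (fun x => Φ x t) := by
    refine LipschitzWith.of_dist_le_mul fun x y => ?_
    have := dist_le_of_trajectories hF (hΦ' x) (hΦ' y) ht
    rw [hΦ, hΦ, mul_comm] at this
    exact this
  exact this.continuous

end GlobalFlow

/-! ### Finite systems that are slowed down at high energy -/

section Approximation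

open Set Filter Topology

variable {ν d : ℕ} {L : AddSubgroup (Mom d)} {W : Interaction ν L}

/-- The positions of a state of a finite system, extended by zero. -/
def posOf {Λ : Finset (Site ν)} (x : {j // j ∈ Λ} → Mom d × Mom d) (j : Site ν) : Mom d :=
  if h : j ∈ Λ then (x ⟨j, h⟩).1 else 0

/-- The momenta of a state of a finite system, extended by zero. -/
def momOf {Λ : Finset (Site ν)} (x : {j // j ∈ Λ} → Mom d × Mom d) (j : Site ν) : Mom d :=
  if h : j ∈ Λ then (x ⟨j, h⟩).2 else 0

theorem contDiff_posOf {Λ : Finset (Site ν)} {n : WithTop ℕ∞} (j : Site ν) :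
    ContDiff ℝ n (fun x : {j // j ∈ Λ} → Mom d × Mom d => posOf x j) := by
  unfold posOf
  split_ifs
  · exact contDiff_fst.comp (contDiff_apply ℝ (Mom d × Mom d) _)
  · exact contDiff_const

theorem contDiff_momOf {Λ : Finset (Site ν)} {n : WithTop ℕ∞} (j : Site ν) :
    ContDiff ℝ n (fun x : {j // j ∈ Λ} → Mom d × Mom d => momOf x j) := by
  unfold momOf
  split_ifs
  · exact contDiff_snd.comp (contDiff_apply ℝ (Mom d × Mom d) _)
  · exact contDiff_const

/-- The slowdown factor, which is one at total energies at most `R`, and zero at total energies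
at least `2 R`. -/
noncomputable def cutoff (W : Interaction ν L) (R : ℝ) (Λ : Finset (Site ν)) (ω : Phase ν L) : ℝ :=
  Real.smoothTransition (2 - (∑ j ∈ Λ, energyNI W j ω) / R)

theorem Controlled.contDiff_sum_energyNI {D : ℕ} {A : ℝ} (h : Controlled W D A)
    (Λ : Finset (Site ν)) : ContDiff ℝ 1 (fun x : {j // j ∈ Λ} → Mom d × Mom d =>
      ∑ j ∈ Λ, energyNI W j (phase L (posOf x) (momOf x))) := by
  refine ContDiff.sum fun j _ => ?_
  have h4 : (fun x : {j // j ∈ Λ} → Mom d × Mom d =>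
      energyNI W j (phase L (posOf x) (momOf x))) =
      fun x => 1 / 2 * ‖momOf x j‖ ^ 2 + W.ext {j} (proj L (posOf x)) := by
    funext s
    rw [← onSite_eq_ext]
    rfl
  rw [h4]
  refine (contDiff_const.mul ((contDiff_momOf j).norm_sq ℝ)).add ?_
  exact (contDiff_ext h.regular {j} fun k => contDiff_posOf k).of_le (by norm_num)

theorem Controlled.contDiff_cutoff {D : ℕ} {A : ℝ} (h : Controlled W D A) (R : ℝ)
    (Λ : Finset (Site ν)) : ContDiff ℝ 1 (fun x : {j // j ∈ Λ} → Mom d × Mom d =>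
      cutoff W R Λ (phase L (posOf x) (momOf x))) :=
  Real.smoothTransition.contDiff.comp
    (contDiff_const.sub ((h.contDiff_sum_energyNI Λ).div_const R))

theorem Controlled.contDiff_force {D : ℕ} {A : ℝ} (h : Controlled W D A) (i : Site ν)
    (Λ : Finset (Site ν)) : ContDiff ℝ 1 (fun x : {j // j ∈ Λ} → Mom d × Mom d =>
      force W i (proj L (posOf x))) := by
  simp only [h.force_eq]
  exact (ContDiff.sum fun Δ _ => contDiff_pgrad h.regular Δ i fun k => contDiff_posOf k).neg

open scoped Classical in
/-- The vector field of the finite system on `Λ` in which only the particles in `B` move. -/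
noncomputable def field (W : Interaction ν L) (R : ℝ) (Λ B : Finset (Site ν))
    (x : {j // j ∈ Λ} → Mom d × Mom d) : {j // j ∈ Λ} → Mom d × Mom d := fun j =>
  if (j : Site ν) ∈ B then (cutoff W R Λ (phase L (posOf x) (momOf x)) • momOf x j,
    cutoff W R Λ (phase L (posOf x) (momOf x)) • force W j (proj L (posOf x))) else 0

theorem Controlled.contDiff_field {D : ℕ} {A : ℝ} (h : Controlled W D A) (R : ℝ)
    (Λ B : Finset (Site ν)) : ContDiff ℝ 1 (field W R Λ B) := by
  refine contDiff_pi.2 fun j => ?_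
  unfold field
  split_ifs
  · exact ((h.contDiff_cutoff R Λ).smul (contDiff_momOf _)).prodMk
      ((h.contDiff_cutoff R Λ).smul (h.contDiff_force _ Λ))
  · exact contDiff_const

theorem exists_norm_add_le (x : Mom d) : ∃ l ∈ L, ‖x + l‖ ≤ ‖(x : Pos L)‖ + 1 := by
  obtain ⟨m, hm, hlt⟩ := QuotientAddGroup.exists_norm_mk_lt (x : Pos L) one_pos
  refine ⟨-x + m, (QuotientAddGroup.eq).1 hm.symm, ?_⟩
  rw [add_neg_cancel_left]
  exact hlt.le

/-- Above total energy `2 R` the field vanishes. Below it, the momenta are bounded, by (P3) the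
positions are bounded modulo `L`, and translations by `L` are periods of the field. -/
theorem Controlled.exists_lipschitz_field {D : ℕ} {A : ℝ} (h : Controlled W D A) {R : ℝ}
    (hR : 0 < R) (Λ B : Finset (Site ν)) :
    ∃ K : ℝ≥0, LipschitzWith K (field W R Λ B) ∧ ∀ x, ‖field W R Λ B x‖ ≤ K := by
  classical
  have hA := h.one_le
  refine exists_lipschitz_bounded_of_periodic (h.contDiff_field R Λ B)
    -- Positions need `A (2 R) + 1`, with one unit to spare for choosing an almost shortest
    -- representative; momenta satisfy `|p|² ≤ 4 R`, hence `2 |p| ≤ 1 + 4 R`.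
    (isCompact_closedBall (0 : {j // j ∈ Λ} → Mom d × Mom d) (A * (2 * R) + 4 * R + 2))
    fun x => ?_
  rcases lt_or_ge (2 * R) (∑ j ∈ Λ, energyNI W j (phase L (posOf x) (momOf x))) with hx | hx
  · left
    filter_upwards [(isOpen_lt continuous_const (h.contDiff_sum_energyNI Λ).continuous).mem_nhds hx]
      with z hz
    have h0 : cutoff W R Λ (phase L (posOf z) (momOf z)) = 0 := by
      refine Real.smoothTransition.zero_of_nonpos ?_
      have : 2 ≤ (∑ j ∈ Λ, energyNI W j (phase L (posOf z) (momOf z))) / R := by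
        rw [le_div_iff₀ hR]; exact le_of_lt hz
      linarith
    funext j
    simp [field, h0]
  · right
    have he : ∀ j ∈ Λ, energyNI W j (phase L (posOf x) (momOf x)) ≤ 2 * R := fun j hj =>
      (Finset.single_le_sum (f := fun j => energyNI W j (phase L (posOf x) (momOf x)))
        (fun j _ => energyNI_nonneg h.nonneg j _) hj).trans hx
    choose l hl hlx using fun j : {j // j ∈ Λ} => exists_norm_add_le (L := L) (x j).1
    refine ⟨fun j => (l j, 0), ?_, fun z => ?_⟩
    · rw [mem_closedBall_zero_iff, pi_norm_le_iff_of_nonneg (by positivity)]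
      intro j
      have hp : posOf x (j : Site ν) = (x j).1 := by simp [posOf]
      have hm : momOf x (j : Site ν) = (x j).2 := by simp [momOf]
      have h1 := h.growth j ((x j).1 : Pos L)
      have h2 := onSite_le_energyNI (W := W) (j : Site ν) (phase L (posOf x) (momOf x))
      have h3 := sq_norm_le_energyNI h.nonneg (j : Site ν) (phase L (posOf x) (momOf x))
      simp only [phase, hp, hm] at h2 h3
      have h4 := he j j.2
      have h5 := mul_le_mul_of_nonneg_left (h2.trans h4) (zero_le_one.trans hA)
      rw [Pi.add_apply, Prod.norm_def, max_le_iff]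
      constructor
      · refine (hlx j).trans ?_
        linarith
      · simp only [Prod.snd_add, add_zero]
        have h6 : 0 ≤ A * (2 * R) := by positivity
        nlinarith [sq_nonneg (‖(x j).2‖ - 1)]
    · have h1 : proj L (posOf (z + fun j => (l j, 0))) = proj L (posOf z) := by
        funext j
        simp only [proj, posOf]
        split_ifs with hj
        · simp only [Pi.add_apply, Prod.fst_add]
          rw [QuotientAddGroup.mk_add, (QuotientAddGroup.eq_zero_iff (l ⟨j, hj⟩)).2 (hl _),
            add_zero]
        · rfl
      have h2 : momOf (z + fun j => (l j, 0)) = momOf z := by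
        funext j
        simp [momOf]
      have h3 : phase L (posOf (z + fun j => (l j, 0))) (momOf (z + fun j => (l j, 0))) =
          phase L (posOf z) (momOf z) := by
        rw [h2]
        funext j
        exact Prod.ext (congrFun h1 j) rfl
      funext j
      simp only [field]
      rw [h3, h1, h2]

/-- The motions of a large finite system of particles, which are slowed down at high energies. -/
theorem Controlled.exists_approximation {D : ℕ} {A : ℝ} (h : Controlled W D A) (n : ℕ) {R : ℝ}
    (hR : 0 < R) : ∃ Q P : ℝ → (Site ν → Mom d) × (Site ν → Mom d) → Site ν → Mom d,
      (∀ t : ℝ, |t| ≤ n → Continuous (Q t) ∧ Continuous (P t)) ∧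
      ∀ x, Q 0 x = x.1 ∧ P 0 x = x.2 ∧ ∃ θ : Site ν → ℝ → ℝ,
        IsMotion W θ n (fun t => Q t x) (fun t => P t x) ∧
        (∀ i ∉ nbhd n (0 : Site ν), ∀ t, θ i t = 0) ∧
        ∀ t, ∑ j ∈ nbhd (n + D) (0 : Site ν), energyNI W j (phase L (Q t x) (P t x)) ≤ R →
          ∀ i ∈ nbhd n (0 : Site ν), θ i t = 1 := by
  classical
  -- Only the particles in `B` move, and the forces on them involve only sites of the larger box
  -- `Λ`.
  set Λ := nbhd (n + D) (0 : Site ν) with hΛ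
  set B := nbhd n (0 : Site ν) with hB
  have hBΛ : ∀ i ∈ B, nbhd D i ⊆ Λ := by
    intro i hi j hj
    rw [hB, mem_nbhd, zero_sub, norm_neg] at hi
    rw [hΛ, mem_nbhd, zero_sub, norm_neg]
    push_cast
    linarith [norm_le_of_mem_nbhd hj]
  have hBΛ' : ∀ i ∈ B, i ∈ Λ := fun i hi => hBΛ i hi (self_mem_nbhd D i)
  obtain ⟨K, hK, hK'⟩ := h.exists_lipschitz_field hR Λ B
  obtain ⟨Φ, hΦ, hΦc⟩ := exists_flow_of_lipschitz_bounded hK hK' (Nat.cast_nonneg n : (0 : ℝ) ≤ n)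
  let res : (Site ν → Mom d) × (Site ν → Mom d) → {j // j ∈ Λ} → Mom d × Mom d :=
    fun x j => (x.1 j, x.2 j)
  have hres : Continuous res := by fun_prop
  let Q : ℝ → (Site ν → Mom d) × (Site ν → Mom d) → Site ν → Mom d :=
    fun t x j => if hj : j ∈ Λ then (Φ (res x) t ⟨j, hj⟩).1 else x.1 j
  let P : ℝ → (Site ν → Mom d) × (Site ν → Mom d) → Site ν → Mom d :=
    fun t x j => if hj : j ∈ Λ then (Φ (res x) t ⟨j, hj⟩).2 else x.2 j
  have hQ : ∀ t x, ∀ j ∈ Λ, Q t x j = posOf (Φ (res x) t) j := by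
    intro t x j hj
    simp [Q, posOf, hj]
  have hP : ∀ t x, ∀ j ∈ Λ, P t x j = momOf (Φ (res x) t) j := by
    intro t x j hj
    simp [P, momOf, hj]
  have hcut : ∀ t x, cutoff W R Λ (phase L (posOf (Φ (res x) t)) (momOf (Φ (res x) t))) =
      cutoff W R Λ (phase L (Q t x) (P t x)) := by
    intro t x
    unfold cutoff
    congr 3
    refine Finset.sum_congr rfl fun j hj => ?_
    simp only [energyNI, phase, hQ t x j hj, hP t x j hj]
  have hforce : ∀ t x, ∀ i ∈ B, force W i (proj L (posOf (Φ (res x) t))) =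
      force W i (proj L (Q t x)) := by
    intro t x i hi
    refine h.force_congr fun j hj => ?_
    simp only [proj, hQ t x j (hBΛ i hi hj)]
  refine ⟨Q, P, fun t ht => ⟨?_, ?_⟩, fun x => ⟨?_, ?_, ?_⟩⟩
  · refine continuous_pi fun j => ?_
    simp only [Q]
    split_ifs with hj
    · exact continuous_fst.comp ((continuous_apply _).comp ((hΦc t ht).comp hres))
    · fun_prop
  · refine continuous_pi fun j => ?_
    simp only [P]
    split_ifs with hj
    · exact continuous_snd.comp ((continuous_apply _).comp ((hΦc t ht).comp hres))
    · fun_prop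
  · funext j
    simp only [Q, (hΦ _).1, res]
    split_ifs <;> rfl
  · funext j
    simp only [P, (hΦ _).1, res]
    split_ifs <;> rfl
  · refine ⟨fun i t => if i ∈ B then cutoff W R Λ (phase L (Q t x) (P t x)) else 0,
      ⟨?_, ?_, ?_, ?_⟩, ?_, ?_⟩
    · intro i t
      split_ifs
      · exact Real.smoothTransition.nonneg _
      · exact le_rfl
    · intro i t
      split_ifs
      · exact Real.smoothTransition.le_one _
      · exact zero_le_one
    · intro i t ht
      by_cases hi : i ∈ Λ
      · have h1 := hasDerivAt_pi.1 ((hΦ (res x)).2 t ht) ⟨i, hi⟩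
        have h2 := (ContinuousLinearMap.fst ℝ (Mom d) (Mom d)).hasFDerivAt.comp_hasDerivAt t h1
        simp only [Q, hi, dif_pos]
        refine h2.congr_deriv ?_
        simp only [field]
        split_ifs
        · rw [hcut, ← hP t x i hi]
          rfl
        · simp
      · have hiB : i ∉ B := fun hb => hi (hBΛ' i hb)
        simp only [Q, hi, hiB, dif_neg, not_false_eq_true, if_neg, zero_smul]
        exact hasDerivAt_const _ _
    · intro i t ht
      by_cases hi : i ∈ Λ
      · have h1 := hasDerivAt_pi.1 ((hΦ (res x)).2 t ht) ⟨i, hi⟩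
        have h2 := (ContinuousLinearMap.snd ℝ (Mom d) (Mom d)).hasFDerivAt.comp_hasDerivAt t h1
        simp only [P, hi, dif_pos]
        refine h2.congr_deriv ?_
        simp only [field]
        split_ifs with hiB
        · rw [hcut, hforce t x i hiB]
          rfl
        · simp
      · have hiB : i ∉ B := fun hb => hi (hBΛ' i hb)
        simp only [P, hi, hiB, dif_neg, not_false_eq_true, if_neg, zero_smul]
        exact hasDerivAt_const _ _
    · intro i hi t
      exact if_neg hi
    · intro t ht i hi
      dsimp only
      rw [if_pos hi]
      refine Real.smoothTransition.one_of_one_le ?_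
      have : (∑ j ∈ Λ, energyNI W j (phase L (Q t x) (P t x))) / R ≤ 1 := by
        rw [div_le_one hR]; exact ht
      linarith

end Approximation

/-! ### Existence of the time evolution as a limit of finite systems -/

section Existence

open Set Filter Topology

variable {ν d : ℕ} {L : AddSubgroup (Mom d)} {W : Interaction ν L}

theorem continuous_energyNI_phase (hR : Regular W) (i : Site ν) :
    Continuous (fun x : (Site ν → Mom d) × (Site ν → Mom d) =>
      energyNI W i (phase L x.1 x.2)) := by
  have : (fun x : (Site ν → Mom d) × (Site ν → Mom d) => energyNI W i (phase L x.1 x.2)) =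
      fun x => 1 / 2 * ‖x.2 i‖ ^ 2 + W.ext {i} (proj L x.1) := by
    funext x
    rw [← onSite_eq_ext]
    rfl
  rw [this]
  have h1 : Continuous (fun x : (Site ν → Mom d) × (Site ν → Mom d) => x.2 i) := by fun_prop
  exact (continuous_const.mul (h1.norm.pow 2)).add ((continuous_ext hR {i}).comp continuous_fst)

theorem Controlled.continuous_force {D : ℕ} {A : ℝ} (h : Controlled W D A) (i : Site ν) :
    Continuous (fun q : Site ν → Mom d => force W i (proj L q)) := by
  simp only [h.force_eq]
  exact (continuous_finsetSum _ fun Δ _ => continuous_pgrad h.regular Δ i).neg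

/-- Motions of which all but finitely many particles are at rest are bounded in `𝔅_r`. -/
theorem Controlled.exists_bound_of_finite {D : ℕ} {A : ℝ} (h : Controlled W D A)
    {θ : Site ν → ℝ → ℝ} {T : ℝ} {Q P : ℝ → Site ν → Mom d} (hm : IsMotion W θ T Q P)
    {B : Finset (Site ν)} (hθ : ∀ i ∉ B, ∀ t, θ i t = 0) {r C : ℝ} (hr : 0 ≤ r) (hC : 0 ≤ C)
    (h0 : ∀ i, energyNI W i (phase L (Q 0) (P 0)) ≤ C * weight r i) :
    ∃ M : ℝ, 0 ≤ M ∧ ∀ i t, |t| ≤ T → energyNI W i (phase L (Q t) (P t)) ≤ M * weight r i := by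
  have hrest : ∀ i ∉ B, ∀ t, |t| ≤ T → Q t i = Q 0 i ∧ P t i = P 0 i := by
    intro i hi t ht
    constructor
    · have := norm_le_of_norm_deriv_le_abs (f := fun s => Q s i - Q 0 i) (B := fun _ => 0)
        (B' := fun _ => 0) (fun s hs => (hm.pos i s hs).sub_const _) (by simp)
        (fun s => hasDerivAt_const s 0) (fun s _ => by simp [hθ i hi]) t ht
      exact sub_eq_zero.1 (norm_le_zero_iff.1 this)
    · have := norm_le_of_norm_deriv_le_abs (f := fun s => P s i - P 0 i) (B := fun _ => 0)
        (B' := fun _ => 0) (fun s hs => (hm.mom i s hs).sub_const _) (by simp)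
        (fun s => hasDerivAt_const s 0) (fun s _ => by simp [hθ i hi]) t ht
      exact sub_eq_zero.1 (norm_le_zero_iff.1 this)
  obtain ⟨e', he'⟩ := h.exists_hasDerivAt_energyNI hm
  -- Outside `B` nothing moves, and inside there are only finitely many energies, each continuous on
  -- a compact interval. The resulting bound depends on `B`, but it only serves as the a priori
  -- constant for propagation.
  have hbd : ∀ i, ∃ b : ℝ, ∀ t ∈ Icc (-T) T, ‖energyNI W i (phase L (Q t) (P t))‖ ≤ b := fun i =>
    isCompact_Icc.exists_bound_of_continuousOn fun t ht =>
      (he' i t (abs_le.2 ht)).1.continuousAt.continuousWithinAt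
  choose b hb using hbd
  refine ⟨C + ∑ i ∈ B, |b i|, by positivity, fun i t ht => ?_⟩
  by_cases hi : i ∈ B
  · have h1 := (le_abs_self _).trans ((hb i t (abs_le.1 ht)).trans (le_abs_self _))
    have h2 : |b i| ≤ ∑ i ∈ B, |b i| :=
      Finset.single_le_sum (f := fun i => |b i|) (fun _ _ => abs_nonneg _) hi
    have h3 := one_le_weight hr i
    have h4 : 0 ≤ C + ∑ i ∈ B, |b i| := by positivity
    nlinarith
  · have h1 : energyNI W i (phase L (Q t) (P t)) = energyNI W i (phase L (Q 0) (P 0)) := by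
      simp only [energyNI, phase, (hrest i hi t ht).1, (hrest i hi t ht).2]
    rw [h1]
    refine (h0 i).trans (mul_le_mul_of_nonneg_right ?_ (weight_pos r i).le)
    have : 0 ≤ ∑ i ∈ B, |b i| := by positivity
    linarith

theorem exists_limit_of_uniform_cauchy {E : Type*} [NormedAddCommGroup E] [CompleteSpace E]
    {f : ℕ → ℝ → E} (h : ∀ T : ℝ, 0 ≤ T → ∀ ε > 0, ∃ N : ℕ, ∀ n ≥ N, ∀ n' ≥ N, ∀ t, |t| ≤ T →
      ‖f n t - f n' t‖ ≤ ε) :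
    ∃ g : ℝ → E, (∀ t, Tendsto (fun n => f n t) atTop (𝓝 (g t))) ∧
      ∀ T : ℝ, 0 ≤ T → TendstoUniformlyOn f g atTop (Ioo (-T) T) := by
  have hc : ∀ t, CauchySeq (fun n => f n t) := by
    intro t
    rw [Metric.cauchySeq_iff']
    intro ε hε
    obtain ⟨N, hN⟩ := h |t| (abs_nonneg t) (ε / 2) (by linarith)
    refine ⟨N, fun n hn => ?_⟩
    rw [dist_eq_norm]
    exact (hN n hn N le_rfl t le_rfl).trans_lt (by linarith)
  choose g hg using fun t => cauchySeq_tendsto_of_complete (hc t)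
  refine ⟨g, hg, fun T hT => ?_⟩
  rw [Metric.tendstoUniformlyOn_iff]
  intro ε hε
  obtain ⟨N, hN⟩ := h T hT (ε / 2) (by linarith)
  filter_upwards [eventually_ge_atTop N] with n hn t ht
  have h1 : Tendsto (fun n' => ‖f n' t - f n t‖) atTop (𝓝 ‖g t - f n t‖) :=
    ((hg t).sub_const _).norm
  have h2 : ‖g t - f n t‖ ≤ ε / 2 := by
    refine le_of_tendsto h1 ?_
    filter_upwards [eventually_ge_atTop N] with n' hn'
    exact hN n' hn' n hn t (abs_le.2 ⟨ht.1.le, ht.2.le⟩)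
  rw [dist_eq_norm]
  linarith

/-- Continuous maps which approximate the time evolution on `Ω_2`. -/
theorem Controlled.exists_flow_approximation {D : ℕ} {A : ℝ} (h : Controlled W D A) :
    ∃ Q P : ℕ → ℝ → (Site ν → Mom d) × (Site ν → Mom d) → Site ν → Mom d,
      (∀ (n : ℕ) (t : ℝ), |t| ≤ n → Continuous (Q n t) ∧ Continuous (P n t)) ∧
      ∀ x, phase L x.1 x.2 ∈ Omega2 W → ∃ Q' P' : ℝ → Site ν → Mom d, Q' 0 = x.1 ∧ P' 0 = x.2 ∧
        (∀ i t, HasDerivAt (fun s => Q' s i) (P' t i) t) ∧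
        (∀ i t, HasDerivAt (fun s => P' s i) (force W i (proj L (Q' t))) t) ∧
        (∃ r : ℝ, 0 < r ∧ r < 2 ∧ ∀ t, phase L (Q' t) (P' t) ∈ growthSet W r) ∧
        ∀ t, Tendsto (fun n => Q n t x) atTop (𝓝 (Q' t)) ∧
          Tendsto (fun n => P n t x) atTop (𝓝 (P' t)) := by
  -- The thresholds do not depend on the initial point, so one sequence of continuous maps serves
  -- all of `Ω_2`; measurability of the flow rests on this. The exponent `3` lets them exceed,
  -- eventually in `n`, the energy in the box for every `r < 2` and every constant.
  let R : ℕ → ℝ := fun n => (nbhd (n + D) (0 : Site ν)).card * (1 + (n + D : ℕ) : ℝ) ^ 3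
  have hcard : ∀ n, 0 < ((nbhd (n + D) (0 : Site ν)).card : ℝ) := fun n => by
    exact_mod_cast Finset.card_pos.2 ⟨_, self_mem_nbhd _ _⟩
  have hR : ∀ n, 0 < R n := fun n => by
    have := hcard n
    positivity
  choose Q P hcont hap using fun n => h.exists_approximation n (hR n)
  refine ⟨Q, P, hcont, fun x hx => ?_⟩
  choose hQ0 hP0 θ hm hθ0 hθ1 using fun n => hap n x
  obtain ⟨r, hr, hr2, hg⟩ := hx
  obtain ⟨C, hC, hb⟩ := (mem_growthSet_iff h.nonneg).1 hg
  set κ := growthRate ν D A r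
  have hκ : 0 ≤ κ := h.growthRate_nonneg r
  have hE : ∀ (n : ℕ) (t : ℝ), |t| ≤ n → ∀ i, energyNI W i (phase L (Q n t x) (P n t x)) ≤
      C * Real.exp (κ * |t|) * weight r i := by
    intro n t ht
    have h0 : ∀ i, energyNI W i (phase L (Q n 0 x) (P n 0 x)) ≤ C * weight r i := by
      rw [hQ0, hP0]; exact hb
    obtain ⟨M, hM, hMb⟩ := h.exists_bound_of_finite (hm n) (hθ0 n) hr.le hC.le h0
    have hu : ∀ u ∈ uIcc (0 : ℝ) t, |u| ≤ n := by
      intro u hu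
      refine le_trans ?_ ht
      rcases mem_uIcc.1 hu with hu | hu
      · exact abs_le_abs_of_nonneg hu.1 hu.2
      · exact abs_le_abs_of_nonpos hu.2 hu.1
    have := (h.energyNI_propagation (hm n) hr.le hM hu (fun i u hu' => hMb i u (hu u hu'))).2 C
      hC.le h0
    simpa using this
  -- Up to time `T` the energy in the box of radius `n + D` stays below `R n` once `n` is large, so
  -- the particles of the inner box are not slowed down.
  have hone : ∀ T : ℝ, ∃ N : ℕ, ∀ n ≥ N, T ≤ n ∧ ∀ t, |t| ≤ T → ∀ i ∈ nbhd n (0 : Site ν),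
      θ n i t = 1 := by
    intro T
    obtain ⟨N, hN⟩ := exists_nat_ge (max T (C * Real.exp (κ * T)))
    refine ⟨N, fun n hn => ?_⟩
    have hn' : (N : ℝ) ≤ n := by exact_mod_cast hn
    have hTn : T ≤ n := (le_max_left _ _).trans (hN.trans hn')
    have hCn : C * Real.exp (κ * T) ≤ n := (le_max_right _ _).trans (hN.trans hn')
    refine ⟨hTn, fun t ht => hθ1 n t ?_⟩
    have hone' : (1 : ℝ) ≤ 1 + (n + D : ℕ) := by
      have := (Nat.cast_nonneg (n + D) : (0 : ℝ) ≤ (n + D : ℕ)); linarith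
    calc ∑ j ∈ nbhd (n + D) (0 : Site ν), energyNI W j (phase L (Q n t x) (P n t x))
        ≤ ∑ j ∈ nbhd (n + D) (0 : Site ν), (1 + (n + D : ℕ) : ℝ) ^ 3 := by
          refine Finset.sum_le_sum fun j hj => ?_
          have hj' : ‖j‖ ≤ (n + D : ℕ) := by simpa [mem_nbhd] using hj
          have h1 : weight r j ≤ (1 + (n + D : ℕ) : ℝ) ^ 2 := by
            refine (weight_le_of_norm_le hr.le hj').trans ?_
            rw [← Real.rpow_natCast]
            exact Real.rpow_le_rpow_of_exponent_le hone' (by norm_num; linarith)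
          have h2 : C * Real.exp (κ * |t|) ≤ 1 + (n + D : ℕ) := by
            calc C * Real.exp (κ * |t|) ≤ C * Real.exp (κ * T) := by gcongr
              _ ≤ n := hCn
              _ ≤ _ := by push_cast; linarith [(Nat.cast_nonneg D : (0 : ℝ) ≤ D)]
          calc _ ≤ C * Real.exp (κ * |t|) * weight r j := hE n t (ht.trans hTn) j
            _ ≤ (1 + (n + D : ℕ)) * (1 + (n + D : ℕ) : ℝ) ^ 2 :=
                mul_le_mul h2 h1 (weight_pos r j).le (by linarith)
            _ = _ := by ring
      _ = R n := by rw [Finset.sum_const, nsmul_eq_mul]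
  -- Two approximations of large index are comparable motions. The forces are included because the
  -- derivatives must converge uniformly too.
  have hcauchy : ∀ i : Site ν, ∀ T : ℝ, 0 ≤ T → ∀ ε > 0, ∃ N : ℕ, ∀ n ≥ N, ∀ n' ≥ N, ∀ t, |t| ≤ T →
      ‖Q n t x i - Q n' t x i‖ ≤ ε ∧ ‖P n t x i - P n' t x i‖ ≤ ε ∧
      ‖force W i (proj L (Q n t x)) - force W i (proj L (Q n' t x))‖ ≤ ε := by
    intro i T hT ε hε
    obtain ⟨m, hm'⟩ := exists_nat_ge ‖i‖
    obtain ⟨n₀, hn₀⟩ := h.comparison (r := r) (M := C * Real.exp (κ * T)) hr.le hr2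
      (by positivity) hT m hε
    obtain ⟨N, hN⟩ := hone T
    have hd : ∀ n ≥ max n₀ N, ∀ i : Site ν, ‖i‖ ≤ n₀ → ∀ t, |t| ≤ T →
        HasDerivAt (fun s => Q n s x i) (P n t x i) t ∧
        HasDerivAt (fun s => P n s x i) (force W i (proj L (Q n t x))) t := by
      intro n hn i hi t ht
      obtain ⟨hTn, h1⟩ := hN n ((le_max_right _ _).trans hn)
      have hnn : (n₀ : ℝ) ≤ n := by exact_mod_cast (le_max_left _ _).trans hn
      have h2 := h1 t ht i (by rw [mem_nbhd, zero_sub, norm_neg]; exact hi.trans hnn)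
      have h3 := (hm n).pos i t (ht.trans hTn)
      have h4 := (hm n).mom i t (ht.trans hTn)
      rw [h2, one_smul] at h3 h4
      exact ⟨h3, h4⟩
    have hbd : ∀ n ≥ max n₀ N, ∀ i t, |t| ≤ T → energyNI W i (phase L (Q n t x) (P n t x)) ≤
        C * Real.exp (κ * T) * weight r i := by
      intro n hn i t ht
      refine (hE n t (ht.trans (hN n ((le_max_right _ _).trans hn)).1) i).trans ?_
      have := (weight_pos r i).le
      gcongr
    refine ⟨max n₀ N, fun n hn n' hn' t ht => hn₀ (fun t => Q n t x) (fun t => P n t x)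
      (fun t => Q n' t x) (fun t => P n' t x) ⟨fun i hi t ht => (hd n hn i hi t ht).1,
      fun i hi t ht => (hd n hn i hi t ht).2, fun i hi t ht => (hd n' hn' i hi t ht).1,
      fun i hi t ht => (hd n' hn' i hi t ht).2, by rw [hQ0, hQ0], by rw [hP0, hP0], hbd n hn,
      hbd n' hn'⟩ i hm' t ht⟩
  choose Q' hQ' hQu using fun i => exists_limit_of_uniform_cauchy (f := fun n t => Q n t x i)
    fun T hT ε hε => (hcauchy i T hT ε hε).imp fun N hN n hn n' hn' t ht => (hN n hn n' hn' t ht).1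
  choose P' hP' hPu using fun i => exists_limit_of_uniform_cauchy (f := fun n t => P n t x i)
    fun T hT ε hε => (hcauchy i T hT ε hε).imp fun N hN n hn n' hn' t ht =>
      (hN n hn n' hn' t ht).2.1
  choose F' hF' hFu using fun i => exists_limit_of_uniform_cauchy
    (f := fun n t => force W i (proj L (Q n t x)))
    fun T hT ε hε => (hcauchy i T hT ε hε).imp fun N hN n hn n' hn' t ht =>
      (hN n hn n' hn' t ht).2.2
  have hQt : ∀ t, Tendsto (fun n => Q n t x) atTop (𝓝 (fun i => Q' i t)) := fun t =>
    tendsto_pi_nhds.2 fun i => hQ' i t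
  have hPt : ∀ t, Tendsto (fun n => P n t x) atTop (𝓝 (fun i => P' i t)) := fun t =>
    tendsto_pi_nhds.2 fun i => hP' i t
  have hFeq : ∀ i t, F' i t = force W i (proj L (fun i => Q' i t)) := fun i t =>
    tendsto_nhds_unique (hF' i t) (((h.continuous_force i).tendsto _).comp (hQt t))
  have hev : ∀ (i : Site ν) (T : ℝ), ∀ᶠ n : ℕ in atTop, ∀ t ∈ Ioo (-T) T,
      HasDerivAt (fun s => Q n s x i) (P n t x i) t ∧
      HasDerivAt (fun s => P n s x i) (force W i (proj L (Q n t x))) t := by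
    intro i T
    obtain ⟨N, hN⟩ := hone T
    obtain ⟨m, hm'⟩ := exists_nat_ge ‖i‖
    filter_upwards [eventually_ge_atTop N, eventually_ge_atTop m] with n hn hnm t ht
    have ht' : |t| ≤ T := abs_le.2 ⟨ht.1.le, ht.2.le⟩
    obtain ⟨hTn, h1⟩ := hN n hn
    have hnn : (m : ℝ) ≤ n := by exact_mod_cast hnm
    have h2 := h1 t ht' i (by rw [mem_nbhd, zero_sub, norm_neg]; exact hm'.trans hnn)
    have h3 := (hm n).pos i t (ht'.trans hTn)
    have h4 := (hm n).mom i t (ht'.trans hTn)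
    rw [h2, one_smul] at h3 h4
    exact ⟨h3, h4⟩
  have hmem : ∀ t : ℝ, t ∈ Ioo (-(|t| + 1)) (|t| + 1) := fun t =>
    abs_lt.1 (by linarith)
  refine ⟨fun t i => Q' i t, fun t i => P' i t, ?_, ?_, ?_, ?_, ⟨r, hr, hr2, fun t => ?_⟩,
    fun t => ⟨hQt t, hPt t⟩⟩
  · exact tendsto_nhds_unique (hQt 0) (by simp only [hQ0]; exact tendsto_const_nhds)
  · exact tendsto_nhds_unique (hPt 0) (by simp only [hP0]; exact tendsto_const_nhds)
  · intro i t
    exact hasDerivAt_of_tendstoUniformlyOn isOpen_Ioo (hPu i (|t| + 1) (by positivity))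
      ((hev i (|t| + 1)).mono fun n hn s hs => (hn s hs).1) (fun s _ => hQ' i s) (hmem t)
  · intro i t
    rw [← hFeq]
    exact hasDerivAt_of_tendstoUniformlyOn isOpen_Ioo (hFu i (|t| + 1) (by positivity))
      ((hev i (|t| + 1)).mono fun n hn s hs => (hn s hs).2) (fun s _ => hP' i s) (hmem t)
  · rw [mem_growthSet_iff h.nonneg]
    -- The energy bound `hE` is uniform in `n` and passes to the limit at each site.
    refine ⟨C * Real.exp (κ * |t|), by positivity, fun i => ?_⟩
    have h1 := ((continuous_energyNI_phase h.regular i).tendsto _).comp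
      ((hQt t).prodMk_nhds (hPt t))
    refine le_of_tendsto h1 ?_
    obtain ⟨N, hN⟩ := exists_nat_ge |t|
    filter_upwards [eventually_ge_atTop N] with n hn
    exact hE n t (hN.trans (by exact_mod_cast hn)) i

theorem Controlled.existsUnique_trajectory {D : ℕ} {A : ℝ} (h : Controlled W D A)
    {ω : Phase ν L} (hω : ω ∈ Omega2 W) :
    ∃! y : ℝ → Phase ν L, IsTrajectory W y ∧ y 0 = ω := by
  obtain ⟨q, p, rfl⟩ := exists_phase_eq ω
  obtain ⟨_, _, -, hap⟩ := h.exists_flow_approximation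
  obtain ⟨Q, P, hQ0, hP0, hQ, hP, hg, -⟩ := hap (q, p) hω
  refine ⟨fun t => phase L (Q t) (P t), ⟨⟨solvesMotion_of_hasDerivAt hQ hP, hg⟩, ?_⟩, ?_⟩
  · simp only [hQ0, hP0]
  · rintro y ⟨hy, hy0⟩
    exact h.trajectory_unique hy ⟨solvesMotion_of_hasDerivAt hQ hP, hg⟩
      (by rw [hy0]; simp only [hQ0, hP0])

end Existence

/-! ### Measurability, shift covariance and energy bounds of the flow -/

section Flow

open Set Filter Topology

variable {ν d : ℕ} {L : AddSubgroup (Mom d)} {W : Interaction ν L}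

theorem IsEuclideanOrTorus.isClosed (hL : IsEuclideanOrTorus L) : IsClosed (L : Set (Mom d)) := by
  rcases hL with rfl | ⟨h, -⟩
  · simp
  · exact AddSubgroup.isClosed_of_discrete

theorem continuous_phase :
    Continuous (fun x : (Site ν → Mom d) × (Site ν → Mom d) => phase L x.1 x.2) := by
  refine continuous_pi fun j => ?_
  simp only [phase]
  have h1 : Continuous fun x : (Site ν → Mom d) × (Site ν → Mom d) => x.1 j := by fun_prop
  have h2 : Continuous fun x : (Site ν → Mom d) × (Site ν → Mom d) => x.2 j := by fun_prop
  exact (continuous_quotient_mk'.comp h1).prodMk h2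

theorem countablySeparated_of_secondCountable (α : Type*) [TopologicalSpace α] [T2Space α]
    [SecondCountableTopology α] [MeasurableSpace α] [BorelSpace α] :
    MeasurableSpace.CountablySeparated α := inferInstance

/-- The space of lifts is standard Borel and maps onto the state space, which is countably
separated; for such a surjection measurability downstairs follows from measurability upstairs.
Everything can thus be checked on lifts, where the maps are continuous or limits of continuous ones.
-/
theorem measurable_of_comp_phase (hL : IsEuclideanOrTorus L) {β : Type*} [MeasurableSpace β]
    {g : Phase ν L → β} (hg : Measurable
      (fun x : (Site ν → Mom d) × (Site ν → Mom d) => g (phase L x.1 x.2))) : Measurable g := by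
  have := hL.isClosed
  have h1 : SecondCountableTopology (Phase ν L) := inferInstance
  have h2 : BorelSpace (Phase ν L) := inferInstance
  have h3 : T2Space (Phase ν L) := inferInstance
  have h4 : MeasurableSpace.CountablySeparated (Phase ν L) :=
    countablySeparated_of_secondCountable _
  have h5 : PolishSpace (Mom d) := inferInstance
  have h6 : PolishSpace (Site ν → Mom d) := inferInstance
  have h7 : StandardBorelSpace ((Site ν → Mom d) × (Site ν → Mom d)) := standardBorel_of_polish
  refine (Measurable.measurable_comp_iff_of_surjective continuous_phase.measurable ?_).1 hg
  intro ω
  obtain ⟨q, p, h⟩ := exists_phase_eq ω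
  exact ⟨(q, p), h⟩

theorem measurable_energyNI (hL : IsEuclideanOrTorus L) (hR : Regular W) (i : Site ν) :
    Measurable (energyNI W i) :=
  measurable_of_comp_phase hL (continuous_energyNI_phase hR i).measurable

/-- Exponents may be increased to `2 - 1 / (k + 1)` and constants to integers, so countably many
conditions suffice for measurability. -/
theorem Omega2_eq_iUnion (hP1 : OnSiteNonneg W) : Omega2 W =
    ⋃ (k : ℕ) (m : ℕ), ⋂ i, {ω | energyNI W i ω ≤ m * weight (2 - 1 / (k + 1)) i} := by
  ext ω
  simp only [Omega2, mem_iUnion, mem_iInter, mem_ofPred_eq]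
  constructor
  · rintro ⟨r, hr, hr2, hg⟩
    obtain ⟨C, hC, hb⟩ := (mem_growthSet_iff hP1).1 hg
    obtain ⟨k, hk⟩ := exists_nat_one_div_lt (by linarith : 0 < 2 - r)
    obtain ⟨m, hm⟩ := exists_nat_ge C
    refine ⟨k, m, fun i => (hb i).trans ?_⟩
    exact mul_le_mul hm (weight_mono (by linarith) i) (weight_pos r i).le (by positivity)
  · rintro ⟨k, m, hb⟩
    have h1 : (0 : ℝ) < 1 / (k + 1) := by positivity
    have h2 : (1 : ℝ) / (k + 1) ≤ 1 := by
      rw [div_le_one (by positivity)]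
      linarith [(Nat.cast_nonneg k : (0 : ℝ) ≤ k)]
    refine ⟨2 - 1 / (k + 1), by linarith, by linarith, (mem_growthSet_iff hP1).2
      ⟨m + 1, by positivity, fun i => (hb i).trans ?_⟩⟩
    exact mul_le_mul_of_nonneg_right (by linarith) (weight_pos _ i).le

theorem measurableSet_Omega2 (hL : IsEuclideanOrTorus L) (hR : Regular W) (hP1 : OnSiteNonneg W) :
    MeasurableSet (Omega2 W) := by
  rw [Omega2_eq_iUnion hP1]
  exact MeasurableSet.iUnion fun k => MeasurableSet.iUnion fun m => MeasurableSet.iInter fun i =>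
    measurableSet_le (measurable_energyNI hL hR i) measurable_const

theorem Controlled.isTrajectory_flow {D : ℕ} {A : ℝ} (h : Controlled W D A) {ω : Phase ν L}
    (hω : ω ∈ Omega2 W) : IsTrajectory W (fun t => flow W t ω) ∧ flow W 0 ω = ω := by
  have hex : ∃ y : ℝ → Phase ν L, IsTrajectory W y ∧ y 0 = ω :=
    (h.existsUnique_trajectory hω).exists
  simp only [flow, dif_pos hex]
  exact hex.choose_spec

theorem Controlled.flow_eq {D : ℕ} {A : ℝ} (h : Controlled W D A) {y : ℝ → Phase ν L}
    (hy : IsTrajectory W y) (t : ℝ) : flow W t (y 0) = y t := by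
  have hω : y 0 ∈ Omega2 W := by
    obtain ⟨-, r, hr, hr2, hg⟩ := hy
    exact ⟨r, hr, hr2, hg 0⟩
  obtain ⟨h1, h2⟩ := h.isTrajectory_flow hω
  exact congrFun (h.trajectory_unique h1 hy h2) t

theorem flow_of_notMem {ω : Phase ν L} (hω : ω ∉ Omega2 W) (t : ℝ) : flow W t ω = ω := by
  unfold flow
  rw [dif_neg]
  rintro ⟨y, ⟨-, r, hr, hr2, hg⟩, rfl⟩
  exact hω ⟨r, hr, hr2, hg 0⟩

theorem Controlled.measurable_flow {D : ℕ} {A : ℝ} (h : Controlled W D A)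
    (hL : IsEuclideanOrTorus L) (t : ℝ) : Measurable (flow W t) := by
  classical
  have := hL.isClosed
  refine measurable_of_comp_phase hL ?_
  obtain ⟨Q, P, hcont, hap⟩ := h.exists_flow_approximation
  obtain ⟨N, hN⟩ := exists_nat_ge |t|
  let S : Set ((Site ν → Mom d) × (Site ν → Mom d)) := {x | phase L x.1 x.2 ∈ Omega2 W}
  have hS : MeasurableSet S :=
    continuous_phase.measurable (measurableSet_Omega2 hL h.regular h.nonneg)
  -- The index starts at `N ≥ |t|`, because the approximation of index `n` is continuous only for
  -- times at most `n`.
  refine measurable_of_tendsto_metrizable (f := fun n x => if x ∈ S then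
    phase L (Q (n + N) t x) (P (n + N) t x) else phase L x.1 x.2) (fun n => ?_) ?_
  · refine Measurable.ite hS ?_ continuous_phase.measurable
    have hn : |t| ≤ (n + N : ℕ) := hN.trans (by exact_mod_cast Nat.le_add_left N n)
    exact (continuous_phase.comp ((hcont _ t hn).1.prodMk (hcont _ t hn).2)).measurable
  · refine tendsto_pi_nhds.2 fun x => ?_
    by_cases hx : x ∈ S
    · simp only [hx, if_true]
      obtain ⟨Q', P', hQ0, hP0, hQ, hP, hg, hlim⟩ := hap x hx
      have hfl := h.flow_eq (y := fun t => phase L (Q' t) (P' t))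
        ⟨solvesMotion_of_hasDerivAt hQ hP, hg⟩ t
      simp only [hQ0, hP0] at hfl
      rw [hfl]
      have h1 := (tendsto_add_atTop_iff_nat N).2 (hlim t).1
      have h2 := (tendsto_add_atTop_iff_nat N).2 (hlim t).2
      exact ((continuous_phase (L := L)).tendsto _).comp (h1.prodMk_nhds h2)
    · simp only [hx, if_false]
      rw [flow_of_notMem hx]
      exact tendsto_const_nhds

theorem shift_shift (i j : Site ν) (ω : Phase ν L) : shift i (shift j ω) = shift (i + j) ω := by
  funext k
  simp only [shift]
  rw [add_assoc]

theorem shift_zero (ω : Phase ν L) : shift 0 ω = ω := by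
  funext k
  simp [shift]

theorem pgrad_shift (hTI : TranslationInvariant W) (k i : Site ν) (Δ : Finset (Site ν))
    (q : Site ν → Pos L) : pgrad i (W.ext Δ) (fun j => q (j + k)) =
      pgrad (i + k) (W.ext (translate k Δ)) q := by
  unfold pgrad
  congr 1
  funext v
  rw [hTI]
  congr 1
  funext j
  by_cases hj : j = i
  · subst hj; simp
  · have : j + k ≠ i + k := fun e => hj (add_right_cancel e)
    simp [hj, this]

theorem force_shift (hTI : TranslationInvariant W) (k i : Site ν) (q : Site ν → Pos L) :
    force W i (fun j => q (j + k)) = force W (i + k) q := by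
  unfold force
  congr 1
  simp only [pgrad_shift hTI]
  exact finsum_comp_equiv (Equiv.addRight k).finsetCongr (f := fun Δ => pgrad (i + k) (W.ext Δ) q)

theorem energyNI_shift (hTI : TranslationInvariant W) (k i : Site ν) (ω : Phase ν L) :
    energyNI W i (shift k ω) = energyNI W (i + k) ω := by
  unfold energyNI shift
  rw [onSite_add hTI i, onSite_add hTI (i + k)]

theorem shift_mem_growthSet (hP1 : OnSiteNonneg W) (hTI : TranslationInvariant W) {r : ℝ}
    (hr : 0 ≤ r) {ω : Phase ν L} (hω : ω ∈ growthSet W r) (k : Site ν) :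
    shift k ω ∈ growthSet W r := by
  rw [mem_growthSet_iff hP1] at hω ⊢
  obtain ⟨C, hC, hb⟩ := hω
  refine ⟨C * (1 + ‖k‖) ^ r, by positivity, fun i => ?_⟩
  rw [energyNI_shift hTI, mul_assoc]
  refine (hb _).trans (mul_le_mul_of_nonneg_left ?_ hC.le)
  rw [weight, weight, ← Real.mul_rpow (by positivity) (by positivity)]
  refine Real.rpow_le_rpow (by positivity) ?_ hr
  have := norm_add_le i k
  nlinarith [norm_nonneg i, norm_nonneg k, mul_nonneg (norm_nonneg i) (norm_nonneg k)]

theorem shift_isTrajectory (hP1 : OnSiteNonneg W) (hTI : TranslationInvariant W)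
    {y : ℝ → Phase ν L} (hy : IsTrajectory W y) (k : Site ν) :
    IsTrajectory W (fun t => shift k (y t)) := by
  obtain ⟨hs, r, hr, hr2, hg⟩ := hy
  refine ⟨fun i => ⟨(hs (i + k)).1, fun t => ?_⟩, r, hr, hr2,
    fun t => shift_mem_growthSet hP1 hTI hr.le (hg t) k⟩
  have h1 := (hs (i + k)).2 t
  have h2 := force_shift hTI k i (positions (y t))
  unfold force at h2
  rw [← h2] at h1
  exact h1

theorem shift_mem_Omega2 (hP1 : OnSiteNonneg W) (hTI : TranslationInvariant W) {ω : Phase ν L}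
    (hω : ω ∈ Omega2 W) (k : Site ν) : shift k ω ∈ Omega2 W := by
  obtain ⟨r, hr, hr2, hg⟩ := hω
  exact ⟨r, hr, hr2, shift_mem_growthSet hP1 hTI hr.le hg k⟩

/-- A shifted trajectory is a trajectory, so this is uniqueness; off `Ω_2`, which is shift
invariant, both sides are trivial. -/
theorem Controlled.flow_shift {D : ℕ} {A : ℝ} (h : Controlled W D A) (k : Site ν) (t : ℝ)
    (ω : Phase ν L) : flow W t (shift k ω) = shift k (flow W t ω) := by
  by_cases hω : ω ∈ Omega2 W
  · obtain ⟨h1, h2⟩ := h.isTrajectory_flow hω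
    have := h.flow_eq (shift_isTrajectory h.nonneg h.inv h1 k) t
    simpa only [h2] using this
  · have h1 : shift k ω ∉ Omega2 W := by
      intro hk
      apply hω
      have := shift_mem_Omega2 h.nonneg h.inv hk (-k)
      rwa [shift_shift, neg_add_cancel, shift_zero] at this
    rw [flow_of_notMem hω, flow_of_notMem h1]

/-- The bound involves the initial state only through iterated neighborhood sums, whose means are
computable under a shift-invariant measure. -/
theorem Controlled.energyNI_flow_le {D : ℕ} {A : ℝ} (h : Controlled W D A) {ω : Phase ν L}
    (hω : ω ∈ Omega2 W) (t : ℝ) (i : Site ν) : energyNI W i (flow W t ω) ≤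
      ∑' k : ℕ, ((1 + A) * |t|) ^ k / k ! * (nsum (nbhd D))^[k] (fun i => energyNI W i ω) i := by
  obtain ⟨⟨hs, r, hr, hr2, hg⟩, h0⟩ := h.isTrajectory_flow hω
  obtain ⟨q, p, hqp⟩ := exists_phase_eq ω
  obtain ⟨Q, P, hy, hQ0, hP0, hQ, hP⟩ := hs.exists_lift (q := q) (p := p) (by rw [hqp]; exact h0)
  obtain ⟨M, hM, hb⟩ := h.exists_bound_of_trajectory hQ hP hr.le (fun t => hy t ▸ hg t) |t|
  have hu : ∀ u ∈ uIcc (0 : ℝ) t, |u| ≤ |t| := by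
    intro u hu
    rcases mem_uIcc.1 hu with hu | hu
    · exact abs_le_abs_of_nonneg hu.1 hu.2
    · exact abs_le_abs_of_nonpos hu.2 hu.1
  have := (h.energyNI_propagation (isMotion_of_hasDerivAt hQ hP |t|) hr.le hM hu
    (fun i u hu' => hb i u (hu u hu'))).1 i
  rw [sub_zero, ← hy t, ← hy 0] at this
  simpa only [h0] using this

theorem Controlled.summable_iterate_energyNI {D : ℕ} {A : ℝ} (h : Controlled W D A) {ω : Phase ν L}
    (hω : ω ∈ Omega2 W) {x : ℝ} (hx : 0 ≤ x) (i : Site ν) : Summable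
      (fun k : ℕ => x ^ k / k ! * (nsum (nbhd D))^[k] (fun i => energyNI W i ω) i) := by
  obtain ⟨r, hr, hr2, hg⟩ := hω
  obtain ⟨C, hC, hb⟩ := (mem_growthSet_iff h.nonneg).1 hg
  exact summable_iterate_nsum (fun i => energyNI_nonneg h.nonneg i ω) (by positivity) hC.le hx hb
    (nsum_weight_le hr.le D) i

end Flow

/-! ### Moments under shift-invariant measures -/

section InvariantMeasures

open Set Filter Topology

variable {ν d : ℕ} {L : AddSubgroup (Mom d)} {W : Interaction ν L}

/-- `ℤ^ν` embeds isometrically into the lattice of rank `ν` that is spanned by the standard basis of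
`ℝ^ν`. -/
theorem summable_norm_rpow_site {s : ℝ} (hs : (ν : ℝ) < s) :
    Summable (fun i : Site ν => ‖i‖ ^ (-s)) := by
  let Z : Submodule ℤ (Fin ν → ℝ) := Submodule.span ℤ (Set.range (Pi.basisFun ℝ (Fin ν)))
  have hrank : Module.finrank ℤ Z = ν := by
    rw [ZLattice.rank ℝ Z]
    simp
  have hmem : ∀ i : Site ν, (fun k => (i k : ℝ)) ∈ Z := by
    intro i
    have : (fun k => (i k : ℝ)) = ∑ k, i k • Pi.basisFun ℝ (Fin ν) k := by
      funext l
      simp [Finset.sum_apply, Pi.single_apply]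
    rw [this]
    exact Submodule.sum_mem _ fun k _ =>
      Submodule.smul_mem _ _ (Submodule.subset_span (mem_range_self k))
  let f : Site ν → Z := fun i => ⟨fun k => (i k : ℝ), hmem i⟩
  have hf : Function.Injective f := by
    intro i j hij
    funext k
    have : (i k : ℝ) = j k := congrFun (congrArg Subtype.val hij) k
    exact_mod_cast this
  have h := (ZLattice.summable_norm_rpow Z (-s) (by rw [hrank]; linarith)).comp_injective hf
  refine h.congr fun i => ?_
  simp only [Function.comp, f]
  congr 1

theorem measurable_shift (k : Site ν) : Measurable (shift (L := L) k) :=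
  measurable_pi_lambda _ fun j => measurable_pi_apply (j + k)

theorem lintegral_shift {μ : Measure (Phase ν L)} (hμ : MemI2 W μ) (k : Site ν)
    {f : Phase ν L → ENNReal} (hf : Measurable f) :
    ∫⁻ ω, f (shift k ω) ∂μ = ∫⁻ ω, f ω ∂μ := by
  conv_rhs => rw [← hμ.invariant k]
  rw [lintegral_map hf (measurable_shift k)]

theorem integral_shift {μ : Measure (Phase ν L)} (hμ : MemI2 W μ) (k : Site ν)
    {f : Phase ν L → ℝ} (hf : Measurable f) :
    ∫ ω, f (shift k ω) ∂μ = ∫ ω, f ω ∂μ := by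
  conv_rhs => rw [← hμ.invariant k]
  rw [integral_map (measurable_shift k).aemeasurable hf.aestronglyMeasurable]

/-- Since `ζ > ν / 2`, some `r < 2` has `r ζ > ν`. Then `∑ |i|^(-r ζ) e_i^ζ` has finite mean by
stationarity, so it is finite almost everywhere, and each of its terms is at most the sum. -/
theorem Controlled.ae_mem_Omega2 {D : ℕ} {A : ℝ} (h : Controlled W D A) (hL : IsEuclideanOrTorus L)
    {μ : Measure (Phase ν L)} (hμ : MemI2 W μ) : ∀ᵐ ω ∂μ, ω ∈ Omega2 W := by
  obtain ⟨ζ, hζ, hfin⟩ := hμ.finite_moment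
  have hζ1 : 1 < ζ := (le_max_left _ _).trans_lt hζ
  have hζ2 : (ν : ℝ) / 2 < ζ := (le_max_right _ _).trans_lt hζ
  have hζ0 : 0 < ζ := by linarith
  let r : ℝ := (ν / ζ + 2) / 2
  have hνζ : (ν : ℝ) / ζ < 2 := by rw [div_lt_iff₀ hζ0]; linarith
  have hν0 : 0 ≤ (ν : ℝ) / ζ := by positivity
  have hr2 : r < 2 := by simp only [r]; linarith
  have hr0 : 0 < r := by simp only [r]; linarith
  have hrζ : (ν : ℝ) < r * ζ := by
    have : (ν : ℝ) / ζ < r := by simp only [r]; linarith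
    rwa [div_lt_iff₀ hζ0] at this
  have hmeas : ∀ i, Measurable fun ω : Phase ν L => ENNReal.ofReal (|energyNI W i ω| ^ ζ) :=
    fun i => ((continuous_abs.measurable.comp (measurable_energyNI hL h.regular i)).pow_const
      ζ).ennreal_ofReal
  have hmom : ∀ i, ∫⁻ ω, ENNReal.ofReal (|energyNI W i ω| ^ ζ) ∂μ = moment W ζ μ := by
    intro i
    have := lintegral_shift hμ i (hmeas 0)
    simp only [energyNI_shift h.inv, zero_add] at this
    exact this
  have hsum : ∫⁻ ω, ∑' i : Site ν, ENNReal.ofReal (‖i‖ ^ (-(r * ζ))) *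
      ENNReal.ofReal (|energyNI W i ω| ^ ζ) ∂μ ≠ ⊤ := by
    rw [lintegral_tsum fun i => ((hmeas i).const_mul _).aemeasurable]
    simp only [lintegral_const_mul _ (hmeas _), hmom]
    rw [ENNReal.tsum_mul_right]
    refine ENNReal.mul_ne_top ?_ hfin.ne
    rw [← ENNReal.ofReal_tsum_of_nonneg (fun i => by positivity) (summable_norm_rpow_site hrζ)]
    exact ENNReal.ofReal_ne_top
  have hae := ae_lt_top (Measurable.tsum fun i => (hmeas i).const_mul _) hsum
  filter_upwards [hae] with ω hω
  set S := ∑' i : Site ν, ENNReal.ofReal (‖i‖ ^ (-(r * ζ))) *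
      ENNReal.ofReal (|energyNI W i ω| ^ ζ) with hS
  refine ⟨r, hr0, hr2, (mem_growthSet_iff h.nonneg).2
    ⟨S.toReal ^ (1 / ζ) + energyNI W 0 ω + 1, ?_, fun i => ?_⟩⟩
  · have := energyNI_nonneg h.nonneg 0 ω
    positivity
  have he0 := energyNI_nonneg h.nonneg 0 ω
  have hS0 : 0 ≤ S.toReal ^ (1 / ζ) := by positivity
  have hw := one_le_weight hr0.le i
  -- At `i = 0` the factor `‖i‖ ^ (-(r * ζ))` is zero, so `S` says nothing there; the constant
  -- contains `energyNI W 0 ω` for this reason.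
  by_cases hi : i = 0
  · subst hi
    nlinarith [mul_nonneg hS0 (weight_pos r (0 : Site ν)).le]
  have hni : 0 < ‖i‖ := norm_pos_iff.2 hi
  have h1 : ENNReal.ofReal (‖i‖ ^ (-(r * ζ))) * ENNReal.ofReal (|energyNI W i ω| ^ ζ) ≤ S :=
    ENNReal.le_tsum i
  rw [← ENNReal.ofReal_mul (by positivity)] at h1
  have h2 := (ENNReal.ofReal_le_iff_le_toReal hω.ne).1 h1
  have hei := energyNI_nonneg h.nonneg i ω
  rw [abs_of_nonneg hei, Real.rpow_neg hni.le, inv_mul_le_iff₀ (by positivity)] at h2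
  have h3 : energyNI W i ω ^ ζ ≤ (S.toReal ^ (1 / ζ) * weight r i) ^ ζ := by
    rw [Real.mul_rpow hS0 (weight_pos r i).le, ← Real.rpow_mul ENNReal.toReal_nonneg,
      one_div_mul_cancel hζ0.ne', Real.rpow_one, weight, ← Real.rpow_mul (by positivity), mul_comm]
    refine h2.trans (mul_le_mul_of_nonneg_right ?_ ENNReal.toReal_nonneg)
    exact Real.rpow_le_rpow hni.le (by linarith) (by positivity)
  have h4 := (Real.rpow_le_rpow_iff hei (mul_nonneg hS0 (weight_pos r i).le) hζ0).1 h3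
  refine h4.trans (mul_le_mul_of_nonneg_right ?_ (weight_pos r i).le)
  linarith

theorem Controlled.lintegral_energyNI {D : ℕ} {A : ℝ} (h : Controlled W D A)
    (hL : IsEuclideanOrTorus L) {μ : Measure (Phase ν L)} (hμ : MemI2 W μ) (i : Site ν) :
    ∫⁻ ω, ENNReal.ofReal (energyNI W i ω) ∂μ = ∫⁻ ω, ENNReal.ofReal (energyNI W 0 ω) ∂μ := by
  have := lintegral_shift hμ i (measurable_energyNI hL h.regular 0).ennreal_ofReal
  simp only [energyNI_shift h.inv, zero_add] at this
  exact this

theorem Controlled.lintegral_energyNI_lt_top {D : ℕ} {A : ℝ} (h : Controlled W D A)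
    {μ : Measure (Phase ν L)} (hμ : MemI2 W μ) :
    ∫⁻ ω, ENNReal.ofReal (energyNI W 0 ω) ∂μ < ⊤ := by
  obtain ⟨ζ, hζ, hfin⟩ := hμ.finite_moment
  have hζ1 : 1 < ζ := (le_max_left _ _).trans_lt hζ
  have := hμ.prob
  calc ∫⁻ ω, ENNReal.ofReal (energyNI W 0 ω) ∂μ
      ≤ ∫⁻ ω, 1 + ENNReal.ofReal (|energyNI W 0 ω| ^ ζ) ∂μ := by
        refine lintegral_mono fun ω => ?_
        have he := energyNI_nonneg h.nonneg 0 ω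
        rw [← ENNReal.ofReal_one, ← ENNReal.ofReal_add zero_le_one (by positivity),
          abs_of_nonneg he]
        refine ENNReal.ofReal_le_ofReal ?_
        have hp : 0 ≤ energyNI W 0 ω ^ ζ := by positivity
        rcases le_total (energyNI W 0 ω) 1 with h1 | h1
        · linarith
        · have := Real.rpow_le_rpow_of_exponent_le h1 hζ1.le
          rw [Real.rpow_one] at this
          linarith
    _ = 1 + moment W ζ μ := by
        rw [lintegral_add_left measurable_const, lintegral_const, measure_univ, one_mul]
        rfl
    _ < ⊤ := ENNReal.add_lt_top.2 ⟨ENNReal.one_lt_top, hfin⟩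

/-- By stationarity all sites have the same mean, so a neighborhood sum multiplies it by the size of
the neighborhood. -/
theorem Controlled.lintegral_iterate_nsum {D : ℕ} {A : ℝ} (h : Controlled W D A)
    (hL : IsEuclideanOrTorus L) {μ : Measure (Phase ν L)} (hμ : MemI2 W μ) (k : ℕ) :
    ∀ i, Measurable (fun ω => (nsum (nbhd D))^[k] (fun i => energyNI W i ω) i) ∧
      ∫⁻ ω, ENNReal.ofReal ((nsum (nbhd D))^[k] (fun i => energyNI W i ω) i) ∂μ =
        ((nbhd D (0 : Site ν)).card : ENNReal) ^ k * ∫⁻ ω, ENNReal.ofReal (energyNI W 0 ω) ∂μ := by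
  induction k with
  | zero =>
    intro i
    refine ⟨measurable_energyNI hL h.regular i, ?_⟩
    rw [pow_zero, one_mul]
    exact h.lintegral_energyNI hL hμ i
  | succ k ih =>
    intro i
    simp only [Function.iterate_succ_apply', nsum]
    refine ⟨Finset.measurable_sum _ fun j _ => (ih j).1, ?_⟩
    have h1 : ∀ ω, ENNReal.ofReal (∑ j ∈ nbhd D i, (nsum (nbhd D))^[k]
        (fun i => energyNI W i ω) j) = ∑ j ∈ nbhd D i, ENNReal.ofReal ((nsum (nbhd D))^[k]
        (fun i => energyNI W i ω) j) := fun ω =>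
      ENNReal.ofReal_sum_of_nonneg fun j _ =>
        iterate_nsum_nonneg (fun i => energyNI_nonneg h.nonneg i ω) k j
    simp only [h1]
    rw [lintegral_finsetSum _ fun j _ => (ih j).1.ennreal_ofReal,
      Finset.sum_congr rfl fun j _ => (ih j).2, Finset.sum_const, card_nbhd, nsmul_eq_mul, pow_succ]
    ring

/-- The energies along the time evolution are dominated by integrable functions, uniformly on
compact time intervals. -/
theorem Controlled.exists_integrable_bound {D : ℕ} {A : ℝ} (h : Controlled W D A)
    (hL : IsEuclideanOrTorus L) {μ : Measure (Phase ν L)} (hμ : MemI2 W μ) (T : ℝ) (i : Site ν) :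
    ∃ G : Phase ν L → ℝ, Integrable G μ ∧
      ∀ ω ∈ Omega2 W, ∀ t, |t| ≤ T → energyNI W i (flow W t ω) ≤ G ω := by
  by_cases hT : 0 ≤ T
  swap
  · exact ⟨0, integrable_zero _ _ _, fun ω _ t ht => absurd ((abs_nonneg t).trans ht) hT⟩
  have hA : 0 ≤ A := zero_le_one.trans h.one_le
  let x : ℝ := (1 + A) * T
  have hx : 0 ≤ x := by positivity
  let f : ℕ → Phase ν L → ℝ := fun k ω =>
    x ^ k / k ! * (nsum (nbhd D))^[k] (fun i => energyNI W i ω) i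
  have hf0 : ∀ k ω, 0 ≤ f k ω := fun k ω => mul_nonneg (by positivity)
    (iterate_nsum_nonneg (fun i => energyNI_nonneg h.nonneg i ω) k i)
  have hfm : ∀ k, Measurable fun ω => ENNReal.ofReal (f k ω) := fun k =>
    (((h.lintegral_iterate_nsum hL hμ k i).1).const_mul _).ennreal_ofReal
  let m : ℝ := (nbhd D (0 : Site ν)).card
  have hsum : ∫⁻ ω, ∑' k, ENNReal.ofReal (f k ω) ∂μ ≠ ⊤ := by
    rw [lintegral_tsum fun k => (hfm k).aemeasurable]
    -- The means are the terms of the exponential series at `x * m`, times the mean of one energy.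
    have h1 : ∀ k, ∫⁻ ω, ENNReal.ofReal (f k ω) ∂μ = ENNReal.ofReal ((x * m) ^ k / k !) *
        ∫⁻ ω, ENNReal.ofReal (energyNI W 0 ω) ∂μ := by
      intro k
      have h2 : 0 ≤ x ^ k / k ! := by positivity
      simp only [f, ENNReal.ofReal_mul h2]
      rw [lintegral_const_mul _ (h.lintegral_iterate_nsum hL hμ k i).1.ennreal_ofReal,
        (h.lintegral_iterate_nsum hL hμ k i).2, ← mul_assoc]
      congr 1
      rw [show (x * m) ^ k / k ! = x ^ k / k ! * m ^ k by rw [mul_pow]; ring, ENNReal.ofReal_mul h2]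
      congr 1
      rw [ENNReal.ofReal_pow (Nat.cast_nonneg _), ENNReal.ofReal_natCast]
    simp only [h1]
    rw [ENNReal.tsum_mul_right]
    refine ENNReal.mul_ne_top ?_ (h.lintegral_energyNI_lt_top hμ).ne
    rw [← ENNReal.ofReal_tsum_of_nonneg (fun k => by positivity)
      (Real.summable_pow_div_factorial (x * m))]
    exact ENNReal.ofReal_ne_top
  refine ⟨fun ω => (∑' k, ENNReal.ofReal (f k ω)).toReal,
    integrable_toReal_of_lintegral_ne_top (Measurable.tsum hfm).aemeasurable hsum,
    fun ω hω t ht => ?_⟩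
  have hs : Summable fun k => f k ω := h.summable_iterate_energyNI hω hx i
  change _ ≤ (∑' k, ENNReal.ofReal (f k ω)).toReal
  rw [← ENNReal.ofReal_tsum_of_nonneg (fun k => hf0 k ω) hs,
    ENNReal.toReal_ofReal (tsum_nonneg fun k => hf0 k ω)]
  refine (h.energyNI_flow_le hω t i).trans ?_
  refine (h.summable_iterate_energyNI hω (by positivity) i).tsum_le_tsum (fun k => ?_) hs
  refine mul_le_mul_of_nonneg_right ?_
    (iterate_nsum_nonneg (fun i => energyNI_nonneg h.nonneg i ω) k i)
  simp only [x]
  gcongr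

end InvariantMeasures

/-! ### The energy flux, mass transport and conservation -/

section Conservation

open Set Filter Topology

variable {ν d : ℕ} {L : AddSubgroup (Mom d)} {W : Interaction ν L}

/-- The finite sets of sites near `0` which contain `0` and another site. -/
noncomputable def clusters (ν D : ℕ) : Finset (Finset (Site ν)) :=
  (nbhd D (0 : Site ν)).powerset.filter fun Δ => {0} ⊂ Δ

theorem filter_subset_eq_insert_clusters (ν D : ℕ) :
    (nbhd D (0 : Site ν)).powerset.filter (fun Δ => {0} ⊆ Δ) = insert {0} (clusters ν D) := by
  ext Δ
  simp only [clusters, Finset.mem_filter, Finset.mem_powerset, Finset.mem_insert]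
  constructor
  · rintro ⟨h1, h2⟩
    rcases h2.eq_or_ssubset with h3 | h3
    · exact Or.inl h3.symm
    · exact Or.inr ⟨h1, h3⟩
  · rintro (rfl | ⟨h1, h2⟩)
    · exact ⟨by simpa using self_mem_nbhd D 0, subset_rfl⟩
    · exact ⟨h1, h2.1⟩

theorem singleton_notMem_clusters (ν D : ℕ) : {0} ∉ clusters ν D := by
  simp [clusters]

theorem singleton_ssubset_of_mem_clusters {D : ℕ} {Δ : Finset (Site ν)} (h : Δ ∈ clusters ν D)
    {k : Site ν} (hk : k ∈ Δ) : {k} ⊂ Δ := by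
  have h1 := Finset.card_lt_card (Finset.mem_filter.1 h).2
  refine (Finset.singleton_subset_iff.2 hk).ssubset_of_ne ?_
  rintro rfl
  simp at h1

theorem zero_mem_of_mem_clusters {D : ℕ} {Δ : Finset (Site ν)} (h : Δ ∈ clusters ν D) : 0 ∈ Δ :=
  Finset.singleton_subset_iff.1 (Finset.mem_filter.1 h).2.1

theorem Controlled.energy_eq {D : ℕ} {A : ℝ} (h : Controlled W D A) (ω : Phase ν L) :
    energy W 0 ω = 1 / 2 * ‖(ω 0).2‖ ^ 2 +
      ∑ Δ ∈ insert {0} (clusters ν D), 1 / (Δ.card : ℝ) * W.ext Δ (positions ω) := by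
  classical
  unfold energy
  congr 1
  simp only [finsum_eq_if]
  rw [finsum_eq_sum_of_support_subset (s := insert {0} (clusters ν D))]
  · refine Finset.sum_congr rfl fun Δ hΔ => if_pos ?_
    rcases Finset.mem_insert.1 hΔ with rfl | hΔ
    · exact Finset.mem_singleton_self 0
    · exact zero_mem_of_mem_clusters hΔ
  · intro Δ hΔ
    rw [Function.mem_support] at hΔ
    have h1 : (0 : Site ν) ∈ Δ := by
      by_contra hi
      exact hΔ (if_neg hi)
    have h2 : W Δ ≠ 0 := by
      intro h0
      apply hΔ
      simp [Interaction.ext, h0]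
    rw [← filter_subset_eq_insert_clusters]
    simp only [Finset.coe_filter, Finset.mem_powerset, Finset.singleton_subset_iff]
    exact ⟨h.subset_nbhd Δ h2 0 h1, h1⟩

/-- The power which the particle at `k` receives from minus the interaction `W_Δ`. -/
noncomputable def power (W : Interaction ν L) (Δ : Finset (Site ν)) (k : Site ν) (ω : Phase ν L) :
    ℝ := ⟪pgrad k (W.ext Δ) (positions ω), (ω k).2⟫_ℝ

/-- The time derivative of the local energy `E_0`. -/
noncomputable def flux (W : Interaction ν L) (D : ℕ) (ω : Phase ν L) : ℝ :=
  ∑ Δ ∈ clusters ν D, (1 / (Δ.card : ℝ) * ∑ k ∈ Δ, power W Δ k ω - power W Δ 0 ω)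

/-- The on-site terms cancel. A larger `Δ` contributes its share `1 / #Δ` of the change of `W_Δ`
along all its particles, and the work of its force on the particle at `0`. -/
theorem Controlled.hasDerivAt_energy {D : ℕ} {A : ℝ} (h : Controlled W D A)
    {Q P : ℝ → Site ν → Mom d} (hQ : ∀ i t, HasDerivAt (fun s => Q s i) (P t i) t)
    (hP : ∀ i t, HasDerivAt (fun s => P s i) (force W i (proj L (Q t))) t) (t : ℝ) :
    HasDerivAt (fun s => energy W 0 (phase L (Q s) (P s))) (flux W D (phase L (Q t) (P t))) t := by
  have h1 := ((hP 0 t).norm_sq).const_mul (1 / 2 : ℝ)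
  have h2 : HasDerivAt (fun s => ∑ Δ ∈ insert {0} (clusters ν D),
      1 / (Δ.card : ℝ) * W.ext Δ (proj L (Q s))) (∑ Δ ∈ insert {0} (clusters ν D),
      1 / (Δ.card : ℝ) * ∑ k ∈ Δ, ⟪pgrad k (W.ext Δ) (proj L (Q t)), P t k⟫_ℝ) t :=
    HasDerivAt.fun_sum fun Δ _ =>
      (hasDerivAt_ext h.regular Δ (fun k _ => hQ k t)).const_mul _
  have h4 : (fun s => energy W 0 (phase L (Q s) (P s))) = fun s => 1 / 2 * ‖P s 0‖ ^ 2 +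
      ∑ Δ ∈ insert {0} (clusters ν D), 1 / (Δ.card : ℝ) * W.ext Δ (proj L (Q s)) :=
    funext fun s => h.energy_eq _
  rw [h4]
  refine (h1.add h2).congr_deriv ?_
  have h5 : force W 0 (proj L (Q t)) =
      -∑ Δ ∈ insert {0} (clusters ν D), pgrad 0 (W.ext Δ) (proj L (Q t)) := by
    rw [← filter_subset_eq_insert_clusters, h.force_eq]
  rw [h5, inner_neg_right, inner_sum, Finset.sum_insert (singleton_notMem_clusters ν D),
    Finset.sum_insert (singleton_notMem_clusters ν D), flux, Finset.sum_sub_distrib]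
  have h6 : ∀ Δ, ⟪P t 0, pgrad 0 (W.ext Δ) (proj L (Q t))⟫_ℝ =
      power W Δ 0 (phase L (Q t) (P t)) := fun Δ => real_inner_comm _ _
  have h7 : ∀ Δ k, ⟪pgrad k (W.ext Δ) (proj L (Q t)), P t k⟫_ℝ =
      power W Δ k (phase L (Q t) (P t)) := fun Δ k => rfl
  simp only [h6, h7, Finset.card_singleton, Finset.sum_singleton, Nat.cast_one]
  ring

theorem measurable_power (hL : IsEuclideanOrTorus L) (hR : Regular W) (Δ : Finset (Site ν))
    (k : Site ν) : Measurable (power W Δ k) := by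
  refine measurable_of_comp_phase hL (Continuous.measurable ?_)
  have h1 : Continuous fun x : (Site ν → Mom d) × (Site ν → Mom d) => x.2 k := by fun_prop
  exact ((continuous_pgrad (L := L) hR Δ k).comp continuous_fst).inner h1

theorem Controlled.measurable_energy {D : ℕ} {A : ℝ} (h : Controlled W D A)
    (hL : IsEuclideanOrTorus L) : Measurable (energy W 0) := by
  refine measurable_of_comp_phase hL (Continuous.measurable ?_)
  simp only [h.energy_eq]
  have h1 : Continuous fun x : (Site ν → Mom d) × (Site ν → Mom d) => x.2 0 := by fun_prop
  exact (continuous_const.mul (h1.norm.pow 2)).add (continuous_finsetSum _ fun Δ _ =>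
    continuous_const.mul ((continuous_ext h.regular Δ).comp continuous_fst))

theorem measurable_flux (hL : IsEuclideanOrTorus L) (hR : Regular W) (D : ℕ) :
    Measurable (flux W D) :=
  Finset.measurable_fun_sum _ fun Δ _ => ((Finset.measurable_fun_sum _ fun k _ =>
    measurable_power hL hR Δ k).const_mul _).sub (measurable_power hL hR Δ 0)

theorem Controlled.exists_integrable_bound_sum {D : ℕ} {A : ℝ} (h : Controlled W D A)
    (hL : IsEuclideanOrTorus L) {μ : Measure (Phase ν L)} (hμ : MemI2 W μ) (T : ℝ) (i : Site ν) :
    ∃ G : Phase ν L → ℝ, Integrable G μ ∧ ∀ ω ∈ Omega2 W, ∀ t, |t| ≤ T →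
      ∑ j ∈ nbhd D i, energyNI W j (flow W t ω) ≤ G ω := by
  choose G hG hb using fun j => h.exists_integrable_bound hL hμ T j
  exact ⟨fun ω => ∑ j ∈ nbhd D i, G j ω, integrable_finsetSum _ fun j _ => hG j,
    fun ω hω t ht => Finset.sum_le_sum fun j _ => hb j ω hω t ht⟩

theorem Controlled.exists_integrable_bound_power {D : ℕ} {A : ℝ} (h : Controlled W D A)
    (hL : IsEuclideanOrTorus L) {μ : Measure (Phase ν L)} (hμ : MemI2 W μ) (T : ℝ)
    (k : Site ν) : ∃ G : Phase ν L → ℝ, Integrable G μ ∧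
      ∀ Δ : Finset (Site ν), {k} ⊂ Δ → ∀ ω ∈ Omega2 W, ∀ t, |t| ≤ T →
        |power W Δ k (flow W t ω)| ≤ G ω := by
  obtain ⟨G, hG, hb⟩ := h.exists_integrable_bound_sum hL hμ T k
  refine ⟨fun ω => (1 + A) * G ω, hG.const_mul _, fun Δ hΔ ω hω t ht => ?_⟩
  refine (h.abs_inner_le k (flow W t ω) (h.pgrad_le Δ k _ hΔ)).trans ?_
  exact mul_le_mul_of_nonneg_left (hb ω hω t ht) (by linarith [h.one_le])

theorem Controlled.integrable_power_flow {D : ℕ} {A : ℝ} (h : Controlled W D A)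
    (hL : IsEuclideanOrTorus L) {μ : Measure (Phase ν L)} (hμ : MemI2 W μ) (t : ℝ)
    {Δ : Finset (Site ν)} {k : Site ν} (hk : {k} ⊂ Δ) :
    Integrable (fun ω => power W Δ k (flow W t ω)) μ := by
  obtain ⟨G, hG, hb⟩ := h.exists_integrable_bound_power hL hμ |t| k
  refine hG.mono' ((measurable_power hL h.regular Δ k).comp
    (h.measurable_flow hL t)).aestronglyMeasurable ?_
  filter_upwards [h.ae_mem_Omega2 hL hμ] with ω hω
  exact hb Δ hk ω hω t le_rfl

theorem Controlled.exists_integrable_bound_flux {D : ℕ} {A : ℝ} (h : Controlled W D A)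
    (hL : IsEuclideanOrTorus L) {μ : Measure (Phase ν L)} (hμ : MemI2 W μ) (T : ℝ) :
    ∃ G : Phase ν L → ℝ, Integrable G μ ∧ ∀ ω ∈ Omega2 W, ∀ t, |t| ≤ T →
      ‖flux W D (flow W t ω)‖ ≤ G ω := by
  choose G hG hb using fun k => h.exists_integrable_bound_power hL hμ T k
  refine ⟨fun ω => ∑ Δ ∈ clusters ν D, (1 / (Δ.card : ℝ) * ∑ k ∈ Δ, G k ω + G 0 ω),
    integrable_finsetSum _ fun Δ _ => ((integrable_finsetSum _ fun k _ => hG k).const_mul _).add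
      (hG 0), fun ω hω t ht => ?_⟩
  refine norm_sum_le_of_le _ fun Δ hΔ => (norm_sub_le _ _).trans (add_le_add ?_ ?_)
  · rw [norm_mul, Real.norm_of_nonneg (by positivity : (0 : ℝ) ≤ 1 / Δ.card)]
    refine mul_le_mul_of_nonneg_left ?_ (by positivity)
    exact norm_sum_le_of_le _ fun k hk =>
      hb k Δ (singleton_ssubset_of_mem_clusters hΔ hk) ω hω t ht
  · exact hb 0 Δ (Finset.mem_filter.1 hΔ).2 ω hω t ht

theorem Controlled.integrable_energy_flow {D : ℕ} {A : ℝ} (h : Controlled W D A)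
    (hL : IsEuclideanOrTorus L) {μ : Measure (Phase ν L)} (hμ : MemI2 W μ) (t : ℝ) :
    Integrable (fun ω => energy W 0 (flow W t ω)) μ := by
  obtain ⟨G, hG, hb⟩ := h.exists_integrable_bound_sum hL hμ |t| (0 : Site ν)
  refine (hG.const_mul (1 + (clusters ν D).card * A)).mono'
    ((h.measurable_energy hL).comp (h.measurable_flow hL t)).aestronglyMeasurable ?_
  filter_upwards [h.ae_mem_Omega2 hL hμ] with ω hω
  have hA : 0 ≤ A := zero_le_one.trans h.one_le
  refine le_trans ?_ (mul_le_mul_of_nonneg_left (hb ω hω t le_rfl) (by positivity))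
  generalize flow W t ω = η
  rw [h.energy_eq, Finset.sum_insert (singleton_notMem_clusters ν D), ← add_assoc,
    Finset.card_singleton, Nat.cast_one, div_one, one_mul, ← onSite_eq_ext]
  refine (norm_add_le _ _).trans ?_
  rw [add_mul, one_mul]
  refine add_le_add ?_ ?_
  · change ‖energyNI W 0 η‖ ≤ _
    rw [Real.norm_of_nonneg (energyNI_nonneg h.nonneg 0 η)]
    exact energyNI_le_sum h.nonneg D 0 η
  · rw [mul_assoc, ← nsmul_eq_mul]
    refine (norm_sum_le _ _).trans (Finset.sum_le_card_nsmul _ _ _ fun Δ hΔ => ?_)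
    have h1 : (1 : ℝ) / Δ.card ≤ 1 := by
      have : 0 < Δ.card := Finset.card_pos.2 ⟨0, zero_mem_of_mem_clusters hΔ⟩
      rw [div_le_one (by exact_mod_cast this)]
      exact_mod_cast this
    rw [norm_mul, Real.norm_of_nonneg (by positivity : (0 : ℝ) ≤ 1 / Δ.card)]
    refine (mul_le_of_le_one_left (norm_nonneg _) h1).trans ?_
    refine (h.ext_le Δ 0 _ (Finset.mem_filter.1 hΔ).2).trans ?_
    exact mul_le_mul_of_nonneg_left (pinning_le_sum_energyNI D 0 η) hA

theorem translate_translate (i j : Site ν) (Δ : Finset (Site ν)) :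
    translate i (translate j Δ) = translate (i + j) Δ := by
  ext k
  simp only [mem_translate]
  rw [show k - i - j = k - (i + j) by abel]

theorem translate_zero (Δ : Finset (Site ν)) : translate 0 Δ = Δ := by
  ext k
  simp [mem_translate]

theorem card_translate (i : Site ν) (Δ : Finset (Site ν)) : (translate i Δ).card = Δ.card :=
  Finset.card_map _

theorem translate_ne_zero (hTI : TranslationInvariant W) {Δ : Finset (Site ν)} (hΔ : W Δ ≠ 0)
    (k : Site ν) : W (translate k Δ) ≠ 0 := by
  classical
  intro h0
  apply hΔ
  funext x
  let q : Site ν → Pos L := fun j => if hj : j ∈ Δ then x ⟨j, hj⟩ else 0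
  have h1 := hTI k Δ (fun j => q (j - k))
  have h2 : W.ext (translate k Δ) (fun j => q (j - k)) = 0 := by
    unfold Interaction.ext
    rw [h0]
    rfl
  rw [h2] at h1
  have h3 : W.ext Δ (fun j => q (j + k - k)) = W Δ x := by
    unfold Interaction.ext
    congr 1
    funext j
    simp [q]
  rw [h3] at h1
  exact h1.symm

theorem power_shift (hTI : TranslationInvariant W) (k : Site ν) (Δ : Finset (Site ν))
    (ω : Phase ν L) : power W (translate (-k) Δ) 0 (shift k ω) = power W Δ k ω := by
  unfold power
  have h1 := pgrad_shift hTI k 0 (translate (-k) Δ) (positions ω)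
  rw [translate_translate, add_neg_cancel, translate_zero, zero_add] at h1
  have h2 : positions (shift k ω) = fun j => positions ω (j + k) := rfl
  rw [h2, h1]
  simp [shift]

/-- Mass transport: averaging over the sites of a cluster does not change the sum over the
clusters which contain `0` of a translation invariant quantity. -/
theorem sum_clusters_average {D : ℕ} (hTI : TranslationInvariant W)
    (hrange : ∀ Δ : Finset (Site ν), W Δ ≠ 0 → ∀ i ∈ Δ, Δ ⊆ nbhd D i)
    (g : Finset (Site ν) → ℝ) (hg : ∀ Δ, W Δ = 0 → g Δ = 0) :
    ∑ Δ ∈ clusters ν D, 1 / (Δ.card : ℝ) * ∑ k ∈ Δ, g (translate (-k) Δ) =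
      ∑ Δ ∈ clusters ν D, g Δ := by
  classical
  -- A translate of a cluster may leave `nbhd D 0`, unless `W_Δ` is nonzero; the sums are therefore
  -- restricted to interacting clusters.
  let S := (clusters ν D).filter fun Δ => W Δ ≠ 0
  have hg' : ∀ Δ k, W Δ = 0 → g (translate (-k) Δ) = 0 := by
    intro Δ k hΔ
    apply hg
    by_contra hne
    have := translate_ne_zero hTI hne k
    rw [translate_translate, add_neg_cancel, translate_zero] at this
    exact this hΔ
  have h1 : ∑ Δ ∈ clusters ν D, 1 / (Δ.card : ℝ) * ∑ k ∈ Δ, g (translate (-k) Δ) =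
      ∑ Δ ∈ S, ∑ k ∈ Δ, 1 / (Δ.card : ℝ) * g (translate (-k) Δ) := by
    simp only [← Finset.mul_sum]
    refine (Finset.sum_filter_of_ne (p := fun Δ => W Δ ≠ 0) fun Δ _ hne h0 => hne ?_).symm
    simp [hg' Δ _ h0]
  have h2 : ∑ Δ ∈ clusters ν D, g Δ = ∑ Δ ∈ S, ∑ k ∈ Δ, 1 / (Δ.card : ℝ) * g Δ := by
    rw [← Finset.sum_filter_of_ne (p := fun Δ => W Δ ≠ 0) fun Δ _ hne h0 => hne (hg Δ h0)]
    refine Finset.sum_congr rfl fun Δ hΔ => ?_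
    have : 0 < Δ.card :=
      Finset.card_pos.2 ⟨0, zero_mem_of_mem_clusters (Finset.mem_filter.1 hΔ).1⟩
    rw [Finset.sum_const, nsmul_eq_mul]
    field_simp
  have hmem : ∀ Δ ∈ S, ∀ k ∈ Δ, translate (-k) Δ ∈ S ∧ -k ∈ translate (-k) Δ := by
    intro Δ hΔ k hk
    obtain ⟨h3, h4⟩ := Finset.mem_filter.1 hΔ
    have h5 := translate_ne_zero hTI h4 (-k)
    have h0 : (0 : Site ν) ∈ translate (-k) Δ := by rw [mem_translate]; simpa using hk
    refine ⟨Finset.mem_filter.2 ⟨Finset.mem_filter.2 ⟨Finset.mem_powerset.2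
      (hrange _ h5 0 h0), ?_⟩, h5⟩, ?_⟩
    · refine (Finset.singleton_subset_iff.2 h0).ssubset_of_ne fun he => ?_
      have h6 := Finset.card_lt_card (Finset.mem_filter.1 h3).2
      rw [← card_translate (-k) Δ, ← he] at h6
      simp at h6
    · rw [mem_translate, sub_self]
      exact zero_mem_of_mem_clusters h3
  have hinv : ∀ (k : Site ν) (Δ : Finset (Site ν)), translate (- -k) (translate (-k) Δ) = Δ := by
    intro k Δ
    rw [translate_translate, neg_neg, add_neg_cancel, translate_zero]
  rw [h1, h2, Finset.sum_sigma', Finset.sum_sigma']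
  -- The map `(Δ, k) ↦ (Δ - k, -k)` is an involution on pairs with `0, k ∈ Δ` and preserves `#Δ`.
  refine Finset.sum_nbij' (fun x => ⟨translate (-x.2) x.1, -x.2⟩)
    (fun x => ⟨translate (-x.2) x.1, -x.2⟩) ?_ ?_ ?_ ?_ ?_
  · rintro ⟨Δ, k⟩ hx
    rw [Finset.mem_sigma] at hx ⊢
    exact hmem Δ hx.1 k hx.2
  · rintro ⟨Δ, k⟩ hx
    rw [Finset.mem_sigma] at hx ⊢
    exact hmem Δ hx.1 k hx.2
  · rintro ⟨Δ, k⟩ -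
    simp [hinv, -neg_neg]
    simp
  · rintro ⟨Δ, k⟩ -
    simp [hinv, -neg_neg]
    simp
  · rintro ⟨Δ, k⟩ -
    rw [card_translate]

/-- Only shift invariance of `μ` is used: since the flow commutes with shifts, the mean power of `k`
in `Δ` at time `t` is that of `0` in `Δ - k`, and mass transport cancels the two sums. -/
theorem Controlled.integral_flux_flow {D : ℕ} {A : ℝ} (h : Controlled W D A)
    (hL : IsEuclideanOrTorus L) {μ : Measure (Phase ν L)} (hμ : MemI2 W μ) (t : ℝ) :
    ∫ ω, flux W D (flow W t ω) ∂μ = 0 := by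
  let g : Finset (Site ν) → ℝ := fun Δ => ∫ ω, power W Δ 0 (flow W t ω) ∂μ
  have hint : ∀ Δ ∈ clusters ν D, ∀ k ∈ Δ, Integrable (fun ω => power W Δ k (flow W t ω)) μ :=
    fun Δ hΔ k hk => h.integrable_power_flow hL hμ t (singleton_ssubset_of_mem_clusters hΔ hk)
  have hg : ∀ Δ k, ∫ ω, power W Δ k (flow W t ω) ∂μ = g (translate (-k) Δ) := by
    intro Δ k
    have h1 := integral_shift hμ k ((measurable_power hL h.regular (translate (-k) Δ) 0).comp
      (h.measurable_flow hL t))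
    simp only [Function.comp_apply, h.flow_shift, power_shift h.inv] at h1
    exact h1
  unfold flux
  have hI : ∀ Δ ∈ clusters ν D, Integrable (fun ω => 1 / (Δ.card : ℝ) *
      ∑ k ∈ Δ, power W Δ k (flow W t ω) - power W Δ 0 (flow W t ω)) μ := fun Δ hΔ =>
    ((integrable_finsetSum _ fun k hk => hint Δ hΔ k hk).const_mul _).sub
      (hint Δ hΔ 0 (zero_mem_of_mem_clusters hΔ))
  rw [integral_finsetSum _ hI]
  have h2 : ∀ Δ ∈ clusters ν D, ∫ ω, (1 / (Δ.card : ℝ) * ∑ k ∈ Δ, power W Δ k (flow W t ω) -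
      power W Δ 0 (flow W t ω)) ∂μ =
      1 / (Δ.card : ℝ) * ∑ k ∈ Δ, g (translate (-k) Δ) - g Δ := by
    intro Δ hΔ
    rw [integral_sub ((integrable_finsetSum _ fun k hk => hint Δ hΔ k hk).const_mul _)
      (hint Δ hΔ 0 (zero_mem_of_mem_clusters hΔ)), integral_const_mul,
      integral_finsetSum _ fun k hk => hint Δ hΔ k hk]
    simp only [hg, neg_zero, translate_zero]
  rw [Finset.sum_congr rfl h2, Finset.sum_sub_distrib,
    sum_clusters_average h.inv h.subset_nbhd g fun Δ hΔ => ?_, sub_self]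
  simp [g, power, pgrad_zero _ _ hΔ]

/-- Differentiation under the integral, with the majorant of the flux on a neighborhood of `t`; the
derivative is the mean flux, which vanishes at every time. -/
theorem Controlled.integral_energy_flow {D : ℕ} {A : ℝ} (h : Controlled W D A)
    (hL : IsEuclideanOrTorus L) {μ : Measure (Phase ν L)} (hμ : MemI2 W μ) (t : ℝ) :
    ∫ ω, energy W 0 (flow W t ω) ∂μ = ∫ ω, energy W 0 (flow W 0 ω) ∂μ := by
  have hd : ∀ t, HasDerivAt (fun t => ∫ ω, energy W 0 (flow W t ω) ∂μ) 0 t := by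
    intro t
    obtain ⟨G, hG, hb⟩ := h.exists_integrable_bound_flux hL hμ (|t| + 1)
    have := (hasDerivAt_integral_of_dominated_loc_of_deriv_le (𝕜 := ℝ) (μ := μ) (x₀ := t)
      (F := fun t ω => energy W 0 (flow W t ω)) (F' := fun t ω => flux W D (flow W t ω))
      (s := Icc (-(|t| + 1)) (|t| + 1)) (bound := G)
      (Icc_mem_nhds (by linarith [neg_abs_le t]) (by linarith [le_abs_self t]))
      (Eventually.of_forall fun s => (h.integrable_energy_flow hL hμ s).aestronglyMeasurable)
      (h.integrable_energy_flow hL hμ t)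
      ((measurable_flux hL h.regular D).comp (h.measurable_flow hL t)).aestronglyMeasurable
      ?_ hG ?_).2
    · rwa [h.integral_flux_flow hL hμ t] at this
    · filter_upwards [h.ae_mem_Omega2 hL hμ] with ω hω s hs
      exact hb ω hω s (abs_le.2 hs)
    · filter_upwards [h.ae_mem_Omega2 hL hμ] with ω hω s _
      obtain ⟨⟨hsol, -⟩, h0⟩ := h.isTrajectory_flow hω
      obtain ⟨q, p, hqp⟩ := exists_phase_eq ω
      obtain ⟨Q, P, hy, -, -, hQ, hP⟩ := hsol.exists_lift (q := q) (p := p)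
        (by rw [hqp]; exact h0)
      simp only [hy]
      exact h.hasDerivAt_energy hQ hP s
  exact is_const_of_deriv_eq_zero (fun t => (hd t).differentiableAt) (fun t => (hd t).deriv) t 0

theorem Controlled.flow_zero {D : ℕ} {A : ℝ} (h : Controlled W D A) (ω : Phase ν L) :
    flow W 0 ω = ω := by
  by_cases hω : ω ∈ Omega2 W
  · exact (h.isTrajectory_flow hω).2
  · exact flow_of_notMem hω 0

end Conservation

end AnharmonicCrystal

theorem proposition3p3 {ν d : ℕ} (L : AddSubgroup (AnharmonicCrystal.Mom d))
    (hL : AnharmonicCrystal.IsEuclideanOrTorus L)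
    (W : AnharmonicCrystal.Interaction ν L)
    (hF : AnharmonicCrystal.FiniteRange W)
    (hR : AnharmonicCrystal.Regular W)
    (hTI : AnharmonicCrystal.TranslationInvariant W)
    (hP1 : AnharmonicCrystal.OnSiteNonneg W)
    (hP2 : AnharmonicCrystal.PinningConv W)
    (hP3 : AnharmonicCrystal.PinningGrowth W)
    (hD1 : AnharmonicCrystal.ForceDominated W)
    (hD2 : AnharmonicCrystal.EnergyDominated W)
    (hD3 : AnharmonicCrystal.HessianDominated W) :
    (∀ ω ∈ AnharmonicCrystal.Omega2 W,
      ∃! y : ℝ → AnharmonicCrystal.Phase ν L, AnharmonicCrystal.IsTrajectory W y ∧ y 0 = ω) ∧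
    ∀ μ : MeasureTheory.Measure (AnharmonicCrystal.Phase ν L), AnharmonicCrystal.MemI2 W μ →
      MeasureTheory.Integrable (fun ω => AnharmonicCrystal.energy W 0 ω) μ ∧
      ∀ t : ℝ,
        MeasureTheory.Integrable
          (fun ω => AnharmonicCrystal.energy W 0 (AnharmonicCrystal.flow W t ω)) μ ∧
        ∫ ω, AnharmonicCrystal.energy W 0 ω ∂μ =
          ∫ ω, AnharmonicCrystal.energy W 0 (AnharmonicCrystal.flow W t ω) ∂μ := by
  obtain ⟨D, A, h⟩ := AnharmonicCrystal.exists_controlled hF hR hTI hP1 hP2 hP3 hD1 hD2 hD3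
  refine ⟨fun ω hω => h.existsUnique_trajectory hω, fun μ hμ => ⟨?_, fun t =>
    ⟨h.integrable_energy_flow hL hμ t, ?_⟩⟩⟩
  · simpa only [h.flow_zero] using h.integrable_energy_flow hL hμ 0
  · rw [h.integral_energy_flow hL hμ t]
    simp only [h.flow_zero]
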